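/- **Setting.** Let $T$ and $X$ be standard Borel spaces, let $\mathcal E\to X$ be a measurable vector bundle of rank $d$ with a measurable Euclidean norm $\|\cdot\|$ (the exterior powers $\wedge^k\mathcal E$ carry the induced Euclidean norms), let $f:T\times T\times X\to X$ be measurable, and let $F:T\times T\times\mathcal E\to\mathcal E$ be a measurable edge random linear bundle morphism covering $f$: each $F_{t,s,x}:\mathcal E_x\to\mathcal E_{f_{t,s}(x)}$ is linear. Let $Q(t,ds)$ be a transition probability kernel on $T$, and let $\nu$ be a probability measure on $T\times X$ that is stationary, i.e. invariant under $P\varphi(t,x)=\int\varphi(s,f_{t,s}(x))\,Q(t,ds)$. The driving measure $m$ on $T^{\mathbb N}\times X$ is the law of $((t_n)_{n\ge0},x_0)$, where $(t_n,x_n)_{n\ge0}$ is the Markov chain on $T\times X$ with initial law $\nu$ and transition kernel $q((t,x),C)=\int 1_C(s,f_{t,s}(x))\,Q(t,ds)$. Put $\mathcal F(\omega,x)=(\sigma\omega,f_{\omega_0,\omega_1}(x))$ with $\sigma$ the shift, $F_{(\omega,x)}=F_{\omega_0,\omega_1,x}$, $F^n_{(\omega,x)}=F_{\mathcal F^{n-1}(\omega,x)}\circ\cdots\circ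 F_{(\omega,x)}$, and assume $$\int\log^+\|F_{(\omega,x)}\|\,dm<\infty .$$ Let $\Sigma_0(m)=0$ and, for $1\le k\le d$, $\Sigma_k(m)=\lim_{n\to\infty}\frac1n\int\log\|\wedge^kF^n_{(\omega,x)}\|\,dm\in[-\infty,\infty)$. The Lyapunov exponents are $\lambda_k(m)=\Sigma_k(m)-\Sigma_{k-1}(m)$ if $\Sigma_{k-1}(m)>-\infty$, and $\lambda_k(m)=-\infty$ otherwise. Let $\hat{\mathcal E}_k$ be the projective bundle $\mathrm P(\wedge^k\mathcal E)$ with an isolated cemetery point $\Delta_x$ adjoined to each fibre, let $\Delta=\bigsqcup_x\Delta_x$, and let $\pi_k(t,x,[v])=(t,x)$ on $T\times\hat{\mathcal E}_k$. Set $[\wedge^kF_{t,s,x}v]=\Delta_{f_{t,s}(x)}$ and $\log\frac{\|\wedge^kF_{t,s,x}v\|}{\|v\|}=-\infty$ if $\wedge^kF_{t,s,x}v=0$ or $[v]=\Delta_x$. Define the annealed operator and potential $$\hat P_k\psi(t,x,[v])=\int\psi\bigl(s,f_{t,s}(x),[\wedge^kF_{t,s,x}v]\bigr)\,Q(t,ds),\qquad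 \hat\phi_k(t,x,[v])=\int\log\frac{\|\wedge^kF_{t,s,x}v\|}{\|v\|}\,Q(t,ds).$$ Let $\mathcal I_\nu(\hat P_k)$ be the convex set of $\hat P_k$-invariant probability measures $\hat\nu$ on $T\times\hat{\mathcal E}_k$ with $(\pi_k)_*\hat\nu=\nu$. An invariant probability measure is called ergodic if it is an extreme point of the set of all invariant probability measures of the operator. **Statement.** For every $k=1,\dots,d$, the limit defining $\Sigma_k(m)$ exists and equals $\sum_{i=1}^k\lambda_i(m)$, and $$\sum_{i=1}^k\lambda_i(m)=\sup\Bigl\{\int\hat\phi_k\,d\hat\nu:\ \hat\nu\in\mathcal I_\nu(\hat P_k)\Bigr\}.$$ Moreover, the supremum is attained at an extreme point $\hat\nu_*$ of $\mathcal I_\nu(\hat P_k)$; if $\nu$ is ergodic, then $\hat\nu_*$ is an ergodic $\hat P_k$-invariant measure, and if every $F_{t,s,x}$ is injective, then $\hat\nu_*$ can be chosen (simultaneously) with $\hat\nu_*(T\times\Delta)=0$, so that no cemetery is needed. Finally, if $\lambda_k(m)>-\infty$, then every maximizing $\hat\nu\in\mathcal I_\nu(\hat P_k)$ gives zero mass to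 the degeneracy locus $$(T\times\Delta)\cup\bigl\{(t,x,[v]):\ Q\bigl(t,\{s:\wedge^kF_{t,s,x}v=0\}\bigr)>0\bigr\}$$ and to the set $\{\hat\phi_k=-\infty\}$. -/

import Mathlib

open MeasureTheory ProbabilityTheory Filter Topology
open scoped ENNReal LinearAlgebra.Projectivization

noncomputable section

/-! ### Integrals of extended real functions -/

/-- The integral `∫ g⁺ dμ - ∫ g⁻ dμ` of a function with values in `[-∞, ∞]`.  It is the usual
integral as soon as one of the two terms is finite (and equals `-∞` if both are infinite). -/
def extIntegral {α : Type*} [MeasurableSpace α] (μ : Measure α) (g : α → EReal) : EReal :=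
  ((∫⁻ a, (g a).toENNReal ∂μ : ℝ≥0∞) : EReal) - ((∫⁻ a, (-(g a)).toENNReal ∂μ : ℝ≥0∞) : EReal)

/-! ### Invariant measures of operators on bounded measurable functions -/

/-- Probability measures `μ` with `∫ P ψ dμ = ∫ ψ dμ` for all bounded measurable `ψ`, where `P`
is an operator on bounded measurable functions. -/
def invariantMeasures {Z : Type*} [MeasurableSpace Z] (P : (Z → ℝ) → Z → ℝ) : Set (Measure Z) :=
  {μ | IsProbabilityMeasure μ ∧
    ∀ ψ : Z → ℝ, Measurable ψ → (∃ C, ∀ z, |ψ z| ≤ C) → ∫ z, P ψ z ∂μ = ∫ z, ψ z ∂μ}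

/-- Ergodic measures are the extreme points of the convex set of invariant probability measures. -/
def ergodicMeasures {Z : Type*} [MeasurableSpace Z] (P : (Z → ℝ) → Z → ℝ) : Set (Measure Z) :=
  (invariantMeasures P).extremePoints ℝ≥0∞

/-! ### Measurable Euclidean vector bundles -/

/-- A measurable vector bundle of rank `d` over `X` with fibres `E x`, given by a countable
measurable atlas; the Euclidean norms of the fibres depend measurably on the base point. -/
structure MeasurableEuclideanBundle {X : Type*} [MeasurableSpace X] (d : ℕ) (E : X → Type*)
    [∀ x, NormedAddCommGroup (E x)] [∀ x, InnerProductSpace ℝ (E x)] where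
  baseSet : ℕ → Set X
  measurableSet_baseSet : ∀ i, MeasurableSet (baseSet i)
  iUnion_baseSet : ⋃ i, baseSet i = Set.univ
  /-- the linear chart of the fibre over a point of `baseSet i` -/
  triv : ∀ (i : ℕ) (x : baseSet i), E x ≃ₗ[ℝ] (Fin d → ℝ)
  measurable_coordChange : ∀ i j : ℕ,
    Measurable fun p : ↥(baseSet i ∩ baseSet j) × (Fin d → ℝ) =>
      triv j ⟨p.1, p.1.2.2⟩ ((triv i ⟨p.1, p.1.2.1⟩).symm p.2)
  measurable_norm : ∀ i : ℕ,
    Measurable fun p : baseSet i × (Fin d → ℝ) => ‖(triv i p.1).symm p.2‖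

namespace MeasurableEuclideanBundle

variable {X : Type*} [MeasurableSpace X] {d : ℕ} {E : X → Type*}
  [∀ x, NormedAddCommGroup (E x)] [∀ x, InnerProductSpace ℝ (E x)]

/-- The total space of the vector bundle. -/
structure Total (_B : MeasurableEuclideanBundle d E) where
  pt : X
  vec : E pt

/-- A set is measurable in the total space iff it is measurable in each chart. -/
instance (B : MeasurableEuclideanBundle d E) : MeasurableSpace B.Total :=
  ⨅ i, MeasurableSpace.map
    (fun p : B.baseSet i × (Fin d → ℝ) => (⟨p.1, (B.triv i p.1).symm p.2⟩ : B.Total))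
    inferInstance

/-- The local frame of `⋀^k E` induced by the `i`-th chart. -/
def wedgeFrame (B : MeasurableEuclideanBundle d E) (k i : ℕ) (x : B.baseSet i) :
    Module.Basis (Set.powersetCard (Fin d) k) ℝ (⋀[ℝ]^k (E x)) :=
  (Module.Basis.ofEquivFun (B.triv i x)).exteriorPower k

/-- The projective bundle `P(⋀^k E)` with a cemetery point adjoined to every fibre: the element
`⟨x, some [v]⟩` is the line spanned by `v ∈ ⋀^k E_x`, and `⟨x, none⟩` is the cemetery point
`Δ_x`. -/
structure Proj (_B : MeasurableEuclideanBundle d E) (k : ℕ) where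
  pt : X
  dir : Option (ℙ ℝ (⋀[ℝ]^k (E pt)))

/-- Homogeneous coordinates on `P(⋀^k E)` in the `i`-th chart. -/
def projCoord (B : MeasurableEuclideanBundle d E) (k i : ℕ)
    (p : B.baseSet i × {c : Set.powersetCard (Fin d) k → ℝ // c ≠ 0}) : B.Proj k :=
  ⟨p.1, some (Projectivization.mk ℝ ((B.wedgeFrame k i p.1).equivFun.symm p.2)
    ((LinearEquiv.map_ne_zero_iff _).2 p.2.2))⟩

/-- A set is measurable in the projective bundle with cemetery iff its trace on the cemetery
section is measurable and it is measurable in the homogeneous coordinates of every chart. -/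
instance (B : MeasurableEuclideanBundle d E) (k : ℕ) : MeasurableSpace (B.Proj k) :=
  (MeasurableSpace.map (fun x : X => (⟨x, none⟩ : B.Proj k)) inferInstance) ⊓
    ⨅ i, MeasurableSpace.map (B.projCoord k i) inferInstance

end MeasurableEuclideanBundle

/-! ### Norm growth and projective action of a linear map on exterior powers -/

section LinearAlgebra

variable {V W : Type*} [NormedAddCommGroup V] [InnerProductSpace ℝ V] [FiniteDimensional ℝ V]
  [NormedAddCommGroup W] [InnerProductSpace ℝ W] [FiniteDimensional ℝ W]

/-- The operator norm of a linear map between finite-dimensional Euclidean spaces. -/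
def linOpNorm (L : V →ₗ[ℝ] W) : ℝ := ‖LinearMap.toContinuousLinearMap L‖

/-- `log ‖⋀^k L‖`, with `log 0 = -∞`. -/
def logWedgeNorm (k : ℕ) (L : V →ₗ[ℝ] W) : EReal :=
  ENNReal.log (ENNReal.ofReal (linOpNorm (exteriorPower.map k L)))

/-- `log (‖⋀^k L v‖ / ‖v‖)` at the line `[v]`, and `-∞` if `⋀^k L v = 0` or at the cemetery
point.  The quotient does not depend on the vector spanning the line. -/
def logStretch (k : ℕ) (L : V →ₗ[ℝ] W) : Option (ℙ ℝ (⋀[ℝ]^k V)) → EReal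
  | none => ⊥
  | some p => ENNReal.log (ENNReal.ofReal (‖exteriorPower.map k L p.rep‖ / ‖p.rep‖))

open Classical in
/-- The action `[v] ↦ [⋀^k L v]`; lines in the kernel and the cemetery point are sent to the
cemetery point. -/
def projAction (k : ℕ) (L : V →ₗ[ℝ] W) :
    Option (ℙ ℝ (⋀[ℝ]^k V)) → Option (ℙ ℝ (⋀[ℝ]^k W))
  | none => none
  | some p =>
    if h : exteriorPower.map k L p.rep = 0 then none
    else some (Projectivization.mk ℝ (exteriorPower.map k L p.rep) h)

end LinearAlgebra

/-! ### Edge random bundle morphisms -/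

/-- An edge random linear bundle morphism `F : T × T × E → E` covering an edge random map
`f : T × T × X → X`. -/
structure EdgeBundleMorphism (T : Type*) [MeasurableSpace T] {X : Type*} [MeasurableSpace X]
    {d : ℕ} {E : X → Type*} [∀ x, NormedAddCommGroup (E x)] [∀ x, InnerProductSpace ℝ (E x)]
    (B : MeasurableEuclideanBundle d E) where
  /-- the edge random map -/
  base : T → T → X → X
  measurable_base : Measurable fun p : T × T × X => base p.1 p.2.1 p.2.2
  /-- the linear maps `F_{t,s,x} : E_x → E_{f_{t,s}(x)}` -/
  lin : ∀ (t s : T) (x : X), E x →ₗ[ℝ] E (base t s x)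
  measurable_lin : Measurable fun p : T × T × B.Total =>
    (⟨base p.1 p.2.1 p.2.2.pt, lin p.1 p.2.1 p.2.2.pt p.2.2.vec⟩ : B.Total)

namespace EdgeBundleMorphism

variable {T : Type*} [MeasurableSpace T] {X : Type*} [MeasurableSpace X] {d : ℕ} {E : X → Type*}
  [∀ x, NormedAddCommGroup (E x)] [∀ x, InnerProductSpace ℝ (E x)]
  {B : MeasurableEuclideanBundle d E}

/-! #### The driving measure -/

/-- The transition kernel `q((t,x), ·)` on `T × X`: the law of `(s, f_{t,s}(x))` for
`s ∼ Q(t, ·)`. -/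
def stepKernel (F : EdgeBundleMorphism T B) (Q : Kernel T T) : Kernel (T × X) (T × X) :=
  (Kernel.id ×ₖ (Q.comap Prod.fst measurable_fst)).map
    fun p : (T × X) × T => (p.2, F.base p.1.1 p.2 p.1.2)

lemma measurable_step (F : EdgeBundleMorphism T B) :
    Measurable fun p : (T × X) × T => (p.2, F.base p.1.1 p.2 p.1.2) :=
  measurable_snd.prodMk (F.measurable_base.comp
    (measurable_fst.fst.prodMk (measurable_snd.prodMk measurable_fst.snd)))

instance (F : EdgeBundleMorphism T B) (Q : Kernel T T) [IsMarkovKernel Q] :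
    IsMarkovKernel (F.stepKernel Q) :=
  Kernel.IsMarkovKernel.map _ F.measurable_step

/-- The law on `(T × X)^ℕ` of the Markov chain with kernel `q` and initial law `ν`. -/
def chainMeasure (F : EdgeBundleMorphism T B) (Q : Kernel T T) [IsMarkovKernel Q]
    (ν : Measure (T × X)) : Measure (ℕ → T × X) :=
  Kernel.trajMeasure (X := fun _ : ℕ => T × X) ν
    (fun n => (F.stepKernel Q).comap
      (fun h : (Π _ : Finset.Iic n, T × X) => h ⟨n, Finset.mem_Iic.2 le_rfl⟩)
      (measurable_pi_apply _))

/-- The driving measure `m` on `T^ℕ × X`: the law of `((t_n)_n, x_0)`. -/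
def drivingMeasure (F : EdgeBundleMorphism T B) (Q : Kernel T T) [IsMarkovKernel Q]
    (ν : Measure (T × X)) : Measure ((ℕ → T) × X) :=
  (F.chainMeasure Q ν).map fun z => (fun n => (z n).1, (z 0).2)

/-! #### The cocycle and its Lyapunov exponents -/

/-- The edge-driven skew product `(ω, x) ↦ (σ ω, f_{ω₀,ω₁}(x))`. -/
def skew (F : EdgeBundleMorphism T B) (z : (ℕ → T) × X) : (ℕ → T) × X :=
  (fun n => z.1 (n + 1), F.base (z.1 0) (z.1 1) z.2)

/-- `F_{(ω,x)} = F_{ω₀,ω₁,x}`. -/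
def cocycle (F : EdgeBundleMorphism T B) (z : (ℕ → T) × X) : E z.2 →ₗ[ℝ] E (F.skew z).2 :=
  F.lin (z.1 0) (z.1 1) z.2

/-- The iterates `F^n_{(ω,x)}`. -/
def iter (F : EdgeBundleMorphism T B) :
    ∀ (n : ℕ) (z : (ℕ → T) × X), E z.2 →ₗ[ℝ] E ((F.skew)^[n] z).2
  | 0, _ => LinearMap.id
  | n + 1, z => (F.iter n (F.skew z)) ∘ₗ (F.cocycle z)

variable [∀ x, FiniteDimensional ℝ (E x)]

/-- `(1/n) ∫ log ‖⋀^k F^n_{(ω,x)}‖ dm`. -/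
def meanGrowth (F : EdgeBundleMorphism T B) (Q : Kernel T T) [IsMarkovKernel Q]
    (ν : Measure (T × X)) (k n : ℕ) : EReal :=
  (((n : ℝ)⁻¹ : ℝ) : EReal) *
    extIntegral (F.drivingMeasure Q ν) fun z => logWedgeNorm k (F.iter n z)

/-- `Σ_k(m)`, the growth rate of `log ‖⋀^k F^n‖` (the limit of the mean growth), and
`Σ_0(m) = 0`. -/
def growthRate (F : EdgeBundleMorphism T B) (Q : Kernel T T) [IsMarkovKernel Q]
    (ν : Measure (T × X)) (k : ℕ) : EReal :=
  if k = 0 then 0 else limsup (fun n => F.meanGrowth Q ν k n) atTop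

open Classical in
/-- The Lyapunov exponents `λ_k(m)`, `k ≥ 1`: `Σ_k(m) - Σ_{k-1}(m)` if `Σ_{k-1}(m) > -∞`, and
`-∞` otherwise. -/
def lyapunov (F : EdgeBundleMorphism T B) (Q : Kernel T T) [IsMarkovKernel Q]
    (ν : Measure (T × X)) (k : ℕ) : EReal :=
  if F.growthRate Q ν (k - 1) = ⊥ then ⊥
  else F.growthRate Q ν k - F.growthRate Q ν (k - 1)

/-! #### The annealed operators and potential -/

/-- `P φ (t,x) = ∫ φ(s, f_{t,s}(x)) Q(t,ds)`. -/
def baseOperator (F : EdgeBundleMorphism T B) (Q : Kernel T T) (φ : T × X → ℝ) (z : T × X) : ℝ :=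
  ∫ s, φ (s, F.base z.1 s z.2) ∂(Q z.1)

/-- `P̂_k ψ (t,x,[v]) = ∫ ψ(s, f_{t,s}(x), [⋀^k F_{t,s,x} v]) Q(t,ds)`. -/
def annealedOperator (F : EdgeBundleMorphism T B) (Q : Kernel T T) (k : ℕ)
    (ψ : T × B.Proj k → ℝ) (z : T × B.Proj k) : ℝ :=
  ∫ s, ψ (s, ⟨F.base z.1 s z.2.pt, projAction k (F.lin z.1 s z.2.pt) z.2.dir⟩) ∂(Q z.1)

/-- `φ̂_k(t,x,[v]) = ∫ log (‖⋀^k F_{t,s,x} v‖ / ‖v‖) Q(t,ds)`. -/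
def annealedPotential (F : EdgeBundleMorphism T B) (Q : Kernel T T) (k : ℕ)
    (z : T × B.Proj k) : EReal :=
  extIntegral (Q z.1) fun s => logStretch k (F.lin z.1 s z.2.pt) z.2.dir

/-- The `P̂_k`-invariant probability measures on `T × P(⋀^k E)` (with cemetery) projecting
to `ν`. -/
def invariantLifts (F : EdgeBundleMorphism T B) (Q : Kernel T T) (ν : Measure (T × X)) (k : ℕ) :
    Set (Measure (T × B.Proj k)) :=
  {μ ∈ invariantMeasures (F.annealedOperator Q k) | μ.map (fun z => (z.1, z.2.pt)) = ν}

/-- The cemetery section. -/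
def cemetery (_F : EdgeBundleMorphism T B) (k : ℕ) : Set (T × B.Proj k) :=
  {z | z.2.dir = none}

/-- The degeneracy locus: the cemetery section together with the points `(t,x,[v])` such that
`⋀^k F_{t,s,x} v = 0` with positive `Q(t,ds)`-probability. -/
def degeneracyLocus (F : EdgeBundleMorphism T B) (Q : Kernel T T) (k : ℕ) :
    Set (T × B.Proj k) :=
  F.cemetery k ∪
    {z | ∃ p, z.2.dir = some p ∧ 0 < Q z.1 {s | exteriorPower.map k (F.lin z.1 s z.2.pt) p.rep = 0}}

end EdgeBundleMorphism

end

/-! Write Y = T × X, with the transition kernel q of the chain. A measurable choice of orthonormal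
frames (Gram–Schmidt in the first chart containing the point) turns `⋀^k F` into a measurable
cocycle A(y, y') on the fixed space V = `⋀^k ℝ^d`, and the driving measure m into the path law of
the stationary chain on Y. The means of log‖A^n‖ are subadditive, so by Fekete their averages
converge to an infimum, `pathRate`, which is Σ_k. Everything else compares this number with
invariant laws of the induced chain of lines.

Upper bound (`ProjModel.extIntegral_potential_le`). Let μ be an invariant lift whose potential has
integral above -∞. It does not charge the cemetery, so its lines carry unit vectors. Along the chain
of vectors the mean of log‖v_n‖ telescopes into n integrals of the potential, all equal by
invariance. Given the base path, v_n is the path product applied to v_0, so this mean is at most the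
mean of log‖A^n‖. Divide by n.

Lower bound (`ProjModel.exists_pathRate_le_average`). A standard Gaussian vector c satisfies E
log‖Lc‖ ≥ log‖L‖ - const, the constant being independent of L. Started from Gaussian vectors, the
time averages of the laws of the lines therefore have potential integral at least Σ_k - C/n, and
they are invariant up to O(1/n).

Passage to the limit when Σ_k > -∞. Measures over a fixed marginal ν, with compact fibres, are
compact when tested against Carathéodory functions (`exists_limit_of_fst_eq`). The action on lines
is discontinuous only where a vector is killed; the lower bound on the potential makes strong
contraction rare (`isTightFamily_of_le_potential`), so the limit is invariant
(`kernel_comp_eq_of_tendstoLift`). The potential is a decreasing limit of continuous functionals,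
hence upper semicontinuous, and the limit attains Σ_k. The maximizers form a compact face; a
maximizer on it of a strictly convex continuous functional is an extreme point
(`exists_mem_extremePoints`).

When Σ_k = -∞ every lift has integral -∞, so any extreme lift works: the cemetery section in
general, and for an injective cocycle a lift off the cemetery, where tightness comes from
injectivity alone.

The remaining claims are soft. The sum of exponents telescopes to Σ_k because Σ_k = -∞ forces
Σ_{k+1} = -∞, by ‖⋀^{k+1} L‖ ≤ C ‖L‖ ‖⋀^k L‖. An extreme point of the fibre over an extreme ν is
extreme among all invariant measures. The degeneracy locus lies in the set where the potential is
-∞, which is null as soon as the integral is not -∞. -/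

noncomputable section

/-! ### Integrals of functions with values in `[-∞, ∞]` -/

lemma EReal.toENNReal_sub_toENNReal_neg (x : EReal) :
    (x.toENNReal : EReal) - ((-x).toENNReal : EReal) = x := by
  rcases le_total 0 x with h | h
  · rw [EReal.coe_toENNReal h, EReal.toENNReal_of_nonpos (by simpa using h)]; simp
  · rw [EReal.coe_toENNReal (x := -x) (by simpa using h), EReal.toENNReal_of_nonpos h]; simp

/-- Additivity written without subtraction: positive and negative parts are distributed over both
sides so that the identity can be integrated term by term even when negative parts have infinite
integral. -/
lemma EReal.toENNReal_add_balance {x y : EReal} (hx : x ≠ ⊤) (hy : y ≠ ⊤) :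
    (x + y).toENNReal + (-x).toENNReal + (-y).toENNReal
      = (-(x + y)).toENNReal + x.toENNReal + y.toENNReal := by
  induction x with
  | top => exact absurd rfl hx
  | bot => simp
  | coe a =>
    induction y with
    | top => exact absurd rfl hy
    | bot => simp
    | coe b =>
      norm_cast
      simp only [EReal.real_coe_toENNReal]
      have key : ∀ a : ℝ, ENNReal.ofReal a = ENNReal.ofReal (max a 0) := fun a => by
        rcases le_total a 0 with h | h
        · rw [max_eq_right h, ENNReal.ofReal_of_nonpos h, ENNReal.ofReal_zero]
        · rw [max_eq_left h]
      rw [key (a + b), key (-a), key (-b), key (-(a + b)), key a, key b,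
        ← ENNReal.ofReal_add (by positivity) (by positivity),
        ← ENNReal.ofReal_add (by positivity) (by positivity),
        ← ENNReal.ofReal_add (by positivity) (by positivity),
        ← ENNReal.ofReal_add (by positivity) (by positivity)]
      congr 1
      rcases le_total a 0 with h | h <;> rcases le_total b 0 with h' | h' <;>
        rcases le_total (a + b) 0 with h'' | h'' <;>
        simp only [max_eq_left, max_eq_right, h, h', h'', Left.neg_nonpos_iff, Left.nonneg_neg_iff] <;> linarith

lemma EReal.coe_ennreal_sub_le (p n : ℝ≥0∞) : (p : EReal) - n ≤ p := by
  refine EReal.sub_le_of_le_add' ?_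
  rw [add_comm]
  exact le_add_of_nonneg_right (EReal.coe_ennreal_nonneg _)

/-- Turns an integrated balance back into an identity of differences. Only the positive parts have
to be finite: if `n₁` or `n₂` is infinite then so is `n`, and both sides are -∞. -/
lemma ENNReal.coe_sub_coe_of_balance {p p₁ p₂ n n₁ n₂ : ℝ≥0∞} (hp : p ≠ ⊤) (hp₁ : p₁ ≠ ⊤)
    (hp₂ : p₂ ≠ ⊤) (h : p + n₁ + n₂ = n + p₁ + p₂) :
    (p : EReal) - n = ((p₁ : EReal) - n₁) + ((p₂ : EReal) - n₂) := by
  lift p to NNReal using hp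
  lift p₁ to NNReal using hp₁
  lift p₂ to NNReal using hp₂
  induction n₁ with
  | top =>
    have : n = ⊤ := by
      by_contra hn
      have h2 : n + p₁ + p₂ ≠ ⊤ := by simp [hn]
      exact h2 (h ▸ by simp)
    subst this
    rw [EReal.coe_ennreal_top]
    have : ∀ x : NNReal, ((x : ℝ≥0∞) : EReal) - ⊤ = ⊥ := fun x => by
      rw [EReal.sub_top]
    rw [this, this, EReal.bot_add]
  | coe n₁ =>
    induction n₂ with
    | top =>
      have : n = ⊤ := by
        by_contra hn
        have h2 : n + p₁ + p₂ ≠ ⊤ := by simp [hn]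
        exact h2 (h ▸ by simp)
      subst this
      rw [EReal.coe_ennreal_top]
      have : ∀ x : NNReal, ((x : ℝ≥0∞) : EReal) - ⊤ = ⊥ := fun x => by
        rw [EReal.sub_top]
      rw [this, this, EReal.add_bot]
    | coe n₂ =>
      induction n with
      | top => exact absurd h (by simp)
      | coe n =>
        norm_cast at h
        have h' : (p : ℝ) + n₁ + n₂ = n + p₁ + p₂ := by exact_mod_cast h
        simp only [EReal.coe_nnreal_eq_coe_real]
        norm_cast
        linarith

section ExtIntegral

variable {α β : Type*} [MeasurableSpace α] [MeasurableSpace β] {μ : Measure α}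

lemma Measurable.toENNReal_neg {f : α → EReal} (hf : Measurable f) :
    Measurable fun a => (-(f a)).toENNReal :=
  hf.neg.ereal_toENNReal

lemma extIntegral_congr_ae {f g : α → EReal} (h : f =ᵐ[μ] g) :
    extIntegral μ f = extIntegral μ g := by
  have h1 : ∫⁻ a, (f a).toENNReal ∂μ = ∫⁻ a, (g a).toENNReal ∂μ :=
    lintegral_congr_ae (h.mono fun a ha => by simp only [ha])
  have h2 : ∫⁻ a, (-(f a)).toENNReal ∂μ = ∫⁻ a, (-(g a)).toENNReal ∂μ :=
    lintegral_congr_ae (h.mono fun a ha => by simp only [ha])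
  rw [extIntegral, extIntegral, h1, h2]

lemma extIntegral_mono_ae {f g : α → EReal} (h : ∀ᵐ a ∂μ, f a ≤ g a) :
    extIntegral μ f ≤ extIntegral μ g := by
  unfold extIntegral
  refine EReal.sub_le_sub ?_ ?_
  · exact EReal.coe_ennreal_le_coe_ennreal_iff.2
      (lintegral_mono_ae (h.mono fun a ha => EReal.toENNReal_le_toENNReal ha))
  · exact EReal.coe_ennreal_le_coe_ennreal_iff.2
      (lintegral_mono_ae (h.mono fun a ha =>
        EReal.toENNReal_le_toENNReal (EReal.neg_le_neg_iff.2 ha)))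

lemma extIntegral_map {φ : α → β} (hφ : Measurable φ) {g : β → EReal} (hg : Measurable g) :
    extIntegral (μ.map φ) g = extIntegral μ (fun a => g (φ a)) := by
  unfold extIntegral
  rw [lintegral_map hg.ereal_toENNReal hφ, lintegral_map hg.toENNReal_neg hφ]

lemma ae_ne_top_of_lintegral_toENNReal {f : α → EReal} (hf : Measurable f)
    (h : ∫⁻ a, (f a).toENNReal ∂μ ≠ ⊤) : ∀ᵐ a ∂μ, f a ≠ ⊤ := by
  filter_upwards [ae_lt_top hf.ereal_toENNReal h] with a ha h'
  simp [h'] at ha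

lemma extIntegral_add {f g : α → EReal} (hf : Measurable f) (hg : Measurable g)
    (hf' : ∫⁻ a, (f a).toENNReal ∂μ ≠ ⊤) (hg' : ∫⁻ a, (g a).toENNReal ∂μ ≠ ⊤) :
    extIntegral μ (fun a => f a + g a) = extIntegral μ f + extIntegral μ g := by
  unfold extIntegral
  have hfg : Measurable fun a => f a + g a := hf.add hg
  refine ENNReal.coe_sub_coe_of_balance ?_ hf' hg' ?_
  · refine ne_top_of_le_ne_top (ENNReal.add_ne_top.2 ⟨hf', hg'⟩) ?_
    rw [← lintegral_add_left hf.ereal_toENNReal]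
    exact lintegral_mono fun a => EReal.toENNReal_add_le
  · rw [← lintegral_add_left hfg.ereal_toENNReal,
      ← lintegral_add_left (f := fun a => (f a + g a).toENNReal + (-(f a)).toENNReal)
        (hfg.ereal_toENNReal.add hf.toENNReal_neg),
      ← lintegral_add_left hfg.toENNReal_neg,
      ← lintegral_add_left (f := fun a => (-(f a + g a)).toENNReal + (f a).toENNReal)
        (hfg.toENNReal_neg.add hf.ereal_toENNReal)]
    refine lintegral_congr_ae ?_
    filter_upwards [ae_ne_top_of_lintegral_toENNReal hf hf',
      ae_ne_top_of_lintegral_toENNReal hg hg'] with a h₁ h₂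
    exact EReal.toENNReal_add_balance h₁ h₂

lemma extIntegral_coe_of_integrable {f : α → ℝ} (hf : Integrable f μ) :
    extIntegral μ (fun a => (f a : EReal)) = ((∫ a, f a ∂μ : ℝ) : EReal) := by
  unfold extIntegral
  have h1 : ∫⁻ a, ENNReal.ofReal (f a) ∂μ ≠ ⊤ := hf.lintegral_lt_top.ne
  have h2 : ∫⁻ a, ENNReal.ofReal (-f a) ∂μ ≠ ⊤ := hf.neg.lintegral_lt_top.ne
  rw [integral_eq_lintegral_pos_part_sub_lintegral_neg_part hf]
  have e1 : ∫⁻ a, ((f a : ℝ) : EReal).toENNReal ∂μ = ∫⁻ a, ENNReal.ofReal (f a) ∂μ := by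
    simp only [EReal.real_coe_toENNReal]
  have e2 : ∫⁻ a, (-((f a : ℝ) : EReal)).toENNReal ∂μ = ∫⁻ a, ENNReal.ofReal (-f a) ∂μ := by
    refine lintegral_congr fun a => ?_
    rw [← EReal.coe_neg, EReal.real_coe_toENNReal]
  rw [e1, e2, EReal.coe_sub]
  rw [EReal.coe_ennreal_toReal h1, EReal.coe_ennreal_toReal h2]

lemma extIntegral_const [IsProbabilityMeasure μ] (c : EReal) :
    extIntegral μ (fun _ => c) = c := by
  unfold extIntegral
  simp [EReal.toENNReal_sub_toENNReal_neg]

lemma lintegral_neg_ne_top_of_extIntegral {f : α → EReal} (hf : extIntegral μ f ≠ ⊥) :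
    ∫⁻ a, (-(f a)).toENNReal ∂μ ≠ ⊤ := by
  intro h
  apply hf
  unfold extIntegral
  rw [h, EReal.coe_ennreal_top, EReal.sub_top]

lemma measure_eq_bot_of_extIntegral {f : α → EReal} (hf : Measurable f)
    (h : extIntegral μ f ≠ ⊥) : μ {a | f a = ⊥} = 0 := by
  have := ae_lt_top hf.toENNReal_neg (lintegral_neg_ne_top_of_extIntegral h)
  refine measure_mono_null (fun a ha => ?_) (ae_iff.1 this)
  simp only [Set.mem_ofPred_eq] at ha
  simp [ha]

lemma extIntegral_eq_bot_of_measure_ne_zero {f : α → EReal} (hf : μ {a | f a = ⊥} ≠ 0)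
    (hm : Measurable f) : extIntegral μ f = ⊥ := by
  by_contra h
  exact hf (measure_eq_bot_of_extIntegral hm h)

lemma toENNReal_extIntegral_le (f : α → EReal) :
    (extIntegral μ f).toENNReal ≤ ∫⁻ a, (f a).toENNReal ∂μ := by
  unfold extIntegral
  refine (EReal.toENNReal_le_toENNReal (y := ((∫⁻ a, (f a).toENNReal ∂μ : ℝ≥0∞) : EReal)) ?_).trans
    (by simp)
  exact EReal.coe_ennreal_sub_le _ _

/-- Iterated integrals against a kernel. -/
lemma extIntegral_compProd [SFinite μ] (κ : Kernel α β) [IsSFiniteKernel κ]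
    {g : α × β → EReal} (hg : Measurable g)
    (h : ∫⁻ p, (g p).toENNReal ∂(μ ⊗ₘ κ) ≠ ⊤) :
    extIntegral (μ ⊗ₘ κ) g = extIntegral μ fun a => extIntegral (κ a) fun b => g (a, b) := by
  have ha : Measurable fun a => ∫⁻ b, (g (a, b)).toENNReal ∂(κ a) :=
    hg.ereal_toENNReal.lintegral_kernel_prod_right'
  have hb : Measurable fun a => ∫⁻ b, (-(g (a, b))).toENNReal ∂(κ a) :=
    hg.toENNReal_neg.lintegral_kernel_prod_right'
  have hφ : Measurable fun a => extIntegral (κ a) fun b => g (a, b) :=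
    ha.coe_ereal_ennreal.sub hb.coe_ereal_ennreal
  rw [Measure.lintegral_compProd hg.ereal_toENNReal] at h
  have hp : ∫⁻ a, (extIntegral (κ a) fun b => g (a, b)).toENNReal ∂μ ≠ ⊤ :=
    ne_top_of_le_ne_top h (lintegral_mono fun a => toENNReal_extIntegral_le _)
  -- The pointwise balance p + (p - n)⁻ = n + (p - n)⁺, valid for finite p, is integrated in `a`.
  -- The summand `0` only fills the third slot of `ENNReal.coe_sub_coe_of_balance`.
  have key : (∫⁻ a, ∫⁻ b, (g (a, b)).toENNReal ∂(κ a) ∂μ)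
        + ∫⁻ a, (-(extIntegral (κ a) fun b => g (a, b))).toENNReal ∂μ + 0
      = (∫⁻ a, ∫⁻ b, (-(g (a, b))).toENNReal ∂(κ a) ∂μ)
        + ∫⁻ a, (extIntegral (κ a) fun b => g (a, b)).toENNReal ∂μ + 0 := by
    rw [add_zero, add_zero, ← lintegral_add_left ha, ← lintegral_add_left hb]
    refine lintegral_congr_ae ?_
    filter_upwards [ae_lt_top ha h] with a hfin
    have : ∀ p n : ℝ≥0∞, p ≠ ⊤ → p + (-((p : EReal) - n)).toENNReal = n + ((p : EReal) - n).toENNReal := by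
      intro p n hp
      lift p to NNReal using hp
      induction n with
      | top => simp
      | coe n =>
        have := EReal.toENNReal_add_balance (x := (p : ℝ)) (y := ((-n : ℝ) : EReal))
          (EReal.coe_ne_top _) (EReal.coe_ne_top _)
        simp only [← EReal.coe_neg, ← EReal.coe_add, EReal.real_coe_toENNReal, neg_neg, ← sub_eq_add_neg] at this
        simp only [EReal.coe_nnreal_eq_coe_real, ← EReal.coe_sub, ← EReal.coe_neg,
          EReal.real_coe_toENNReal]
        have h1 : ENNReal.ofReal (-(p : ℝ)) = 0 := ENNReal.ofReal_of_nonpos (by simp)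
        have h2 : ENNReal.ofReal (-(n : ℝ)) = 0 := ENNReal.ofReal_of_nonpos (by simp)
        rw [h1, h2, ENNReal.ofReal_coe_nnreal, ENNReal.ofReal_coe_nnreal] at this
        simp only [add_zero] at this
        rw [add_comm, ← this, add_comm]
    exact this _ _ hfin.ne
  have := ENNReal.coe_sub_coe_of_balance (p₂ := 0) (n₂ := 0) h hp (by simp) key
  simp only [EReal.coe_ennreal_zero, sub_zero, add_zero] at this
  conv_lhs => unfold extIntegral
  rw [Measure.lintegral_compProd hg.ereal_toENNReal,
    Measure.lintegral_compProd hg.toENNReal_neg, this]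
  rfl

lemma measurable_extIntegral_kernel (κ : Kernel α β) [IsSFiniteKernel κ]
    {g : α × β → EReal} (hg : Measurable g) :
    Measurable fun a => extIntegral (κ a) fun b => g (a, b) :=
  hg.ereal_toENNReal.lintegral_kernel_prod_right'.coe_ereal_ennreal.sub
    hg.toENNReal_neg.lintegral_kernel_prod_right'.coe_ereal_ennreal

lemma extIntegral_add_measure {ν : Measure α} {f : α → EReal}
    (hμ : ∫⁻ a, (f a).toENNReal ∂μ ≠ ⊤) (hν : ∫⁻ a, (f a).toENNReal ∂ν ≠ ⊤) :
    extIntegral (μ + ν) f = extIntegral μ f + extIntegral ν f := by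
  unfold extIntegral
  refine ENNReal.coe_sub_coe_of_balance ?_ hμ hν ?_
  · rw [lintegral_add_measure]; exact ENNReal.add_ne_top.2 ⟨hμ, hν⟩
  · rw [lintegral_add_measure, lintegral_add_measure]; ring

lemma extIntegral_smul_measure {c : ℝ} (hc : 0 < c) {f : α → EReal}
    (hμ : ∫⁻ a, (f a).toENNReal ∂μ ≠ ⊤) :
    extIntegral (ENNReal.ofReal c • μ) f = (c : EReal) * extIntegral μ f := by
  unfold extIntegral
  rw [lintegral_smul_measure, lintegral_smul_measure]
  lift ∫⁻ a, (f a).toENNReal ∂μ to NNReal using hμ with p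
  have hc' : ENNReal.ofReal c = ((c.toNNReal : NNReal) : ℝ≥0∞) := rfl
  induction (∫⁻ a, (-(f a)).toENNReal ∂μ) with
  | top =>
    have : ENNReal.ofReal c • (⊤ : ℝ≥0∞) = ⊤ := by
      rw [smul_eq_mul, ENNReal.mul_top]; simpa using hc
    rw [this, EReal.coe_ennreal_top, EReal.sub_top, EReal.sub_top, EReal.coe_mul_bot_of_pos hc]
  | coe n =>
    rw [hc', smul_eq_mul, smul_eq_mul, ← ENNReal.coe_mul, ← ENNReal.coe_mul]
    simp only [EReal.coe_nnreal_eq_coe_real]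
    norm_cast
    push_cast
    rw [Real.coe_toNNReal _ hc.le]
    ring

lemma toENNReal_max_coe (x : EReal) (M : ℝ) (hM : 0 ≤ M) :
    (max x ((-M : ℝ) : EReal)).toENNReal = x.toENNReal := by
  rcases le_total x ((-M : ℝ) : EReal) with h | h
  · rw [max_eq_right h]
    have h0 : ((-M : ℝ) : EReal) ≤ 0 := by exact_mod_cast (neg_nonpos.2 hM)
    rw [EReal.toENNReal_of_nonpos h0, EReal.toENNReal_of_nonpos (h.trans h0)]
  · rw [max_eq_left h]

/-- A lower bound for all truncations is a lower bound for the integral. -/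
lemma le_extIntegral_of_forall_truncation {f : α → EReal} (hf : Measurable f)
    (hp : ∫⁻ a, (f a).toENNReal ∂μ ≠ ⊤) {c : EReal}
    (h : ∀ M : ℕ, c ≤ extIntegral μ fun a => max (f a) ((-(M : ℝ) : ℝ) : EReal)) :
    c ≤ extIntegral μ f := by
  -- Truncating at -M does not touch the positive part, and the truncated negative parts increase to
  -- the full one, so monotone convergence applies.
  have hneg : ∫⁻ a, (-(f a)).toENNReal ∂μ
      = ⨆ M : ℕ, ∫⁻ a, (-(max (f a) ((-(M : ℝ) : ℝ) : EReal))).toENNReal ∂μ := by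
    rw [← lintegral_iSup]
    · refine lintegral_congr fun a => ?_
      apply le_antisymm
      · generalize f a = x
        induction x with
        | bot =>
          rw [EReal.neg_bot, EReal.toENNReal_top, top_le_iff, iSup_eq_top]
          intro b hb
          obtain ⟨n, hn⟩ := ENNReal.exists_nat_gt hb.ne
          refine ⟨n, hn.trans_le ?_⟩
          rw [max_eq_right bot_le, ← EReal.coe_neg, neg_neg, EReal.real_coe_toENNReal]
          simp
        | top => simp
        | coe r =>
          obtain ⟨n, hn⟩ := exists_nat_ge (-r)
          refine le_trans ?_ (le_iSup _ n)
          rw [max_eq_left]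
          exact_mod_cast (by linarith : -(n : ℝ) ≤ r)
      · exact iSup_le fun M => EReal.toENNReal_le_toENNReal
          (EReal.neg_le_neg_iff.2 (le_max_left _ _))
    · intro M
      exact (hf.max measurable_const).toENNReal_neg
    · intro M N hMN a
      refine EReal.toENNReal_le_toENNReal (EReal.neg_le_neg_iff.2 (max_le_max le_rfl ?_))
      exact_mod_cast neg_le_neg (by exact_mod_cast hMN)
  unfold extIntegral at h ⊢
  simp only [toENNReal_max_coe _ _ (Nat.cast_nonneg _)] at h
  rw [hneg]
  lift ∫⁻ a, (f a).toENNReal ∂μ to NNReal using hp with p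
  generalize hG : (fun M : ℕ => ∫⁻ a, (-(max (f a) ((-(M : ℝ) : ℝ) : EReal))).toENNReal ∂μ) = G
  have h' : ∀ M, c ≤ (p : ℝ≥0∞) - (G M : EReal) := fun M => hG ▸ h M
  induction c with
  | bot => exact bot_le
  | top =>
    exfalso
    have := top_le_iff.1 (h' 0)
    rw [EReal.coe_nnreal_eq_coe_real] at this
    generalize G 0 = x at this
    induction x with
    | top => simp at this
    | coe n =>
      rw [EReal.coe_nnreal_eq_coe_real] at this
      exact absurd this (by exact_mod_cast EReal.coe_ne_top _)
  | coe c =>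
    have hG' : ∀ M, G M ≤ ENNReal.ofReal (p - c) := by
      intro M
      have := h' M
      generalize G M = x at this
      induction x with
      | top => rw [EReal.coe_ennreal_top, EReal.sub_top] at this; simp at this
      | coe n =>
        simp only [EReal.coe_nnreal_eq_coe_real] at this
        have h2 : c ≤ p - n := by exact_mod_cast this
        rw [← ENNReal.ofReal_coe_nnreal]
        exact ENNReal.ofReal_le_ofReal (by linarith)
    have hpc : c ≤ p := by
      have := (h' 0).trans (EReal.coe_ennreal_sub_le _ _)
      rw [EReal.coe_nnreal_eq_coe_real] at this
      exact_mod_cast this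
    have hs : (⨆ M, G M) ≤ ENNReal.ofReal (p - c) := iSup_le hG'
    rw [EReal.le_sub_iff_add_le (Or.inr (by simp)) (Or.inr (by simp))]
    calc (c : EReal) + ((⨆ M, G M : ℝ≥0∞) : EReal)
        ≤ c + (ENNReal.ofReal (p - c) : EReal) :=
          add_le_add le_rfl (EReal.coe_ennreal_le_coe_ennreal_iff.2 (by simpa [← hG] using hs))
      _ = (p : ℝ≥0∞) := by
          rw [EReal.coe_ennreal_ofReal, max_eq_left (by linarith), EReal.coe_nnreal_eq_coe_real]
          norm_cast; ring

end ExtIntegral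

/-! ### Extended logarithms -/

/-- `log r` for `r > 0`, and `-∞` for `r ≤ 0`. -/
def elog (r : ℝ) : EReal := ENNReal.log (ENNReal.ofReal r)

@[simp] lemma elog_zero : elog 0 = ⊥ := by simp [elog]

@[simp] lemma elog_one : elog 1 = 0 := by simp [elog]

lemma elog_of_pos {r : ℝ} (h : 0 < r) : elog r = (Real.log r : ℝ) :=
  ENNReal.log_ofReal_of_pos h

lemma elog_mono {r s : ℝ} (h : r ≤ s) : elog r ≤ elog s :=
  ENNReal.log_monotone (ENNReal.ofReal_le_ofReal h)

lemma elog_mul {r s : ℝ} (hr : 0 ≤ r) : elog (r * s) = elog r + elog s := by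
  rw [elog, ENNReal.ofReal_mul hr, ENNReal.log_mul_add, elog, elog]

lemma measurable_elog : Measurable elog :=
  (ENNReal.log_monotone.measurable).comp ENNReal.measurable_ofReal

lemma toENNReal_elog (r : ℝ) (hr : 0 ≤ r) : (elog r).toENNReal = ENNReal.ofReal (Real.posLog r) := by
  rcases hr.eq_or_lt with rfl | hr
  · simp
  · rw [elog_of_pos hr, EReal.real_coe_toENNReal, Real.posLog, max_comm]
    rcases le_total (Real.log r) 0 with h | h
    · rw [max_eq_right h, ENNReal.ofReal_of_nonpos h, ENNReal.ofReal_zero]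
    · rw [max_eq_left h]

lemma elog_le_posLog (r : ℝ) (hr : 0 ≤ r) : elog r ≤ (Real.posLog r : ℝ) := by
  rcases hr.eq_or_lt with rfl | hr
  · simp
  · rw [elog_of_pos hr, Real.posLog]
    exact_mod_cast le_max_right _ _

/-! ### Fekete's lemma with values in `[-∞, ∞]` -/

/-- Euclidean division N = n j + r by a nearly optimal n gives a(N) ≤ j a(n) + r C. The linear bound
`hle` handles the remainder, and the infimum may be -∞. -/
lemma tendsto_inv_mul_of_subadditive {a : ℕ → EReal} (hadd : ∀ m n, a (m + n) ≤ a m + a n)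
    {C : ℝ} (hC : 0 ≤ C) (hle : ∀ n : ℕ, a n ≤ ((n * C : ℝ) : EReal)) :
    Tendsto (fun n : ℕ => (((n : ℝ)⁻¹ : ℝ) : EReal) * a n) atTop
      (𝓝 (⨅ n : {n : ℕ // 1 ≤ n}, (((n : ℝ)⁻¹ : ℝ) : EReal) * a n)) := by
  rw [tendsto_order]
  refine ⟨fun c hc => ?_, fun c hc => ?_⟩
  · filter_upwards [eventually_ge_atTop 1] with n hn
    exact hc.trans_le (iInf_le (fun n : {n : ℕ // 1 ≤ n} => (((n : ℝ)⁻¹ : ℝ) : EReal) * a n) ⟨n, hn⟩)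
  · obtain ⟨⟨n, hn⟩, hnc⟩ := iInf_lt_iff.1 hc
    -- The real number c₀ replaces a(n)/n, which may be -∞; the gap between c₀ and c₁ absorbs the
    -- error of order 1/N.
    obtain ⟨c₀, h1, h2⟩ := EReal.lt_iff_exists_real_btwn.1 hnc
    obtain ⟨c₁, h3, h4⟩ := EReal.lt_iff_exists_real_btwn.1 h2
    have h3' : c₀ < c₁ := by exact_mod_cast h3
    have hn0 : (0 : ℝ) < n := by exact_mod_cast hn
    have han : a n ≤ ((n * c₀ : ℝ) : EReal) := by
      generalize a n = x at h1
      induction x with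
      | bot => exact bot_le
      | top => rw [EReal.coe_mul_top_of_pos (by positivity)] at h1; simp at h1
      | coe x =>
        have : (n : ℝ)⁻¹ * x < c₀ := by exact_mod_cast h1
        have : x < n * c₀ := by
          rw [inv_mul_lt_iff₀ hn0] at this; exact this
        exact_mod_cast this.le
    have hq : ∀ j r : ℕ, a (n * j + r) ≤ ((j * (n * c₀) + r * C : ℝ) : EReal) := by
      intro j r
      induction j with
      | zero => simpa using hle r
      | succ j ih =>
        have : n * (j + 1) + r = n + (n * j + r) := by ring
        rw [this]
        refine (hadd _ _).trans ((add_le_add han ih).trans ?_)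
        rw [← EReal.coe_add]
        apply le_of_eq
        congr 1
        push_cast; ring
    -- The remainder r < n contributes r (C - c₀) ≤ n (C + |c₀|), whatever the sign of c₀.
    have hlim : Tendsto (fun N : ℕ => c₀ + (n * (C + |c₀|)) / (N : ℝ)) atTop (𝓝 (c₀ + 0)) :=
      tendsto_const_nhds.add (tendsto_const_div_atTop_nhds_zero_nat _)
    rw [add_zero] at hlim
    filter_upwards [hlim.eventually_lt_const h3', eventually_ge_atTop 1] with N hN hN1
    refine lt_of_le_of_lt ?_ h4
    have hN0 : (0 : ℝ) < N := by exact_mod_cast hN1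
    have hb := hq (N / n) (N % n)
    rw [Nat.div_add_mod] at hb
    have hdm : (n : ℝ) * ((N / n : ℕ) : ℝ) + ((N % n : ℕ) : ℝ) = N := by
      exact_mod_cast Nat.div_add_mod N n
    have hr : ((N % n : ℕ) : ℝ) ≤ n := by exact_mod_cast (Nat.mod_lt N hn).le
    have hr0 : (0 : ℝ) ≤ ((N % n : ℕ) : ℝ) := Nat.cast_nonneg _
    have hb2 : (((N / n : ℕ) : ℝ) * (n * c₀) + ((N % n : ℕ) : ℝ) * C) ≤ N * c₀ + n * (C + |c₀|) := by
      have e : ((N / n : ℕ) : ℝ) * (n * c₀) = (N - ((N % n : ℕ) : ℝ)) * c₀ := by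
        rw [← hdm]; ring
      rw [e]
      have := neg_abs_le c₀
      have h5 : ((N % n : ℕ) : ℝ) * (C - c₀) ≤ ((N % n : ℕ) : ℝ) * (C + |c₀|) :=
        mul_le_mul_of_nonneg_left (by linarith) hr0
      have h6 : ((N % n : ℕ) : ℝ) * (C + |c₀|) ≤ n * (C + |c₀|) :=
        mul_le_mul_of_nonneg_right hr (by positivity)
      linarith
    calc (((N : ℝ)⁻¹ : ℝ) : EReal) * a N
        ≤ (((N : ℝ)⁻¹ : ℝ) : EReal) * ((N * c₀ + n * (C + |c₀|) : ℝ) : EReal) := by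
          refine mul_le_mul_of_nonneg_left (hb.trans (by exact_mod_cast hb2)) ?_
          exact_mod_cast (inv_nonneg.2 hN0.le)
      _ ≤ (c₁ : EReal) := by
          rw [← EReal.coe_mul]
          norm_cast
          have : (N : ℝ)⁻¹ * (N * c₀ + n * (C + |c₀|)) = c₀ + (n * (C + |c₀|)) / (N : ℝ) := by
            field_simp
          rw [this]; exact hN.le

/-! ### Stationary Markov chains -/

section MarkovChain

variable {Y : Type*} [MeasurableSpace Y]

/-- The transition kernel at time `n` seen as a kernel on histories. -/
def historyKernel (q : Kernel Y Y) (n : ℕ) : Kernel (Π _ : Finset.Iic n, Y) Y :=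
  q.comap (fun h => h ⟨n, Finset.mem_Iic.2 le_rfl⟩) (measurable_pi_apply _)

instance (q : Kernel Y Y) [IsMarkovKernel q] (n : ℕ) : IsMarkovKernel (historyKernel q n) := by
  unfold historyKernel; infer_instance

/-- The law on path space of the Markov chain with kernel `q` and initial law `ν`. -/
def markovChain (q : Kernel Y Y) [IsMarkovKernel q] (ν : Measure Y) : Measure (ℕ → Y) :=
  Kernel.trajMeasure (X := fun _ : ℕ => Y) ν (historyKernel q)

variable (q : Kernel Y Y) [IsMarkovKernel q] (ν : Measure Y)

instance [IsProbabilityMeasure ν] : IsProbabilityMeasure (markovChain q ν) := by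
  unfold markovChain; infer_instance

lemma markovChain_map_zero : (markovChain q ν).map (fun z => z 0) = ν := by
  have h : (markovChain q ν).map (Preorder.frestrictLe 0)
      = ν.map (MeasurableEquiv.piUnique (fun _ : Finset.Iic 0 => Y)).symm := by
    rw [markovChain, Kernel.trajMeasure, Measure.map_comp _ _ (by fun_prop),
      Kernel.traj_map_frestrictLe_of_le le_rfl]
    exact Measure.deterministic_comp_eq_map _ |>.trans (Measure.map_id)
  have h2 : (fun z : ℕ → Y => z 0) = (MeasurableEquiv.piUnique (fun _ : Finset.Iic 0 => Y)) ∘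
      (Preorder.frestrictLe (π := fun _ : ℕ => Y) 0) := rfl
  rw [h2, ← Measure.map_map (by fun_prop) (by fun_prop), h, Measure.map_map (by fun_prop) (by fun_prop),
    MeasurableEquiv.self_comp_symm, Measure.map_id]

variable [IsProbabilityMeasure ν]

/-- The Markov property: conditionally on the history up to time `n`, the next point has
law `q (z n)`. -/
lemma lintegral_markovChain_succ (n : ℕ) {g : (ℕ → Y) × Y → ℝ≥0∞} (hg : Measurable g)
    (hdep : ∀ z z' y, (∀ i ≤ n, z i = z' i) → g (z, y) = g (z', y)) :
    ∫⁻ z, g (z, z (n + 1)) ∂(markovChain q ν)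
      = ∫⁻ z, ∫⁻ y, g (z, y) ∂(q (z n)) ∂(markovChain q ν) := by
  -- A history is extended to a full path by freezing it after time n; by `hdep` the function g does
  -- not see the difference.
  let pad : (Π _ : Finset.Iic n, Y) → ℕ → Y := fun h i => h ⟨min i n, Finset.mem_Iic.2 (min_le_right _ _)⟩
  have hpad : Measurable pad := measurable_pi_lambda _ fun i => measurable_pi_apply _
  have hpr : ∀ (z : ℕ → Y) y, g (pad (Preorder.frestrictLe n z), y) = g (z, y) := fun z y =>
    hdep _ _ _ fun i hi => by simp [pad, hi]
  let G : (Π _ : Finset.Iic n, Y) × Y → ℝ≥0∞ := fun p => g (pad p.1, p.2)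
  have hG : Measurable G := hg.comp ((hpad.comp measurable_fst).prodMk measurable_snd)
  have key := Kernel.map_frestrictLe_trajMeasure_compProd_eq_map_trajMeasure
    (X := fun _ : ℕ => Y) (μ₀ := ν) (κ := historyKernel q) (a := n)
  have h1 := congrArg (fun m => ∫⁻ p, G p ∂m) key
  rw [Measure.lintegral_compProd hG, lintegral_map hG.lintegral_kernel_prod_right' (by fun_prop),
    lintegral_map hG (by fun_prop)] at h1
  simp only [G, hpr] at h1
  exact h1.symm

/-- Laws on path space are determined by their restrictions to initial segments of time. At time 0
the claim is stationarity of ν; in the inductive step both restrictions are extended by the same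
transition kernel, because the Markov property at time n + 1 is the one at time n after the shift.
-/
lemma markovChain_map_shift (hν : q ∘ₘ ν = ν) :
    (markovChain q ν).map (fun z n => z (n + 1)) = markovChain q ν := by
  set m := markovChain q ν with hm
  have hs : Measurable fun (z : ℕ → Y) (n : ℕ) => z (n + 1) :=
    measurable_pi_lambda _ fun n => measurable_pi_apply _
  have : IsProbabilityMeasure (m.map fun (z : ℕ → Y) (n : ℕ) => z (n + 1)) :=
    Measure.isProbabilityMeasure_map hs.aemeasurable
  have key : ∀ n, (m.map fun z n => z (n + 1)).map (Preorder.frestrictLe (π := fun _ : ℕ => Y) n)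
      = m.map (Preorder.frestrictLe (π := fun _ : ℕ => Y) n) := by
    intro n
    induction n with
    | zero =>
      have h0 : ∀ μ : Measure (ℕ → Y), μ.map (Preorder.frestrictLe (π := fun _ : ℕ => Y) 0)
          = (μ.map (fun z => z 0)).map (MeasurableEquiv.piUnique (fun _ : Finset.Iic 0 => Y)).symm := by
        intro μ
        rw [Measure.map_map (by fun_prop) (by fun_prop)]
        congr 1
        funext z
        apply (MeasurableEquiv.piUnique (fun _ : Finset.Iic 0 => Y)).injective
        rfl
      rw [h0, h0, Measure.map_map (by fun_prop) hs, hm, markovChain_map_zero]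
      congr 1
      refine Measure.ext_of_lintegral _ fun f hf => ?_
      rw [lintegral_map hf ((measurable_pi_apply 0).comp hs)]
      have := lintegral_markovChain_succ q ν 0 (g := fun p => f p.2) (hf.comp measurable_snd)
        (fun _ _ _ _ => rfl)
      simp only [Function.comp] at this ⊢
      rw [this]
      conv_rhs => rw [← hν, Measure.lintegral_bind q.measurable.aemeasurable hf.aemeasurable,
        ← markovChain_map_zero q ν]
      rw [lintegral_map hf.lintegral_kernel (measurable_pi_apply 0)]
    | succ n ih =>
      -- Appending the last point to a history expresses the marginal up to time n + 1 through the
      -- joint law of the history up to n and the next point.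
      let ext : (Π _ : Finset.Iic n, Y) × Y → (Π _ : Finset.Iic (n + 1), Y) := fun p i =>
        if h : i.1 ≤ n then p.1 ⟨i.1, Finset.mem_Iic.2 h⟩ else p.2
      have hext : Measurable ext := by
        refine measurable_pi_lambda _ fun i => ?_
        by_cases h : i.1 ≤ n
        · simp only [ext, h, dif_pos]; fun_prop
        · simp only [ext, h, dif_neg, not_false_iff]; fun_prop
      have hE : ∀ z : ℕ → Y, Preorder.frestrictLe (π := fun _ : ℕ => Y) (n + 1) z
          = ext (Preorder.frestrictLe n z, z (n + 1)) := by
        intro z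
        funext i
        by_cases h : i.1 ≤ n
        · simp [ext, h]
        · have : i.1 = n + 1 := le_antisymm (Finset.mem_Iic.1 i.2) (by omega)
          simp [ext, this]
      have hfac : ∀ μ : Measure (ℕ → Y), μ.map (Preorder.frestrictLe (π := fun _ : ℕ => Y) (n + 1))
          = (μ.map fun z => (Preorder.frestrictLe (π := fun _ : ℕ => Y) n z, z (n + 1))).map ext := by
        intro μ
        rw [Measure.map_map hext (by fun_prop)]
        congr 1
        funext z
        exact hE z
      rw [hfac, hfac]
      congr 1
      have h1 : m.map (fun z => (Preorder.frestrictLe (π := fun _ : ℕ => Y) n z, z (n + 1)))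
          = m.map (Preorder.frestrictLe (π := fun _ : ℕ => Y) n) ⊗ₘ historyKernel q n :=
        Kernel.map_frestrictLe_trajMeasure_compProd_eq_map_trajMeasure.symm
      rw [h1, ← ih]
      refine Measure.ext_of_lintegral _ fun f hf => ?_
      have hm' : Measurable fun z : ℕ → Y =>
          ∫⁻ y, f (Preorder.frestrictLe n z, y) ∂(historyKernel q n (Preorder.frestrictLe n z)) :=
        hf.lintegral_kernel_prod_right'.comp (Preorder.measurable_frestrictLe n)
      rw [lintegral_map hf (by fun_prop), lintegral_map (by fun_prop) hs,
        Measure.lintegral_compProd hf, lintegral_map hf.lintegral_kernel_prod_right' (by fun_prop),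
        lintegral_map hm' hs]
      exact lintegral_markovChain_succ q ν (n + 1)
        (g := fun p => f (Preorder.frestrictLe (π := fun _ : ℕ => Y) n (fun i => p.1 (i + 1)), p.2))
        (hf.comp (((Preorder.measurable_frestrictLe n).comp (hs.comp measurable_fst)).prodMk
          measurable_snd))
        (fun z z' y h => by
          congr 2
          funext i
          exact h _ (by have := Finset.mem_Iic.1 i.2; omega))
  have hlim : ∀ μ : Measure (ℕ → Y), IsProjectiveLimit μ (fun I : Finset ℕ => μ.map I.restrict) :=
    fun μ I => rfl
  refine IsProjectiveLimit.unique (P := fun I : Finset ℕ => m.map I.restrict) ?_ (hlim m)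
  intro I
  have hI : I ⊆ Finset.Iic (I.sup id) := fun i hi => Finset.mem_Iic.2 (Finset.le_sup (f := id) hi)
  have hr : (I.restrict : (ℕ → Y) → _) = Finset.restrict₂ hI ∘ Preorder.frestrictLe (I.sup id) := rfl
  have hI' := Finset.measurable_restrict₂ (X := fun _ : ℕ => Y) hI
  rw [hr, ← Measure.map_map hI' (by fun_prop), key, Measure.map_map hI' (by fun_prop)]
  rfl

end MarkovChain

/-! ### Linear cocycles over a stationary Markov chain -/

section PathProd

variable {Y V : Type*} [NormedAddCommGroup V] [NormedSpace ℝ V]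

/-- The product `A(z_{n-1}, z_n) ∘ ⋯ ∘ A(z_0, z_1)` along a path. -/
def pathProd (A : Y → Y → V →L[ℝ] V) : ℕ → (ℕ → Y) → V →L[ℝ] V
  | 0, _ => ContinuousLinearMap.id ℝ V
  | n + 1, z => A (z n) (z (n + 1)) ∘L pathProd A n z

variable (A : Y → Y → V →L[ℝ] V)

lemma pathProd_add (m n : ℕ) (z : ℕ → Y) :
    pathProd A (m + n) z = pathProd A n (fun i => z (i + m)) ∘L pathProd A m z := by
  induction n with
  | zero => rfl
  | succ n ih =>
    have e : m + (n + 1) = (m + n) + 1 := rfl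
    rw [e, pathProd, ih, pathProd, ContinuousLinearMap.comp_assoc]
    have h1 : n + m = m + n := add_comm _ _
    have h2 : n + 1 + m = m + n + 1 := by ring
    simp only [h1, h2]

lemma pathProd_congr (n : ℕ) {z z' : ℕ → Y} (h : ∀ i ≤ n, z i = z' i) :
    pathProd A n z = pathProd A n z' := by
  induction n with
  | zero => rfl
  | succ n ih =>
    rw [pathProd, pathProd, ih fun i hi => h i (hi.trans n.le_succ), h n n.le_succ, h (n + 1) le_rfl]

lemma posLog_norm_pathProd_le (n : ℕ) (z : ℕ → Y) :
    Real.posLog ‖pathProd A n z‖ ≤ ∑ j ∈ Finset.range n, Real.posLog ‖A (z j) (z (j + 1))‖ := by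
  induction n with
  | zero =>
    have : ‖pathProd A 0 z‖ ≤ 1 := ContinuousLinearMap.norm_id_le
    rw [Finset.range_zero, Finset.sum_empty, Real.posLog_eq_zero_iff _ |>.2]
    rwa [abs_of_nonneg (norm_nonneg _)]
  | succ n ih =>
    rw [Finset.sum_range_succ, add_comm (Finset.sum _ _), pathProd]
    refine (Real.posLog_le_posLog (norm_nonneg _) (ContinuousLinearMap.opNorm_comp_le _ _)).trans ?_
    exact Real.posLog_mul.trans (add_le_add le_rfl ih)

variable [MeasurableSpace Y] [FiniteDimensional ℝ V] {A}

lemma measurable_pathProd (hA : Measurable fun p : Y × Y => A p.1 p.2) (n : ℕ) :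
    Measurable fun z : ℕ → Y => pathProd A n z := by
  induction n with
  | zero => exact measurable_const
  | succ n ih =>
    have h1 : Measurable fun z : ℕ → Y => A (z n) (z (n + 1)) :=
      Measurable.comp (g := fun p : Y × Y => A p.1 p.2) (f := fun z : ℕ → Y => (z n, z (n + 1)))
        hA (by fun_prop)
    have : Measurable fun p : (V →L[ℝ] V) × (V →L[ℝ] V) => p.1 ∘L p.2 := by fun_prop
    exact this.comp (h1.prodMk ih)

end PathProd

section Growth

variable {Y V : Type*} [MeasurableSpace Y] [NormedAddCommGroup V] [NormedSpace ℝ V]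
  (q : Kernel Y Y) [IsMarkovKernel q] (ν : Measure Y) (A : Y → Y → V →L[ℝ] V)

/-- The mean logarithmic growth `∫ log ‖A(z_{n-1}, z_n) ∘ ⋯ ∘ A(z_0, z_1)‖`. -/
def pathGrowth (n : ℕ) : EReal := extIntegral (markovChain q ν) fun z => elog ‖pathProd A n z‖

variable {q ν A} [IsProbabilityMeasure ν]

lemma markovChain_map_eval (hν : q ∘ₘ ν = ν) (n : ℕ) : (markovChain q ν).map (fun z => z n) = ν := by
  induction n with
  | zero => exact markovChain_map_zero q ν
  | succ n ih =>
    have hs : Measurable fun (z : ℕ → Y) (n : ℕ) => z (n + 1) :=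
      measurable_pi_lambda _ fun n => measurable_pi_apply _
    have h2 := ih
    rw [← markovChain_map_shift q ν hν, Measure.map_map (measurable_pi_apply n) hs] at h2
    exact h2

lemma markovChain_map_shift_add (hν : q ∘ₘ ν = ν) (k : ℕ) :
    (markovChain q ν).map (fun z n => z (n + k)) = markovChain q ν := by
  induction k with
  | zero => exact Measure.map_id
  | succ k ih =>
    have hs : ∀ k, Measurable fun (z : ℕ → Y) (n : ℕ) => z (n + k) := fun k =>
      measurable_pi_lambda _ fun n => measurable_pi_apply _
    have h2 := markovChain_map_shift q ν hν
    conv at h2 => lhs; rw [← ih]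
    rw [Measure.map_map (hs 1) (hs k)] at h2
    refine Eq.trans ?_ h2
    congr 1
    funext z n
    simp only [Function.comp]
    congr 1
    ring

lemma markovChain_map_edge (hν : q ∘ₘ ν = ν) (n : ℕ) :
    (markovChain q ν).map (fun z => (z n, z (n + 1))) = ν ⊗ₘ q := by
  refine Measure.ext_of_lintegral _ fun g hg => ?_
  rw [lintegral_map hg (by fun_prop), Measure.lintegral_compProd hg]
  have h1 := lintegral_markovChain_succ q ν n (g := fun p => g (p.1 n, p.2))
    (hg.comp (((measurable_pi_apply n).comp measurable_fst).prodMk measurable_snd))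
    (fun z z' y h => by simp only [h n le_rfl])
  rw [h1]
  conv_rhs => rw [← markovChain_map_eval hν n]
  rw [lintegral_map hg.lintegral_kernel_prod_right' (measurable_pi_apply n)]

/-- By submultiplicativity log⁺ of the product is at most the sum of log⁺ over the n edges, and by
stationarity every edge has law `ν ⊗ₘ q`. -/
lemma lintegral_posLog_pathProd_le (hν : q ∘ₘ ν = ν) (hA : Measurable fun p : Y × Y => A p.1 p.2)
    (n : ℕ) :
    ∫⁻ z, (elog ‖pathProd A n z‖).toENNReal ∂(markovChain q ν)
      ≤ n * ∫⁻ p, ENNReal.ofReal (Real.posLog ‖A p.1 p.2‖) ∂(ν ⊗ₘ q) := by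
  have hm : Measurable fun p : Y × Y => ENNReal.ofReal (Real.posLog ‖A p.1 p.2‖) :=
    (Real.continuous_posLog.measurable.comp hA.norm).ennreal_ofReal
  have hm' : ∀ j, Measurable fun z : ℕ → Y => ENNReal.ofReal (Real.posLog ‖A (z j) (z (j + 1))‖) :=
    fun j => by
      have he : Measurable fun z : ℕ → Y => (z j, z (j + 1)) := by fun_prop
      exact Measurable.comp (g := fun p : Y × Y => ENNReal.ofReal (Real.posLog ‖A p.1 p.2‖))
        (f := fun z : ℕ → Y => (z j, z (j + 1))) hm he
  calc ∫⁻ z, (elog ‖pathProd A n z‖).toENNReal ∂(markovChain q ν)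
      ≤ ∫⁻ z, ∑ j ∈ Finset.range n, ENNReal.ofReal (Real.posLog ‖A (z j) (z (j + 1))‖)
          ∂(markovChain q ν) := by
        refine lintegral_mono fun z => ?_
        rw [toENNReal_elog _ (norm_nonneg _), ← ENNReal.ofReal_sum_of_nonneg fun _ _ => Real.posLog_nonneg]
        exact ENNReal.ofReal_le_ofReal (posLog_norm_pathProd_le A n z)
    _ = ∑ j ∈ Finset.range n, ∫⁻ z, ENNReal.ofReal (Real.posLog ‖A (z j) (z (j + 1))‖)
          ∂(markovChain q ν) :=
        lintegral_finsetSum _ fun j _ => hm' j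
    _ = ∑ j ∈ Finset.range n, ∫⁻ p, ENNReal.ofReal (Real.posLog ‖A p.1 p.2‖) ∂(ν ⊗ₘ q) := by
        refine Finset.sum_congr rfl fun j _ => ?_
        rw [← markovChain_map_edge hν j, lintegral_map hm (by fun_prop)]
    _ = _ := by rw [Finset.sum_const, Finset.card_range, nsmul_eq_mul]

lemma extIntegral_le_lintegral {α : Type*} [MeasurableSpace α] {μ : Measure α} (f : α → EReal) :
    extIntegral μ f ≤ ((∫⁻ a, (f a).toENNReal ∂μ : ℝ≥0∞) : EReal) :=
  EReal.coe_ennreal_sub_le _ _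

lemma pathGrowth_le (hν : q ∘ₘ ν = ν) (hA : Measurable fun p : Y × Y => A p.1 p.2)
    (hint : ∫⁻ p, ENNReal.ofReal (Real.posLog ‖A p.1 p.2‖) ∂(ν ⊗ₘ q) ≠ ⊤) (n : ℕ) :
    pathGrowth q ν A n
      ≤ ((n * (∫⁻ p, ENNReal.ofReal (Real.posLog ‖A p.1 p.2‖) ∂(ν ⊗ₘ q)).toReal : ℝ) : EReal) := by
  refine (extIntegral_le_lintegral _).trans ?_
  refine (EReal.coe_ennreal_le_coe_ennreal_iff.2 (lintegral_posLog_pathProd_le hν hA n)).trans ?_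
  generalize (∫⁻ p, ENNReal.ofReal (Real.posLog ‖A p.1 p.2‖) ∂(ν ⊗ₘ q)) = x at hint ⊢
  lift x to NNReal using hint
  apply le_of_eq
  have : (n : ℝ≥0∞) * x = ((n * x : NNReal) : ℝ≥0∞) := by push_cast; rfl
  rw [this, EReal.coe_nnreal_eq_coe_real]
  simp

variable [FiniteDimensional ℝ V]

/-- The path is cut at time m; by shift invariance the second block is distributed like the first n
steps. -/
lemma pathGrowth_add_le (hν : q ∘ₘ ν = ν) (hA : Measurable fun p : Y × Y => A p.1 p.2)
    (hint : ∫⁻ p, ENNReal.ofReal (Real.posLog ‖A p.1 p.2‖) ∂(ν ⊗ₘ q) ≠ ⊤) (m n : ℕ) :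
    pathGrowth q ν A (m + n) ≤ pathGrowth q ν A m + pathGrowth q ν A n := by
  have hs : Measurable fun (z : ℕ → Y) (i : ℕ) => z (i + m) :=
    measurable_pi_lambda _ fun n => measurable_pi_apply _
  have hmeas : ∀ n, Measurable fun z : ℕ → Y => elog ‖pathProd A n z‖ := fun n =>
    measurable_elog.comp (measurable_pathProd hA n).norm
  have hfin : ∀ n, ∫⁻ z, (elog ‖pathProd A n z‖).toENNReal ∂(markovChain q ν) ≠ ⊤ := fun n =>
    ne_top_of_le_ne_top (ENNReal.mul_ne_top (by simp) hint) (lintegral_posLog_pathProd_le hν hA n)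
  have e : pathGrowth q ν A n
      = extIntegral (markovChain q ν) fun z => elog ‖pathProd A n (fun i => z (i + m))‖ := by
    conv_lhs => rw [pathGrowth, ← markovChain_map_shift_add hν m, extIntegral_map hs (hmeas n)]
  have hmeas' : Measurable fun z : ℕ → Y => elog ‖pathProd A n (fun i => z (i + m))‖ :=
    (hmeas n).comp hs
  have hfin' : ∫⁻ z, (elog ‖pathProd A n (fun i => z (i + m))‖).toENNReal ∂(markovChain q ν) ≠ ⊤ := by
    have := hfin n
    rwa [← markovChain_map_shift_add hν m, lintegral_map (hmeas n).ereal_toENNReal hs] at this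
  rw [e, pathGrowth, pathGrowth, ← extIntegral_add (hmeas m) hmeas' (hfin m) hfin']
  refine extIntegral_mono_ae (ae_of_all _ fun z => ?_)
  rw [pathProd_add, add_comm, ← elog_mul (norm_nonneg _)]
  exact elog_mono (ContinuousLinearMap.opNorm_comp_le _ _)

variable (q ν A) in
/-- The exponential growth rate of the cocycle. -/
def pathRate : EReal := ⨅ n : {n : ℕ // 1 ≤ n}, (((n : ℝ)⁻¹ : ℝ) : EReal) * pathGrowth q ν A n

lemma tendsto_pathGrowth (hν : q ∘ₘ ν = ν) (hA : Measurable fun p : Y × Y => A p.1 p.2)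
    (hint : ∫⁻ p, ENNReal.ofReal (Real.posLog ‖A p.1 p.2‖) ∂(ν ⊗ₘ q) ≠ ⊤) :
    Tendsto (fun n : ℕ => (((n : ℝ)⁻¹ : ℝ) : EReal) * pathGrowth q ν A n) atTop
      (𝓝 (pathRate q ν A)) :=
  tendsto_inv_mul_of_subadditive (pathGrowth_add_le hν hA hint) ENNReal.toReal_nonneg
    (pathGrowth_le hν hA hint)

end Growth

/-! ### The logarithmic size of a Gaussian vector under a linear map -/

section Gaussian

/-- The negative part of log|x| lives on [-1, 1], where it is Lebesgue integrable, and the Gaussian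
density is at most 1. -/
lemma lintegral_neg_elog_gaussianReal :
    ∫⁻ x, (-(elog |x|)).toENNReal ∂(gaussianReal 0 1) ≠ ⊤ := by
  have h1 : IntegrableOn Real.log (Set.Icc (-1) 1) volume := by
    have := (intervalIntegral.intervalIntegrable_log' (a := -1) (b := 1)).1
    rw [integrableOn_Icc_iff_integrableOn_Ioc]
    exact this
  have h2 : ∫⁻ x in Set.Icc (-1 : ℝ) 1, ENNReal.ofReal (-Real.log x) ≠ ⊤ := h1.neg.lintegral_lt_top.ne
  have hm : Measurable fun x : ℝ => elog |x| := measurable_elog.comp continuous_abs.measurable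
  rw [gaussianReal_of_var_ne_zero _ (by simp), lintegral_withDensity_eq_lintegral_mul _
    (measurable_gaussianPDF 0 1) hm.toENNReal_neg]
  have hb : ∀ x, gaussianPDF 0 1 x ≤ 1 := by
    intro x
    rw [gaussianPDF, ← ENNReal.ofReal_one]
    refine ENNReal.ofReal_le_ofReal ?_
    rw [gaussianPDFReal]
    have h3 : (√(2 * Real.pi * (1 : NNReal)))⁻¹ ≤ 1 := by
      apply inv_le_one_of_one_le₀
      rw [Real.one_le_sqrt]
      have := Real.pi_gt_three
      push_cast
      linarith
    have h4 : Real.exp (-(x - 0) ^ 2 / (2 * (1 : NNReal))) ≤ 1 := by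
      rw [Real.exp_le_one_iff]
      apply div_nonpos_of_nonpos_of_nonneg
      · have := sq_nonneg (x - 0); linarith
      · simp
    calc _ ≤ (1 : ℝ) * 1 := mul_le_mul h3 h4 (Real.exp_nonneg _) zero_le_one
      _ = 1 := one_mul 1
  refine ne_top_of_le_ne_top h2 ?_
  rw [← lintegral_indicator measurableSet_Icc]
  have h0 : ∀ᵐ x : ℝ ∂volume, x ≠ 0 := by simp [ae_iff]
  refine lintegral_mono_ae (h0.mono fun x hx => ?_)
  simp only [Pi.mul_apply]
  have hx' : 0 < |x| := abs_pos.2 hx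
  refine (mul_le_of_le_one_left zero_le (hb x)).trans ?_
  rw [elog_of_pos hx', Real.log_abs, ← EReal.coe_neg, EReal.real_coe_toENNReal]
  by_cases h : x ∈ Set.Icc (-1 : ℝ) 1
  · rw [Set.indicator_of_mem h]
  · rw [Set.indicator_of_notMem h, nonpos_iff_eq_zero, ENNReal.ofReal_eq_zero, neg_nonpos,
      ← Real.log_abs]
    refine Real.log_nonneg ?_
    by_contra! h'
    exact h (abs_le.1 h'.le)

variable {V : Type*} [NormedAddCommGroup V] [InnerProductSpace ℝ V] [FiniteDimensional ℝ V]

lemma exists_norm_apply_eq_opNorm [Nontrivial V] (L : V →L[ℝ] V) : ∃ e : V, ‖e‖ = 1 ∧ ‖L e‖ = ‖L‖ := by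
  have hc : IsCompact (Metric.sphere (0 : V) 1) := isCompact_sphere 0 1
  have hne : (Metric.sphere (0 : V) 1).Nonempty := NormedSpace.sphere_nonempty.2 zero_le_one
  obtain ⟨e, he, hmax⟩ := hc.exists_isMaxOn hne (L.continuous.norm.continuousOn)
  have he1 : ‖e‖ = 1 := by simpa using he
  refine ⟨e, he1, le_antisymm ((L.le_opNorm e).trans (by rw [he1, mul_one])) ?_⟩
  refine L.opNorm_le_of_unit_norm (norm_nonneg _) fun x hx => ?_
  exact hmax (by simpa using hx)

variable [MeasurableSpace V] [BorelSpace V]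

lemma stdGaussian_map_inner {w : V} (hw : ‖w‖ = 1) :
    (stdGaussian V).map (fun c => inner ℝ w c) = gaussianReal 0 1 := by
  have h := IsGaussian.map_eq_gaussianReal (μ := stdGaussian V) (innerSL ℝ w)
  rw [integral_strongDual_stdGaussian, variance_dual_stdGaussian] at h
  have h3 : ‖(innerSL ℝ) w‖ = 1 := by rw [innerSL_apply_norm, hw]
  rw [h3] at h
  simpa using h

/-- The defect of Gaussian vectors in realising the norm of a linear map. -/
def gaussianLogDefect : ℝ := (∫⁻ x, (-(elog |x|)).toENNReal ∂(gaussianReal 0 1)).toReal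

/-- Let e be a unit vector with ‖Le‖ = ‖L‖ and v = Le/‖L‖. Then ‖Lc‖ ≥ |⟨v, Lc⟩| = |⟨L*v, c⟩|, and
‖L*v‖ ≥ ⟨L*v, e⟩ = ‖L‖. Hence ‖Lc‖ ≥ ‖L‖ |⟨w, c⟩| for the unit vector w along L*v, and ⟨w, c⟩ is a
standard Gaussian variable, so the logarithmic loss does not depend on L. -/
lemma elog_opNorm_sub_le_gaussian [Nontrivial V] (L : V →L[ℝ] V) :
    elog ‖L‖ - (gaussianLogDefect : EReal) ≤ extIntegral (stdGaussian V) fun c => elog ‖L c‖ := by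
  by_cases hL : L = 0
  · simp [hL]
  obtain ⟨e, he, hLe⟩ := exists_norm_apply_eq_opNorm L
  have hL0 : 0 < ‖L‖ := norm_pos_iff.2 hL
  set v : V := (‖L‖)⁻¹ • L e with hv
  have hv1 : ‖v‖ = 1 := by rw [hv, norm_smul, hLe, norm_inv, norm_norm, inv_mul_cancel₀ hL0.ne']
  set w₀ : V := ContinuousLinearMap.adjoint L v with hw₀
  have hw : ‖L‖ ≤ ‖w₀‖ := by
    have h1 : inner ℝ w₀ e = ‖L‖ := by
      rw [hw₀, ContinuousLinearMap.adjoint_inner_left, hv, real_inner_smul_left,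
        real_inner_self_eq_norm_sq, hLe]
      field_simp
    calc ‖L‖ = inner ℝ w₀ e := h1.symm
      _ ≤ ‖w₀‖ * ‖e‖ := real_inner_le_norm _ _
      _ = ‖w₀‖ := by rw [he, mul_one]
  have hw0 : 0 < ‖w₀‖ := hL0.trans_le hw
  set w : V := (‖w₀‖)⁻¹ • w₀ with hww
  have hw1 : ‖w‖ = 1 := by rw [hww, norm_smul, norm_inv, norm_norm, inv_mul_cancel₀ hw0.ne']
  have hpt : ∀ c, elog ‖L‖ + elog |inner ℝ w c| ≤ elog ‖L c‖ := by
    intro c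
    rw [← elog_mul (norm_nonneg _)]
    refine elog_mono ?_
    have h2 : inner ℝ w₀ c = inner ℝ v (L c) := ContinuousLinearMap.adjoint_inner_left _ _ _
    have h3 : |inner ℝ w c| = ‖w₀‖⁻¹ * |inner ℝ v (L c)| := by
      rw [hww, real_inner_smul_left, abs_mul, abs_of_pos (inv_pos.2 hw0), h2]
    rw [h3]
    have h4 : |inner ℝ v (L c)| ≤ ‖L c‖ := by
      have := abs_real_inner_le_norm v (L c)
      rwa [hv1, one_mul] at this
    calc ‖L‖ * (‖w₀‖⁻¹ * |inner ℝ v (L c)|) = (‖L‖ / ‖w₀‖) * |inner ℝ v (L c)| := by ring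
      _ ≤ 1 * ‖L c‖ := by
        refine mul_le_mul ((div_le_one hw0).2 hw) h4 (abs_nonneg _) zero_le_one
      _ = ‖L c‖ := one_mul _
  have hm : Measurable fun c : V => inner ℝ w c := by fun_prop
  have hmg : Measurable fun x : ℝ => elog |x| := measurable_elog.comp continuous_abs.measurable
  have hmc : Measurable fun c : V => elog |inner ℝ w c| := hmg.comp hm
  have hpos : ∫⁻ x, (elog |x|).toENNReal ∂(gaussianReal 0 1) ≠ ⊤ := by
    have hi : Integrable (id : ℝ → ℝ) (gaussianReal 0 1) := IsGaussian.integrable_id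
    refine ne_top_of_le_ne_top hi.norm.lintegral_lt_top.ne (lintegral_mono fun x => ?_)
    rw [toENNReal_elog _ (abs_nonneg _)]
    refine ENNReal.ofReal_le_ofReal ?_
    rw [Real.posLog]
    exact max_le (norm_nonneg _) (Real.log_le_self (abs_nonneg _))
  have hneg := lintegral_neg_elog_gaussianReal
  calc elog ‖L‖ - (gaussianLogDefect : EReal)
      ≤ elog ‖L‖ + extIntegral (gaussianReal 0 1) fun x => elog |x| := by
        rw [sub_eq_add_neg]
        refine add_le_add le_rfl ?_
        rw [gaussianLogDefect, extIntegral, EReal.coe_ennreal_toReal hneg]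
        rw [sub_eq_add_neg]
        exact le_add_of_nonneg_left (EReal.coe_ennreal_nonneg _)
    _ = extIntegral (stdGaussian V) fun c => elog ‖L‖ + elog |inner ℝ w c| := by
        rw [← stdGaussian_map_inner hw1] at hpos ⊢
        rw [extIntegral_map hm hmg, extIntegral_add measurable_const hmc _ _,
          extIntegral_const]
        · rw [elog_of_pos hL0, EReal.real_coe_toENNReal]; simp
        · rwa [lintegral_map hmg.ereal_toENNReal hm] at hpos
    _ ≤ _ := extIntegral_mono_ae (ae_of_all _ hpt)

lemma lintegral_posLog_stdGaussian :
    ∫⁻ c, ENNReal.ofReal (Real.posLog ‖c‖) ∂(stdGaussian V) ≠ ⊤ := by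
  have hi : Integrable (id : V → V) (stdGaussian V) := IsGaussian.integrable_id
  refine ne_top_of_le_ne_top hi.norm.lintegral_lt_top.ne (lintegral_mono fun x => ?_)
  refine ENNReal.ofReal_le_ofReal ?_
  rw [Real.posLog]
  exact max_le (norm_nonneg _) (Real.log_le_self (norm_nonneg _))

end Gaussian

/-! ### The Markov chain of vectors moved by the cocycle -/

lemma lintegral_edge_fst {Y V : Type*} [MeasurableSpace Y] [MeasurableSpace V]
    {q : Kernel Y Y} [IsMarkovKernel q]
    (μ : Measure (Y × V)) [SFinite μ] {g : Y × Y → ℝ≥0∞} (hg : Measurable g) :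
    ∫⁻ r, g (r.1.1, r.2) ∂(μ ⊗ₘ (q.comap Prod.fst measurable_fst)) = ∫⁻ p, g p ∂(μ.fst ⊗ₘ q) := by
  rw [Measure.lintegral_compProd hg, Measure.fst,
    lintegral_map hg.lintegral_kernel_prod_right' measurable_fst, Measure.lintegral_compProd (by fun_prop)]
  rfl

section VecChain

variable {Y V : Type*} [MeasurableSpace Y] [NormedAddCommGroup V] [NormedSpace ℝ V]
  [MeasurableSpace V]

/-- The kernel `(y, c) ↦ law of (y', A(y, y') c)` for `y' ∼ q(y)`. -/
def vecKernel (q : Kernel Y Y) (A : Y → Y → V →L[ℝ] V) : Kernel (Y × V) (Y × V) :=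
  (Kernel.id ×ₖ (q.comap Prod.fst measurable_fst)).map
    fun r : (Y × V) × Y => (r.2, A r.1.1 r.2 r.1.2)

/-- The laws of the chain of vectors with initial law `μ`. -/
def vecLaw (q : Kernel Y Y) (A : Y → Y → V →L[ℝ] V) (μ : Measure (Y × V)) : ℕ → Measure (Y × V)
  | 0 => μ
  | n + 1 => vecKernel q A ∘ₘ vecLaw q A μ n

/-- The mean logarithmic stretch of a vector in one step. -/
def vecPotential (q : Kernel Y Y) (A : Y → Y → V →L[ℝ] V) (p : Y × V) : EReal :=
  extIntegral (q p.1) fun y => elog (‖A p.1 y p.2‖ / ‖p.2‖)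

variable {q : Kernel Y Y} [IsMarkovKernel q] {A : Y → Y → V →L[ℝ] V}

lemma lintegral_posLog_norm_cocycle {ν : Measure Y} (hA : Measurable fun p : Y × Y => A p.1 p.2)
    (hint : ∫⁻ p, ENNReal.ofReal (Real.posLog ‖A p.1 p.2‖) ∂(ν ⊗ₘ q) ≠ ⊤)
    (μ : Measure (Y × V)) [SFinite μ] (hμ : μ.fst = ν) :
    ∫⁻ r, ENNReal.ofReal (Real.posLog ‖A r.1.1 r.2‖) ∂(μ ⊗ₘ (q.comap Prod.fst measurable_fst)) ≠ ⊤ := by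
  have hm : Measurable fun p : Y × Y => ENNReal.ofReal (Real.posLog ‖A p.1 p.2‖) :=
    (Real.continuous_posLog.measurable.comp hA.norm).ennreal_ofReal
  rwa [← hμ, ← lintegral_edge_fst μ hm] at hint

variable [FiniteDimensional ℝ V] [BorelSpace V]

lemma measurable_apply_cocycle (hA : Measurable fun p : Y × Y => A p.1 p.2) :
    Measurable fun r : (Y × V) × Y => A r.1.1 r.2 r.1.2 := by
  have h1 : Measurable fun r : (Y × V) × Y => A r.1.1 r.2 :=
    Measurable.fun_comp (g := fun p : Y × Y => A p.1 p.2) (f := fun r : (Y × V) × Y => (r.1.1, r.2))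
      hA (by fun_prop)
  have h2 : Measurable fun p : (V →L[ℝ] V) × V => p.1 p.2 := by fun_prop
  exact h2.fun_comp (h1.prodMk measurable_fst.snd)

lemma measurable_vecStep (hA : Measurable fun p : Y × Y => A p.1 p.2) :
    Measurable fun r : (Y × V) × Y => (r.2, A r.1.1 r.2 r.1.2) :=
  measurable_snd.prodMk (measurable_apply_cocycle hA)

lemma isMarkovKernel_vecKernel (hA : Measurable fun p : Y × Y => A p.1 p.2) :
    IsMarkovKernel (vecKernel q A) :=
  Kernel.IsMarkovKernel.map _ (measurable_vecStep hA)

lemma lintegral_vecKernel (hA : Measurable fun p : Y × Y => A p.1 p.2) (p : Y × V)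
    {G : Y × V → ℝ≥0∞} (hG : Measurable G) :
    ∫⁻ r, G r ∂(vecKernel q A p) = ∫⁻ y, G (y, A p.1 y p.2) ∂(q p.1) := by
  rw [vecKernel, Kernel.map_apply _ (measurable_vecStep hA), lintegral_map hG (measurable_vecStep hA),
    Kernel.lintegral_id_prod (hG.fun_comp (measurable_vecStep hA))]
  rfl

lemma vecKernel_comp_eq_map (hA : Measurable fun p : Y × Y => A p.1 p.2) (μ : Measure (Y × V))
    [SFinite μ] :
    vecKernel q A ∘ₘ μ = (μ ⊗ₘ (q.comap Prod.fst measurable_fst)).map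
      fun r : (Y × V) × Y => (r.2, A r.1.1 r.2 r.1.2) := by
  refine Measure.ext_of_lintegral _ fun G hG => ?_
  rw [Measure.lintegral_bind (Kernel.measurable _).aemeasurable hG.aemeasurable,
    lintegral_map hG (measurable_vecStep hA), Measure.lintegral_compProd
      (hG.fun_comp (measurable_vecStep hA))]
  exact lintegral_congr fun p => lintegral_vecKernel hA p hG

lemma vecKernel_comp_fst (hA : Measurable fun p : Y × Y => A p.1 p.2) (μ : Measure (Y × V))
    [SFinite μ] : (vecKernel q A ∘ₘ μ).fst = q ∘ₘ μ.fst := by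
  refine Measure.ext_of_lintegral _ fun G hG => ?_
  rw [Measure.lintegral_bind q.measurable.aemeasurable hG.aemeasurable, Measure.fst, Measure.fst,
    lintegral_map hG measurable_fst, lintegral_map hG.lintegral_kernel measurable_fst,
    Measure.lintegral_bind (Kernel.measurable _).aemeasurable (hG.fun_comp measurable_fst).aemeasurable]
  exact lintegral_congr fun p => lintegral_vecKernel hA p (hG.fun_comp measurable_fst)

lemma measurable_vecPotential (hA : Measurable fun p : Y × Y => A p.1 p.2) :
    Measurable (vecPotential q A) :=
  measurable_extIntegral_kernel (q.comap Prod.fst measurable_fst)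
    (g := fun r : (Y × V) × Y => elog (‖A r.1.1 r.2 r.1.2‖ / ‖r.1.2‖))
    (measurable_elog.fun_comp ((measurable_apply_cocycle hA).norm.div measurable_fst.snd.norm))

lemma isProbabilityMeasure_vecLaw (hA : Measurable fun p : Y × Y => A p.1 p.2)
    (μ : Measure (Y × V)) [IsProbabilityMeasure μ] (n : ℕ) :
    IsProbabilityMeasure (vecLaw q A μ n) := by
  have := isMarkovKernel_vecKernel (q := q) hA
  induction n with
  | zero => exact inferInstanceAs (IsProbabilityMeasure μ)
  | succ n ih =>
    rw [vecLaw]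
    infer_instance

lemma vecLaw_fst (hA : Measurable fun p : Y × Y => A p.1 p.2) {ν : Measure Y} (hν : q ∘ₘ ν = ν)
    (μ : Measure (Y × V)) [IsProbabilityMeasure μ] (hμ : μ.fst = ν) (n : ℕ) :
    (vecLaw q A μ n).fst = ν := by
  induction n with
  | zero => exact hμ
  | succ n ih =>
    have := isProbabilityMeasure_vecLaw (q := q) hA μ n
    rw [vecLaw, vecKernel_comp_fst hA, ih, hν]

/-- The chain of vectors started from `ν ⊗ κ` is the image of the initial vector under the products
along the paths of the base chain. -/
lemma vecLaw_eq_map (hA : Measurable fun p : Y × Y => A p.1 p.2) (ν : Measure Y)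
    [IsProbabilityMeasure ν] (κ : Kernel Y V) [IsMarkovKernel κ] (n : ℕ) :
    vecLaw q A (ν ⊗ₘ κ) n
      = (markovChain q ν ⊗ₘ (κ.comap (fun z : ℕ → Y => z 0) (measurable_pi_apply 0))).map
        fun p => (p.1 n, pathProd A n p.1 p.2) := by
  have hap : Measurable fun p : (V →L[ℝ] V) × V => p.1 p.2 := by fun_prop
  have hmap : ∀ n, Measurable fun p : (ℕ → Y) × V => (p.1 n, pathProd A n p.1 p.2) := fun n =>
    ((measurable_pi_apply n).fun_comp measurable_fst).prodMk
      (hap.fun_comp (((measurable_pathProd hA n).fun_comp measurable_fst).prodMk measurable_snd))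
  induction n with
  | zero =>
    refine Measure.ext_of_lintegral _ fun G hG => ?_
    rw [vecLaw, lintegral_map hG (hmap 0), Measure.lintegral_compProd (hG.fun_comp (hmap 0)),
      Measure.lintegral_compProd hG]
    conv_lhs => rw [← markovChain_map_zero q ν]
    rw [lintegral_map hG.lintegral_kernel_prod_right' (measurable_pi_apply 0)]
    rfl
  | succ n ih =>
    refine Measure.ext_of_lintegral _ fun G hG => ?_
    have hH : Measurable fun p : Y × V => ∫⁻ y, G (y, A p.1 y p.2) ∂(q p.1) :=
      Measurable.lintegral_kernel_prod_right' (κ := q.comap Prod.fst measurable_fst)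
        (f := fun r : (Y × V) × Y => G (r.2, A r.1.1 r.2 r.1.2)) (hG.fun_comp (measurable_vecStep hA))
    rw [vecLaw, Measure.lintegral_bind (Kernel.measurable _).aemeasurable hG.aemeasurable, ih,
      lintegral_congr (fun p => lintegral_vecKernel hA p hG), lintegral_map hH (hmap n),
      lintegral_map hG (hmap (n + 1)), Measure.lintegral_compProd (hH.fun_comp (hmap n)),
      Measure.lintegral_compProd (hG.fun_comp (hmap (n + 1)))]
    have hK : Measurable fun r : ((ℕ → Y) × Y) × V =>
        G (r.1.2, A (r.1.1 n) r.1.2 (pathProd A n r.1.1 r.2)) := by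
      have h1 : Measurable fun r : ((ℕ → Y) × Y) × V =>
          ((r.1.1 n, pathProd A n r.1.1 r.2), r.1.2) :=
        ((hmap n).fun_comp (measurable_fst.fst.prodMk measurable_snd)).prodMk measurable_fst.snd
      exact (hG.fun_comp (measurable_vecStep hA)).comp h1
    have hg : Measurable fun p : (ℕ → Y) × Y =>
        ∫⁻ c, G (p.2, A (p.1 n) p.2 (pathProd A n p.1 c)) ∂(κ (p.1 0)) :=
      Measurable.lintegral_kernel_prod_right'
        (κ := κ.comap (fun p : (ℕ → Y) × Y => p.1 0) ((measurable_pi_apply 0).fun_comp measurable_fst)) hK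
    -- The initial vector is integrated out first, leaving a function of the path up to time n and
    -- the next point, to which the Markov property applies. The remaining difference is the order
    -- of integration in c and y.
    have hmk := lintegral_markovChain_succ q ν n
      (g := fun p => ∫⁻ c, G (p.2, A (p.1 n) p.2 (pathProd A n p.1 c)) ∂(κ (p.1 0))) hg
      (fun z z' y h => by
        simp only [h n le_rfl, h 0 (Nat.zero_le n), pathProd_congr A n h])
    refine Eq.trans ?_ hmk.symm
    refine lintegral_congr fun z => ?_
    refine lintegral_lintegral_swap (μ := κ (z 0)) (ν := q (z n)) ?_
    exact (hK.fun_comp (f := fun r : V × Y => (((z, r.2), r.1) : ((ℕ → Y) × Y) × V)) (by fun_prop)).aemeasurable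

section Step

variable {ν : Measure Y} (hA : Measurable fun p : Y × Y => A p.1 p.2)
  (hint : ∫⁻ p, ENNReal.ofReal (Real.posLog ‖A p.1 p.2‖) ∂(ν ⊗ₘ q) ≠ ⊤)
include hA hint

omit [FiniteDimensional ℝ V] [BorelSpace V] in
lemma lintegral_posLog_stretch (μ : Measure (Y × V)) [SFinite μ] (hμ : μ.fst = ν) :
    ∫⁻ r, (elog (‖A r.1.1 r.2 r.1.2‖ / ‖r.1.2‖)).toENNReal
      ∂(μ ⊗ₘ (q.comap Prod.fst measurable_fst)) ≠ ⊤ := by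
  refine ne_top_of_le_ne_top (lintegral_posLog_norm_cocycle hA hint μ hμ) (lintegral_mono fun r => ?_)
  rw [toENNReal_elog _ (by positivity)]
  exact ENNReal.ofReal_le_ofReal (Real.posLog_le_posLog (by positivity)
    (ContinuousLinearMap.ratio_le_opNorm _ _))

lemma lintegral_posLog_vecKernel (μ : Measure (Y × V)) [SFinite μ] (hμ : μ.fst = ν)
    (hc : ∫⁻ p, ENNReal.ofReal (Real.posLog ‖p.2‖) ∂μ ≠ ⊤) :
    ∫⁻ p, ENNReal.ofReal (Real.posLog ‖p.2‖) ∂(vecKernel q A ∘ₘ μ) ≠ ⊤ := by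
  have hpl : Measurable fun c : V => ENNReal.ofReal (Real.posLog ‖c‖) :=
    (Real.continuous_posLog.measurable.fun_comp measurable_norm).ennreal_ofReal
  rw [vecKernel_comp_eq_map hA, lintegral_map (hpl.fun_comp measurable_snd) (measurable_vecStep hA)]
  have h2 : ∫⁻ r, ENNReal.ofReal (Real.posLog ‖r.1.2‖) ∂(μ ⊗ₘ (q.comap Prod.fst measurable_fst))
      ≠ ⊤ := by
    rw [Measure.lintegral_compProd (hpl.fun_comp measurable_fst.snd)]
    simpa using hc
  refine ne_top_of_le_ne_top
    (ENNReal.add_ne_top.2 ⟨lintegral_posLog_norm_cocycle hA hint μ hμ, h2⟩) ?_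
  rw [← lintegral_add_right _ (hpl.fun_comp measurable_fst.snd)]
  refine lintegral_mono fun r => ?_
  rw [← ENNReal.ofReal_add Real.posLog_nonneg Real.posLog_nonneg]
  refine ENNReal.ofReal_le_ofReal ((Real.posLog_le_posLog (norm_nonneg _)
    (ContinuousLinearMap.le_opNorm _ _)).trans Real.posLog_mul)

/-- This is log‖Ac‖ = log‖c‖ + log(‖Ac‖/‖c‖), integrated. At c = 0 both sides are -∞, since 0/0 = 0
and `elog 0 = ⊥`. Finiteness of the positive parts permits splitting the integral. -/
lemma extIntegral_elog_vecKernel (μ : Measure (Y × V)) [SFinite μ] (hμ : μ.fst = ν)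
    (hc : ∫⁻ p, ENNReal.ofReal (Real.posLog ‖p.2‖) ∂μ ≠ ⊤) :
    extIntegral (vecKernel q A ∘ₘ μ) (fun p => elog ‖p.2‖)
      = extIntegral μ (fun p => elog ‖p.2‖) + extIntegral μ (vecPotential q A) := by
  have hn : Measurable fun c : V => elog ‖c‖ := measurable_elog.fun_comp measurable_norm
  have hn1 : Measurable fun r : (Y × V) × Y => elog ‖r.1.2‖ := hn.fun_comp measurable_fst.snd
  have hs : Measurable fun r : (Y × V) × Y => elog (‖A r.1.1 r.2 r.1.2‖ / ‖r.1.2‖) :=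
    measurable_elog.fun_comp ((measurable_apply_cocycle hA).norm.div measurable_fst.snd.norm)
  have hf1 : ∫⁻ r, (elog ‖r.1.2‖).toENNReal ∂(μ ⊗ₘ (q.comap Prod.fst measurable_fst)) ≠ ⊤ := by
    rw [Measure.lintegral_compProd hn1.ereal_toENNReal]
    simpa [toENNReal_elog] using hc
  have hf2 := lintegral_posLog_stretch hA hint μ hμ
  rw [vecKernel_comp_eq_map hA, extIntegral_map (measurable_vecStep hA) (hn.fun_comp measurable_snd)]
  have hpt : ∀ r : (Y × V) × Y, elog ‖A r.1.1 r.2 r.1.2‖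
      = elog ‖r.1.2‖ + elog (‖A r.1.1 r.2 r.1.2‖ / ‖r.1.2‖) := by
    intro r
    rw [← elog_mul (norm_nonneg _)]
    congr 1
    by_cases h : r.1.2 = 0
    · simp [h]
    · have := norm_ne_zero_iff.2 h
      field_simp
  simp only [hpt]
  rw [extIntegral_add hn1 hs hf1 hf2, extIntegral_compProd _ hn1 hf1, extIntegral_compProd _ hs hf2]
  congr 1
  exact congrArg _ (funext fun p => extIntegral_const (μ := q p.1) (elog ‖p.2‖))

lemma lintegral_posLog_vecLaw (hν : q ∘ₘ ν = ν) (μ : Measure (Y × V)) [IsProbabilityMeasure μ]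
    (hμ : μ.fst = ν) (hc : ∫⁻ p, ENNReal.ofReal (Real.posLog ‖p.2‖) ∂μ ≠ ⊤) (n : ℕ) :
    ∫⁻ p, ENNReal.ofReal (Real.posLog ‖p.2‖) ∂(vecLaw q A μ n) ≠ ⊤ := by
  induction n with
  | zero => exact hc
  | succ n ih =>
    have := isProbabilityMeasure_vecLaw (q := q) hA μ n
    exact lintegral_posLog_vecKernel hA hint _ (vecLaw_fst hA hν μ hμ n) ih

lemma extIntegral_elog_vecLaw (hν : q ∘ₘ ν = ν) (μ : Measure (Y × V)) [IsProbabilityMeasure μ]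
    (hμ : μ.fst = ν) (hc : ∫⁻ p, ENNReal.ofReal (Real.posLog ‖p.2‖) ∂μ ≠ ⊤) (n : ℕ) :
    extIntegral (vecLaw q A μ n) (fun p => elog ‖p.2‖)
      = extIntegral μ (fun p => elog ‖p.2‖)
        + ∑ j ∈ Finset.range n, extIntegral (vecLaw q A μ j) (vecPotential q A) := by
  induction n with
  | zero => simp [vecLaw]
  | succ n ih =>
    have := isProbabilityMeasure_vecLaw (q := q) hA μ n
    rw [Finset.sum_range_succ, ← add_assoc, ← ih]
    exact extIntegral_elog_vecKernel hA hint _ (vecLaw_fst hA hν μ hμ n)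
      (lintegral_posLog_vecLaw hA hint hν μ hμ hc n)

variable [IsProbabilityMeasure ν]

/-- Conditionally on the base path, the only randomness left in the vector is its initial value, of
law `κ (z 0)`. This form lets upper and lower bounds be proved path by path. -/
lemma extIntegral_elog_vecLaw_compProd (hν : q ∘ₘ ν = ν) (κ : Kernel Y V) [IsMarkovKernel κ]
    (hc : ∫⁻ p, ENNReal.ofReal (Real.posLog ‖p.2‖) ∂(ν ⊗ₘ κ) ≠ ⊤) (n : ℕ) :
    extIntegral (vecLaw q A (ν ⊗ₘ κ) n) (fun p => elog ‖p.2‖)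
      = extIntegral (markovChain q ν) fun z => extIntegral (κ (z 0)) fun c =>
          elog ‖pathProd A n z c‖ := by
  have hap : Measurable fun p : (V →L[ℝ] V) × V => p.1 p.2 := by fun_prop
  have hap' : Measurable fun p : (ℕ → Y) × V => pathProd A n p.1 p.2 :=
    hap.fun_comp (((measurable_pathProd hA n).fun_comp measurable_fst).prodMk measurable_snd)
  have hmap : Measurable fun p : (ℕ → Y) × V => (p.1 n, pathProd A n p.1 p.2) :=
    ((measurable_pi_apply n).fun_comp measurable_fst).prodMk hap'
  have hpl : Measurable fun p : Y × V => ENNReal.ofReal (Real.posLog ‖p.2‖) :=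
    (Real.continuous_posLog.measurable.fun_comp measurable_snd.norm).ennreal_ofReal
  have hn : Measurable fun p : Y × V => elog ‖p.2‖ := measurable_elog.fun_comp measurable_snd.norm
  have hfin := lintegral_posLog_vecLaw hA hint hν (ν ⊗ₘ κ) (Measure.fst_compProd _ _) hc n
  rw [vecLaw_eq_map hA, lintegral_map hpl hmap] at hfin
  rw [vecLaw_eq_map hA, extIntegral_map hmap hn, extIntegral_compProd _ (hn.fun_comp hmap)]
  · rfl
  · simpa only [toENNReal_elog _ (norm_nonneg _)] using hfin

/-- Vectors of norm at most one do not grow faster than the cocycle. -/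
lemma extIntegral_elog_vecLaw_le [StandardBorelSpace V] (hν : q ∘ₘ ν = ν) (μ : Measure (Y × V))
    [IsProbabilityMeasure μ] (hμ : μ.fst = ν) (hc : ∀ᵐ p ∂μ, ‖p.2‖ ≤ 1) (n : ℕ) :
    extIntegral (vecLaw q A μ n) (fun p => elog ‖p.2‖) ≤ pathGrowth q ν A n := by
  -- Disintegration over the base point presents the initial vector through a kernel, as the path
  -- representation requires.
  have hdis : ν ⊗ₘ μ.condKernel = μ := by rw [← hμ]; exact Measure.disintegrate μ μ.condKernel
  have hc0 : ∫⁻ p, ENNReal.ofReal (Real.posLog ‖p.2‖) ∂μ = 0 := by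
    rw [lintegral_eq_zero_iff' (by
      exact (Real.continuous_posLog.measurable.fun_comp measurable_snd.norm).ennreal_ofReal.aemeasurable)]
    filter_upwards [hc] with p hp
    have : Real.posLog ‖p.2‖ = 0 := (Real.posLog_eq_zero_iff _).2 (by rwa [abs_norm])
    simp [this]
  rw [← hdis, extIntegral_elog_vecLaw_compProd hA hint hν _ (by rw [hdis, hc0]; simp), pathGrowth]
  have hm1 : MeasurableSet {p : Y × V | ‖p.2‖ ≤ 1} := measurableSet_le (by fun_prop) (by fun_prop)
  have hc' : ∀ᵐ y ∂ν, ∀ᵐ c ∂(μ.condKernel y), ‖c‖ ≤ 1 := by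
    rw [← hdis] at hc
    exact Measure.ae_ae_of_ae_compProd hc
  have hc'' : ∀ᵐ z ∂(markovChain q ν), ∀ᵐ c ∂(μ.condKernel (z 0)), ‖c‖ ≤ 1 := by
    rw [← markovChain_map_zero q ν] at hc'
    exact ae_of_ae_map (measurable_pi_apply 0).aemeasurable hc'
  refine extIntegral_mono_ae (hc''.mono fun z hz => ?_)
  conv_rhs => rw [← extIntegral_const (μ := μ.condKernel (z 0)) (elog ‖pathProd A n z‖)]
  refine extIntegral_mono_ae (hz.mono fun c hcc => elog_mono ?_)
  exact (ContinuousLinearMap.le_opNorm _ _).trans (mul_le_of_le_one_right (norm_nonneg _) hcc)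

end Step

end VecChain

/-! ### Gaussian initial vectors over the base chain. -/

section Gaussian

variable {Y V : Type*} [MeasurableSpace Y] [NormedAddCommGroup V] [InnerProductSpace ℝ V]
  [FiniteDimensional ℝ V] [MeasurableSpace V] [BorelSpace V]
  {q : Kernel Y Y} [IsMarkovKernel q] {A : Y → Y → V →L[ℝ] V} {ν : Measure Y}
  [IsProbabilityMeasure ν]

lemma lintegral_posLog_gaussian_compProd :
    ∫⁻ p, ENNReal.ofReal (Real.posLog ‖p.2‖) ∂(ν ⊗ₘ Kernel.const Y (stdGaussian V)) ≠ ⊤ := by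
  rw [Measure.lintegral_compProd (by
    exact (Real.continuous_posLog.measurable.fun_comp measurable_snd.norm).ennreal_ofReal)]
  simpa using lintegral_posLog_stdGaussian (V := V)

/-- Gaussian vectors grow as fast as the cocycle, up to a bounded error. -/
lemma pathGrowth_le_extIntegral_gaussian [Nontrivial V] (hA : Measurable fun p : Y × Y => A p.1 p.2)
    (hint : ∫⁻ p, ENNReal.ofReal (Real.posLog ‖A p.1 p.2‖) ∂(ν ⊗ₘ q) ≠ ⊤) (hν : q ∘ₘ ν = ν) (n : ℕ) :
    pathGrowth q ν A n + ((-gaussianLogDefect : ℝ) : EReal)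
      ≤ extIntegral (vecLaw q A (ν ⊗ₘ Kernel.const Y (stdGaussian V)) n) fun p => elog ‖p.2‖ := by
  rw [extIntegral_elog_vecLaw_compProd hA hint hν _ lintegral_posLog_gaussian_compProd, pathGrowth]
  have hm : Measurable fun z : ℕ → Y => elog ‖pathProd A n z‖ :=
    measurable_elog.fun_comp (measurable_pathProd hA n).norm
  conv_lhs => rw [← extIntegral_const (μ := markovChain q ν) ((-gaussianLogDefect : ℝ) : EReal)]
  rw [← extIntegral_add hm measurable_const]
  · refine extIntegral_mono_ae (ae_of_all _ fun z => ?_)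
    rw [EReal.coe_neg, ← sub_eq_add_neg]
    exact elog_opNorm_sub_le_gaussian _
  · exact ne_top_of_le_ne_top (ENNReal.mul_ne_top (by simp) hint)
      (lintegral_posLog_pathProd_le hν hA n)
  · rw [EReal.real_coe_toENNReal]; simp

end Gaussian

/-! ### Projective bundles with cemetery, seen through homogeneous coordinates -/

/-- A presentation of a measurable space `Z` as the projective bundle of `Y × V → Y` with a
cemetery point adjoined to each fibre: `mk y c` is the line spanned by `c`, or the cemetery point
if `c = 0`, and `vec` is a measurable choice of a unit vector in each line. -/
structure ProjModel (Y V Z : Type*) [MeasurableSpace Y] [NormedAddCommGroup V] [NormedSpace ℝ V]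
    [MeasurableSpace V] [MeasurableSpace Z] where
  ofFields ::
  base : Z → Y
  vec : Z → V
  mk : Y → V → Z
  measurable_base : Measurable base
  measurable_vec : Measurable vec
  measurable_mk : Measurable fun p : Y × V => mk p.1 p.2
  base_mk : ∀ y c, base (mk y c) = y
  mk_base_vec : ∀ z, mk (base z) (vec z) = z
  mk_smul : ∀ y c (a : ℝ), a ≠ 0 → mk y (a • c) = mk y c
  vec_mk : ∀ y c, ∃ a : ℝ, a ≠ 0 ∧ vec (mk y c) = a • c
  norm_vec : ∀ z, vec z ≠ 0 → ‖vec z‖ = 1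

lemma integral_bind_of_bounded {α β : Type*} [MeasurableSpace α] [MeasurableSpace β] (κ : Kernel α β)
    [IsMarkovKernel κ] (μ : Measure α) [IsFiniteMeasure μ] {ψ : β → ℝ} (hψ : Measurable ψ)
    {C : ℝ} (hC : ∀ z, |ψ z| ≤ C) :
    ∫ b, ψ b ∂(κ ∘ₘ μ) = ∫ a, ∫ b, ψ b ∂(κ a) ∂μ := by
  rw [← Measure.snd_compProd, Measure.snd, integral_map measurable_snd.aemeasurable
    hψ.aestronglyMeasurable, Measure.integral_compProd]
  exact Integrable.of_bound (hψ.comp measurable_snd).aestronglyMeasurable C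
    (ae_of_all _ fun p => hC p.2)

namespace ProjModel

variable {Y V Z : Type*} [MeasurableSpace Y] [NormedAddCommGroup V] [NormedSpace ℝ V]
  [MeasurableSpace V] [MeasurableSpace Z] (M : ProjModel Y V Z)

/-- The action of the cocycle on lines. -/
def kernel (q : Kernel Y Y) (A : Y → Y → V →L[ℝ] V) : Kernel Z Z :=
  (Kernel.id ×ₖ (q.comap M.base M.measurable_base)).map
    fun r : Z × Y => M.mk r.2 (A (M.base r.1) r.2 (M.vec r.1))

/-- The annealed potential. -/
def potential (q : Kernel Y Y) (A : Y → Y → V →L[ℝ] V) (z : Z) : EReal :=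
  vecPotential q A (M.base z, M.vec z)

/-- The invariant probability measures over `ν`. -/
def lifts (q : Kernel Y Y) (A : Y → Y → V →L[ℝ] V) (ν : Measure Y) : Set (Measure Z) :=
  {μ | IsProbabilityMeasure μ ∧ M.kernel q A ∘ₘ μ = μ ∧ μ.map M.base = ν}

/-- The cemetery points. -/
def dead : Set Z := {z | M.vec z = 0}

lemma vec_mk_eq_zero_iff (y : Y) (c : V) : M.vec (M.mk y c) = 0 ↔ c = 0 := by
  obtain ⟨a, ha, h⟩ := M.vec_mk y c
  rw [h, smul_eq_zero, or_iff_right ha]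

lemma measurable_base_vec : Measurable fun z => (M.base z, M.vec z) :=
  M.measurable_base.prodMk M.measurable_vec

variable {q : Kernel Y Y} {A : Y → Y → V →L[ℝ] V}

/-- Normalizing a vector changes it by a nonzero scalar, which linear maps commute with and `mk`
forgets; in the stretch the scalar cancels. -/
lemma mk_apply_vec_mk (y y' : Y) (c : V) :
    M.mk y' (A y y' (M.vec (M.mk y c))) = M.mk y' (A y y' c) := by
  obtain ⟨a, ha, h⟩ := M.vec_mk y c
  rw [h, map_smul, M.mk_smul _ _ _ ha]

lemma stretch_vec_mk (L : V →L[ℝ] V) (y : Y) (c : V) :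
    ‖L (M.vec (M.mk y c))‖ / ‖M.vec (M.mk y c)‖ = ‖L c‖ / ‖c‖ := by
  obtain ⟨a, ha, h⟩ := M.vec_mk y c
  rw [h, map_smul, norm_smul, norm_smul, mul_div_mul_left _ _ (norm_ne_zero_iff.2 ha)]

lemma potential_mk (p : Y × V) : M.potential q A (M.mk p.1 p.2) = vecPotential q A p := by
  simp only [potential, vecPotential, M.base_mk, M.stretch_vec_mk]

variable [BorelSpace V]

lemma measurableSet_dead : MeasurableSet M.dead := M.measurable_vec (measurableSet_singleton 0)

variable [FiniteDimensional ℝ V] [IsMarkovKernel q]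

lemma measurable_apply_vec (hA : Measurable fun p : Y × Y => A p.1 p.2) :
    Measurable fun r : Z × Y => A (M.base r.1) r.2 (M.vec r.1) :=
  (measurable_apply_cocycle hA).fun_comp
    ((M.measurable_base_vec.comp measurable_fst).prodMk measurable_snd)

lemma measurable_step (hA : Measurable fun p : Y × Y => A p.1 p.2) :
    Measurable fun r : Z × Y => M.mk r.2 (A (M.base r.1) r.2 (M.vec r.1)) :=
  M.measurable_mk.fun_comp (measurable_snd.prodMk (M.measurable_apply_vec hA))

lemma isMarkovKernel_kernel (hA : Measurable fun p : Y × Y => A p.1 p.2) :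
    IsMarkovKernel (M.kernel q A) :=
  Kernel.IsMarkovKernel.map _ (M.measurable_step hA)

lemma kernel_apply (hA : Measurable fun p : Y × Y => A p.1 p.2) (z : Z) :
    M.kernel q A z = (q (M.base z)).map fun y => M.mk y (A (M.base z) y (M.vec z)) := by
  have h : Measurable fun y => M.mk y (A (M.base z) y (M.vec z)) :=
    (M.measurable_step hA).fun_comp (f := fun y => (z, y)) (by fun_prop)
  refine Measure.ext_of_lintegral _ fun G hG => ?_
  rw [lintegral_map hG h, kernel, Kernel.map_apply _ (M.measurable_step hA),
    lintegral_map hG (M.measurable_step hA),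
    Kernel.lintegral_id_prod (hG.fun_comp (M.measurable_step hA))]
  rfl

lemma kernel_comp_eq_map (hA : Measurable fun p : Y × Y => A p.1 p.2) (μ : Measure Z) [SFinite μ] :
    M.kernel q A ∘ₘ μ = (μ ⊗ₘ (q.comap M.base M.measurable_base)).map
      fun r : Z × Y => M.mk r.2 (A (M.base r.1) r.2 (M.vec r.1)) := by
  refine Measure.ext_of_lintegral _ fun G hG => ?_
  rw [Measure.lintegral_bind (Kernel.measurable _).aemeasurable hG.aemeasurable,
    lintegral_map hG (M.measurable_step hA), Measure.lintegral_compProd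
      (hG.fun_comp (M.measurable_step hA))]
  refine lintegral_congr fun z => ?_
  rw [M.kernel_apply hA, lintegral_map hG
    ((M.measurable_step hA).fun_comp (f := fun y => (z, y)) (by fun_prop))]
  rfl

/-- The chain of lines is the image of the chain of vectors. -/
lemma kernel_comp_map_mk (hA : Measurable fun p : Y × Y => A p.1 p.2) (μ : Measure (Y × V))
    [SFinite μ] :
    M.kernel q A ∘ₘ (μ.map fun p => M.mk p.1 p.2)
      = (vecKernel q A ∘ₘ μ).map fun p => M.mk p.1 p.2 := by
  refine Measure.ext_of_lintegral _ fun G hG => ?_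
  rw [Measure.lintegral_bind (Kernel.measurable _).aemeasurable hG.aemeasurable,
    lintegral_map hG.lintegral_kernel M.measurable_mk, lintegral_map hG M.measurable_mk,
    Measure.lintegral_bind (Kernel.measurable _).aemeasurable
      (hG.fun_comp M.measurable_mk).aemeasurable]
  refine lintegral_congr fun p => ?_
  rw [lintegral_vecKernel hA p (hG.fun_comp M.measurable_mk), M.kernel_apply hA, lintegral_map hG
    ((M.measurable_step hA).fun_comp (f := fun y => (M.mk p.1 p.2, y)) (by fun_prop))]
  simp only [M.base_mk, M.mk_apply_vec_mk]

lemma measurable_potential (hA : Measurable fun p : Y × Y => A p.1 p.2) :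
    Measurable (M.potential q A) :=
  (measurable_vecPotential hA).comp M.measurable_base_vec

-- At a cemetery point the stretch is the quotient 0/0 = 0, and its extended logarithm is -∞ for
-- every next point.
omit [FiniteDimensional ℝ V] [BorelSpace V] in
lemma potential_eq_bot {z : Z} (hz : z ∈ M.dead) : M.potential q A z = ⊥ := by
  have : M.vec z = 0 := hz
  simp [potential, vecPotential, this, extIntegral_const]

lemma dead_null_of_extIntegral (hA : Measurable fun p : Y × Y => A p.1 p.2) {μ : Measure Z}
    (h : extIntegral μ (M.potential q A) ≠ ⊥) : μ M.dead = 0 :=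
  measure_mono_null (fun _ hz => M.potential_eq_bot hz)
    (measure_eq_bot_of_extIntegral (M.measurable_potential hA) h)

omit [FiniteDimensional ℝ V] [BorelSpace V] [IsMarkovKernel q] in
lemma map_mk_map_base_vec (μ : Measure Z) :
    (μ.map fun z => (M.base z, M.vec z)).map (fun p => M.mk p.1 p.2) = μ := by
  rw [Measure.map_map M.measurable_mk M.measurable_base_vec]
  conv_rhs => rw [← Measure.map_id (μ := μ)]
  congr 1
  funext z
  exact M.mk_base_vec z

variable {ν : Measure Y}

omit [BorelSpace V] [FiniteDimensional ℝ V] in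
lemma lintegral_posLog_edge (hA : Measurable fun p : Y × Y => A p.1 p.2)
    {μ : Measure Z} [SFinite μ] (hμ : μ.map M.base = ν) :
    ∫⁻ r, ENNReal.ofReal (Real.posLog ‖A (M.base r.1) r.2‖) ∂(μ ⊗ₘ q.comap M.base M.measurable_base)
      = ∫⁻ p, ENNReal.ofReal (Real.posLog ‖A p.1 p.2‖) ∂(ν ⊗ₘ q) := by
  have hm : Measurable fun p : Y × Y => ENNReal.ofReal (Real.posLog ‖A p.1 p.2‖) :=
    (Real.continuous_posLog.measurable.comp hA.norm).ennreal_ofReal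
  rw [← hμ, Measure.lintegral_compProd hm, Measure.lintegral_compProd
    (hm.fun_comp (f := fun r : Z × Y => (M.base r.1, r.2))
      ((M.measurable_base.comp measurable_fst).prodMk measurable_snd)),
    lintegral_map hm.lintegral_kernel_prod_right' M.measurable_base]
  rfl

omit [BorelSpace V] [FiniteDimensional ℝ V] in
lemma lintegral_pos_potential (hA : Measurable fun p : Y × Y => A p.1 p.2)
    (hint : ∫⁻ p, ENNReal.ofReal (Real.posLog ‖A p.1 p.2‖) ∂(ν ⊗ₘ q) ≠ ⊤)
    {μ : Measure Z} [SFinite μ] (hμ : μ.map M.base = ν) :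
    ∫⁻ z, (M.potential q A z).toENNReal ∂μ ≠ ⊤ := by
  have hm : Measurable fun p : Y × Y => ENNReal.ofReal (Real.posLog ‖A p.1 p.2‖) :=
    (Real.continuous_posLog.measurable.comp hA.norm).ennreal_ofReal
  rw [← M.lintegral_posLog_edge hA hμ, Measure.lintegral_compProd
    (hm.fun_comp (f := fun r : Z × Y => (M.base r.1, r.2))
      ((M.measurable_base.comp measurable_fst).prodMk measurable_snd))] at hint
  refine ne_top_of_le_ne_top hint (lintegral_mono fun z => ?_)
  refine (toENNReal_extIntegral_le _).trans (lintegral_mono fun y => ?_)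
  simp only
  rw [toENNReal_elog _ (by positivity)]
  exact ENNReal.ofReal_le_ofReal (Real.posLog_le_posLog (by positivity)
    (ContinuousLinearMap.ratio_le_opNorm _ _))

lemma map_mk_vecLaw (hA : Measurable fun p : Y × Y => A p.1 p.2) {μ : Measure Z}
    [IsProbabilityMeasure μ] (hμ : M.kernel q A ∘ₘ μ = μ) (n : ℕ) :
    (vecLaw q A (μ.map fun z => (M.base z, M.vec z)) n).map (fun p => M.mk p.1 p.2) = μ := by
  have : IsProbabilityMeasure (μ.map fun z => (M.base z, M.vec z)) :=
    Measure.isProbabilityMeasure_map M.measurable_base_vec.aemeasurable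
  induction n with
  | zero => exact M.map_mk_map_base_vec μ
  | succ n ih =>
    have := isProbabilityMeasure_vecLaw (q := q) hA (μ.map fun z => (M.base z, M.vec z)) n
    rw [vecLaw, ← M.kernel_comp_map_mk hA, ih, hμ]

omit [MeasurableSpace Y] [MeasurableSpace V] [NormedAddCommGroup V] [NormedSpace ℝ V] in
lemma _root_.EReal.le_inv_mul_of_sum_le {x g : EReal} {n : ℕ} (hn : 1 ≤ n)
    (h : ∑ _j ∈ Finset.range n, x ≤ g) : x ≤ (((n : ℝ)⁻¹ : ℝ) : EReal) * g := by
  have hn0 : (0 : ℝ) < n := by exact_mod_cast hn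
  have hn0' : (0 : ℝ) < (n : ℝ)⁻¹ := inv_pos.2 hn0
  rw [Finset.sum_const, Finset.card_range, EReal.nsmul_eq_mul] at h
  have h2 := mul_le_mul_of_nonneg_left h (a := (((n : ℝ)⁻¹ : ℝ) : EReal)) (by exact_mod_cast hn0'.le)
  refine le_trans (le_of_eq ?_) h2
  rw [← mul_assoc]
  have : ((n : ℕ) : EReal) = ((n : ℝ) : EReal) := rfl
  rw [this, ← EReal.coe_mul, inv_mul_cancel₀ hn0.ne', EReal.coe_one, one_mul]

variable [IsProbabilityMeasure ν]

/-- The annealed potential integrates to at most the growth rate. -/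
theorem extIntegral_potential_le [StandardBorelSpace V]
    (hA : Measurable fun p : Y × Y => A p.1 p.2)
    (hint : ∫⁻ p, ENNReal.ofReal (Real.posLog ‖A p.1 p.2‖) ∂(ν ⊗ₘ q) ≠ ⊤) (hν : q ∘ₘ ν = ν)
    {μ : Measure Z} (hμ : μ ∈ M.lifts q A ν) :
    extIntegral μ (M.potential q A) ≤ pathRate q ν A := by
  obtain ⟨hprob, hinv, hbase⟩ := hμ
  -- Outside the trivial case the cemetery is null, so `vec` is almost surely a unit vector and the
  -- initial logarithmic norm integrates to 0.
  by_cases hbot : extIntegral μ (M.potential q A) = ⊥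
  · rw [hbot]; exact bot_le
  have hd := M.dead_null_of_extIntegral hA hbot
  set μ₀ : Measure (Y × V) := μ.map fun z => (M.base z, M.vec z) with hμ₀
  have hp0 : IsProbabilityMeasure μ₀ :=
    Measure.isProbabilityMeasure_map M.measurable_base_vec.aemeasurable
  have hfst : μ₀.fst = ν := by
    rw [hμ₀, Measure.fst, Measure.map_map measurable_fst M.measurable_base_vec, ← hbase]
    rfl
  have hunit : ∀ᵐ p ∂μ₀, ‖p.2‖ = 1 := by
    rw [hμ₀, ae_map_iff M.measurable_base_vec.aemeasurable
      (measurableSet_eq_fun measurable_snd.norm measurable_const)]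
    have : ∀ᵐ z ∂μ, z ∉ M.dead := by rw [ae_iff]; simpa using hd
    exact this.mono fun z hz => M.norm_vec z hz
  have hc : ∫⁻ p, ENNReal.ofReal (Real.posLog ‖p.2‖) ∂μ₀ ≠ ⊤ := by
    rw [lintegral_congr_ae (g := fun _ => 0) (hunit.mono fun p hp => by simp [hp])]
    simp
  have hu0 : extIntegral μ₀ (fun p => elog ‖p.2‖) = 0 := by
    rw [extIntegral_congr_ae (g := fun _ => 0) (hunit.mono fun p hp => by simp [hp]),
      extIntegral_const]
  refine le_iInf fun ⟨n, hn⟩ => EReal.le_inv_mul_of_sum_le hn ?_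
  have h1 := extIntegral_elog_vecLaw hA hint hν μ₀ hfst hc n
  have h2 := extIntegral_elog_vecLaw_le hA hint hν μ₀ hfst (hunit.mono fun p hp => hp.le) n
  rw [h1, hu0, zero_add] at h2
  -- The laws of the vectors are not stationary, but their images in the space of lines all equal μ,
  -- and the potential depends only on the line. So the telescoped sum has n equal terms.
  refine le_trans (le_of_eq (Finset.sum_congr rfl fun j _ => ?_)) h2
  conv_lhs => rw [← M.map_mk_vecLaw hA hinv j, extIntegral_map M.measurable_mk
    (M.measurable_potential hA)]
  simp only [M.potential_mk]
  rfl

/-! #### Time averages -/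

/-- The average of the laws of the first `n` lines of the chain. -/
def average (q : Kernel Y Y) (A : Y → Y → V →L[ℝ] V) (μ : Measure (Y × V)) (n : ℕ) : Measure Z :=
  ENNReal.ofReal (n : ℝ)⁻¹ •
    ∑ j ∈ Finset.range n, (vecLaw q A μ j).map fun p => M.mk p.1 p.2

lemma isProbabilityMeasure_map_mk (hA : Measurable fun p : Y × Y => A p.1 p.2)
    (μ : Measure (Y × V)) [IsProbabilityMeasure μ] (j : ℕ) :
    IsProbabilityMeasure ((vecLaw q A μ j).map fun p => M.mk p.1 p.2) := by
  have := isProbabilityMeasure_vecLaw (q := q) hA μ j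
  exact Measure.isProbabilityMeasure_map M.measurable_mk.aemeasurable

omit [MeasurableSpace Y] [MeasurableSpace V] [MeasurableSpace Z] [NormedAddCommGroup V]
  [NormedSpace ℝ V] in
lemma _root_.ENNReal.ofReal_inv_mul_natCast {n : ℕ} (hn : 1 ≤ n) :
    ENNReal.ofReal (n : ℝ)⁻¹ * n = 1 := by
  have hn0 : (0 : ℝ) < n := by exact_mod_cast hn
  rw [← ENNReal.ofReal_natCast n, ← ENNReal.ofReal_mul (by positivity), inv_mul_cancel₀ hn0.ne',
    ENNReal.ofReal_one]

lemma isProbabilityMeasure_average (hA : Measurable fun p : Y × Y => A p.1 p.2)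
    (μ : Measure (Y × V)) [IsProbabilityMeasure μ] {n : ℕ} (hn : 1 ≤ n) :
    IsProbabilityMeasure (M.average q A μ n) := by
  have := fun j => M.isProbabilityMeasure_map_mk (q := q) hA μ j
  refine ⟨?_⟩
  rw [average, Measure.smul_apply, Measure.finsetSum_apply]
  simp [ENNReal.ofReal_inv_mul_natCast hn]

omit [IsProbabilityMeasure ν] in
lemma average_map_base (hA : Measurable fun p : Y × Y => A p.1 p.2) (hν : q ∘ₘ ν = ν)
    (μ : Measure (Y × V)) [IsProbabilityMeasure μ] (hμ : μ.fst = ν) {n : ℕ} (hn : 1 ≤ n) :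
    (M.average q A μ n).map M.base = ν := by
  have hj : ∀ j, ((vecLaw q A μ j).map fun p => M.mk p.1 p.2).map M.base = ν := fun j => by
    rw [Measure.map_map M.measurable_base M.measurable_mk, ← vecLaw_fst hA hν μ hμ j, Measure.fst]
    congr 1
    funext p
    exact M.base_mk _ _
  ext s hs
  have hj' : ∀ j, (vecLaw q A μ j).map (fun p => M.mk p.1 p.2) (M.base ⁻¹' s) = ν s := fun j => by
    rw [← Measure.map_apply M.measurable_base hs, hj]
  rw [Measure.map_apply M.measurable_base hs, average, Measure.smul_apply,
    Measure.finsetSum_apply, Finset.sum_congr rfl fun j _ => hj' j]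
  rw [Finset.sum_const, Finset.card_range, nsmul_eq_mul, smul_eq_mul, ← mul_assoc,
    ENNReal.ofReal_inv_mul_natCast hn, one_mul]

lemma integral_average (hA : Measurable fun p : Y × Y => A p.1 p.2)
    (μ : Measure (Y × V)) [IsProbabilityMeasure μ] (n : ℕ) {ψ : Z → ℝ} (hψ : Measurable ψ)
    {C : ℝ} (hC : ∀ z, |ψ z| ≤ C) :
    ∫ z, ψ z ∂(M.average q A μ n)
      = (n : ℝ)⁻¹ * ∑ j ∈ Finset.range n, ∫ z, ψ z ∂((vecLaw q A μ j).map fun p => M.mk p.1 p.2) := by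
  have := fun j => M.isProbabilityMeasure_map_mk (q := q) hA μ j
  rw [average, integral_smul_measure, integral_finsetSum_measure, smul_eq_mul,
    ENNReal.toReal_ofReal (by positivity)]
  intro j _
  exact Integrable.of_bound hψ.aestronglyMeasurable C (ae_of_all _ hC)

/-- Time averages are almost invariant. -/
lemma abs_integral_kernel_average_sub_le (hA : Measurable fun p : Y × Y => A p.1 p.2)
    (μ : Measure (Y × V)) [IsProbabilityMeasure μ] (n : ℕ) {ψ : Z → ℝ} (hψ : Measurable ψ)
    {C : ℝ} (hC : ∀ z, |ψ z| ≤ C) :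
    |∫ z, (∫ z', ψ z' ∂(M.kernel q A z)) ∂(M.average q A μ n) - ∫ z, ψ z ∂(M.average q A μ n)|
      ≤ (n : ℝ)⁻¹ * (2 * C) := by
  have := fun j => M.isProbabilityMeasure_map_mk (q := q) hA μ j
  have := M.isMarkovKernel_kernel (q := q) hA
  have hint : ∀ j, Integrable ψ ((vecLaw q A μ j).map fun p => M.mk p.1 p.2) := fun j =>
    Integrable.of_bound hψ.aestronglyMeasurable C (ae_of_all _ hC)
  have hm : Measurable fun z => ∫ z', ψ z' ∂(M.kernel q A z) :=
    (hψ.stronglyMeasurable.integral_kernel).measurable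
  have hb : ∀ z, |∫ z', ψ z' ∂(M.kernel q A z)| ≤ C := fun z => by
    have := norm_integral_le_of_norm_le_const (μ := M.kernel q A z) (ae_of_all _ fun z => (Real.norm_eq_abs _).trans_le (hC z))
    simpa using this
  have hstep : ∀ j, ∫ z, (∫ z', ψ z' ∂(M.kernel q A z)) ∂((vecLaw q A μ j).map fun p => M.mk p.1 p.2)
      = ∫ z, ψ z ∂((vecLaw q A μ (j + 1)).map fun p => M.mk p.1 p.2) := by
    intro j
    have := isProbabilityMeasure_vecLaw (q := q) hA μ j
    have h1 := M.kernel_comp_map_mk hA (q := q) (vecLaw q A μ j)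
    rw [vecLaw, ← h1, integral_bind_of_bounded _ _ hψ hC]
  -- Applying the kernel moves the time index by one, so the difference telescopes to two boundary
  -- terms, each of absolute value at most C.
  rw [M.integral_average hA μ n hm hb, M.integral_average hA μ n hψ hC, ← mul_sub,
    ← Finset.sum_sub_distrib, Finset.sum_congr rfl fun j _ => by rw [hstep j],
    Finset.sum_range_sub (fun j => ∫ z, ψ z ∂((vecLaw q A μ j).map fun p => M.mk p.1 p.2)), abs_mul,
    abs_of_nonneg (by positivity)]
  refine mul_le_mul_of_nonneg_left ?_ (by positivity)
  have hj : ∀ j, |∫ z, ψ z ∂((vecLaw q A μ j).map fun p => M.mk p.1 p.2)| ≤ C := fun j => by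
    have := norm_integral_le_of_norm_le_const
      (μ := (vecLaw q A μ j).map fun p => M.mk p.1 p.2) (ae_of_all _ fun z => (Real.norm_eq_abs _).trans_le (hC z))
    simpa using this
  refine (abs_sub _ _).trans ?_
  have := hj n
  have := hj 0
  linarith

omit [IsProbabilityMeasure ν] in
lemma lintegral_pos_average (hA : Measurable fun p : Y × Y => A p.1 p.2)
    (hint : ∫⁻ p, ENNReal.ofReal (Real.posLog ‖A p.1 p.2‖) ∂(ν ⊗ₘ q) ≠ ⊤) (hν : q ∘ₘ ν = ν)
    (μ : Measure (Y × V)) [IsProbabilityMeasure μ] (hμ : μ.fst = ν) (j : ℕ) :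
    ∫⁻ z, (M.potential q A z).toENNReal ∂((vecLaw q A μ j).map fun p => M.mk p.1 p.2) ≠ ⊤ := by
  have := M.isProbabilityMeasure_map_mk (q := q) hA μ j
  refine M.lintegral_pos_potential hA hint ?_
  rw [Measure.map_map M.measurable_base M.measurable_mk, ← vecLaw_fst hA hν μ hμ j, Measure.fst]
  congr 1
  funext p
  exact M.base_mk _ _

omit [IsProbabilityMeasure ν] in
lemma extIntegral_average (hA : Measurable fun p : Y × Y => A p.1 p.2)
    (hint : ∫⁻ p, ENNReal.ofReal (Real.posLog ‖A p.1 p.2‖) ∂(ν ⊗ₘ q) ≠ ⊤) (hν : q ∘ₘ ν = ν)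
    (μ : Measure (Y × V)) [IsProbabilityMeasure μ] (hμ : μ.fst = ν) {n : ℕ} (hn : 1 ≤ n) :
    extIntegral (M.average q A μ n) (M.potential q A)
      = (((n : ℝ)⁻¹ : ℝ) : EReal)
        * ∑ j ∈ Finset.range n, extIntegral (vecLaw q A μ j) (vecPotential q A) := by
  have hj : ∀ j, extIntegral ((vecLaw q A μ j).map fun p => M.mk p.1 p.2) (M.potential q A)
      = extIntegral (vecLaw q A μ j) (vecPotential q A) := fun j => by
    rw [extIntegral_map M.measurable_mk (M.measurable_potential hA)]
    simp only [M.potential_mk]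
  have hfin := M.lintegral_pos_average hA hint hν μ hμ
  have hsum : ∀ m : ℕ, ∫⁻ z, (M.potential q A z).toENNReal
      ∂(∑ j ∈ Finset.range m, (vecLaw q A μ j).map fun p => M.mk p.1 p.2) ≠ ⊤ := fun m => by
    rw [lintegral_finsetSum_measure]
    exact ENNReal.sum_ne_top.2 fun j _ => hfin j
  have hext : ∀ m : ℕ, extIntegral
      (∑ j ∈ Finset.range m, (vecLaw q A μ j).map fun p => M.mk p.1 p.2) (M.potential q A)
      = ∑ j ∈ Finset.range m, extIntegral (vecLaw q A μ j) (vecPotential q A) := fun m => by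
    induction m with
    | zero => simp [extIntegral]
    | succ m ih =>
      rw [Finset.sum_range_succ, Finset.sum_range_succ,
        extIntegral_add_measure (hsum m) (hfin m), ih, hj]
  rw [average, extIntegral_smul_measure (by positivity) (hsum n), hext]

end ProjModel

/-! ### Time averages started from Gaussian vectors. -/

section Gaussian

variable {Y V Z : Type*} [MeasurableSpace Y] [NormedAddCommGroup V] [InnerProductSpace ℝ V]
  [FiniteDimensional ℝ V] [MeasurableSpace V] [BorelSpace V] [Nontrivial V] [MeasurableSpace Z]
  (M : ProjModel Y V Z) {q : Kernel Y Y} [IsMarkovKernel q] {A : Y → Y → V →L[ℝ] V}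
  {ν : Measure Y} [IsProbabilityMeasure ν]

/-- Time averages along Gaussian vectors almost realise the growth rate. -/
theorem ProjModel.exists_pathRate_le_average (hA : Measurable fun p : Y × Y => A p.1 p.2)
    (hint : ∫⁻ p, ENNReal.ofReal (Real.posLog ‖A p.1 p.2‖) ∂(ν ⊗ₘ q) ≠ ⊤) (hν : q ∘ₘ ν = ν) :
    ∃ C : ℝ, ∀ n : ℕ, 1 ≤ n → pathRate q ν A + ((-((n : ℝ)⁻¹ * C) : ℝ) : EReal)
      ≤ extIntegral (M.average q A (ν ⊗ₘ Kernel.const Y (stdGaussian V)) n) (M.potential q A) := by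
  set μ := ν ⊗ₘ Kernel.const Y (stdGaussian V) with hμ
  have hfst : μ.fst = ν := Measure.fst_compProd _ _
  set C₁ := (∫⁻ p, ENNReal.ofReal (Real.posLog ‖p.2‖) ∂μ).toReal with hC₁
  have hG := lintegral_posLog_gaussian_compProd (ν := ν) (V := V)
  have hu0 : extIntegral μ (fun p => elog ‖p.2‖) ≤ (C₁ : EReal) := by
    refine (extIntegral_le_lintegral _).trans (le_of_eq ?_)
    simp only [toENNReal_elog _ (norm_nonneg _)]
    rw [hC₁]
    exact (EReal.coe_ennreal_toReal hG).symm
  -- The first summand is the loss from using a Gaussian vector instead of an optimal one, the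
  -- second bounds the initial logarithmic norm. Both are paid once and then divided by n.
  refine ⟨gaussianLogDefect + C₁, fun n hn => ?_⟩
  have hn0 : (0 : ℝ) < n := by exact_mod_cast hn
  have hn0' : (0 : ℝ) < (n : ℝ)⁻¹ := inv_pos.2 hn0
  rw [M.extIntegral_average hA hint hν μ hfst hn]
  set S := ∑ j ∈ Finset.range n, extIntegral (vecLaw q A μ j) (vecPotential q A) with hS
  have h1 := pathGrowth_le_extIntegral_gaussian hA hint hν n
  rw [extIntegral_elog_vecLaw hA hint hν _ hfst hG n] at h1
  have h2 : pathGrowth q ν A n + ((-gaussianLogDefect : ℝ) : EReal) ≤ C₁ + S :=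
    h1.trans (add_le_add hu0 le_rfl)
  have h3 : pathGrowth q ν A n + ((-(gaussianLogDefect + C₁) : ℝ) : EReal) ≤ S := by
    have h4 := add_le_add h2 (le_refl ((-C₁ : ℝ) : EReal))
    rw [add_assoc, ← EReal.coe_add, add_comm (C₁ : EReal) S, add_assoc, ← EReal.coe_add,
      add_neg_cancel, EReal.coe_zero, add_zero, ← neg_add] at h4
    exact h4
  have h5 := mul_le_mul_of_nonneg_left h3 (a := (((n : ℝ)⁻¹ : ℝ) : EReal))
    (by exact_mod_cast hn0'.le)
  refine le_trans ?_ h5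
  rw [EReal.left_distrib_of_nonneg_of_ne_top (by exact_mod_cast hn0'.le) (EReal.coe_ne_top _),
    ← EReal.coe_mul, mul_neg]
  -- The rate is an infimum, so it bounds the normalized growth at every single time n from below.
  exact add_le_add (iInf_le (fun n : {n : ℕ // 1 ≤ n} =>
    (((n : ℝ)⁻¹ : ℝ) : EReal) * pathGrowth q ν A n) ⟨n, hn⟩) le_rfl

end Gaussian

/-! ### Compactness of measures with a prescribed marginal on a standard Borel space -/

section Young

/-- The uniform distance to a fixed function is a supremum over a countable dense set of points,
hence measurable; membership in a closed set is then expressed by distances to a countable dense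
subset of it, since C(S, ℝ) is separable. -/
lemma stronglyMeasurable_continuousMap {α S : Type*} [MeasurableSpace α] [MetricSpace S]
    [CompactSpace S] (G : α → C(S, ℝ)) (hG : ∀ s, Measurable fun a => G a s) :
    StronglyMeasurable G := by
  rcases isEmpty_or_nonempty S with hS | hS
  · have : G = fun _ => 0 := funext fun a => ContinuousMap.ext fun s => hS.elim s
    rw [this]; exact stronglyMeasurable_const
  have hdist : ∀ g : C(S, ℝ), Measurable fun a => dist (G a) g := fun g => by
    refine measurable_of_Iic fun r => ?_
    rcases lt_or_ge r 0 with hr | hr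
    · convert! MeasurableSet.empty
      ext a
      simpa using hr.trans_le dist_nonneg
    · have : (fun a => dist (G a) g) ⁻¹' Set.Iic r
          = ⋂ n : ℕ, {a | dist (G a (TopologicalSpace.denseSeq S n))
            (g (TopologicalSpace.denseSeq S n)) ≤ r} := by
        ext a
        simp only [Set.mem_preimage, Set.mem_Iic, Set.mem_iInter, Set.mem_ofPred_eq]
        refine ⟨fun h n => (ContinuousMap.dist_apply_le_dist _).trans h, fun h => ?_⟩
        refine (ContinuousMap.dist_le hr).2 fun s => ?_
        have hc : IsClosed {s | dist (G a s) (g s) ≤ r} :=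
          isClosed_le ((G a).continuous.dist g.continuous) continuous_const
        have := (TopologicalSpace.denseRange_denseSeq S).closure_eq ▸
          hc.closure_subset_iff.2 (Set.range_subset_iff.2 h)
        exact this (Set.mem_univ s)
      rw [this]
      exact MeasurableSet.iInter fun n => measurableSet_le ((hG _).dist measurable_const)
        measurable_const
  let _ : MeasurableSpace C(S, ℝ) := borel _
  have : BorelSpace C(S, ℝ) := ⟨rfl⟩
  refine Measurable.stronglyMeasurable (measurable_of_isClosed' fun F hF hne _ => ?_)
  have : Nonempty F := hne.to_subtype
  have : G ⁻¹' F = ⋂ n : ℕ, ⋃ m : ℕ, {a | dist (G a) (TopologicalSpace.denseSeq F m : C(S, ℝ))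
      < 1 / ((n : ℝ) + 1)} := by
    ext a
    simp only [Set.mem_preimage, Set.mem_iInter, Set.mem_iUnion, Set.mem_ofPred_eq]
    constructor
    · intro h n
      obtain ⟨_, ⟨m, rfl⟩, hm⟩ := Metric.dense_iff.1 (TopologicalSpace.denseRange_denseSeq F)
        ⟨G a, h⟩ _ (Nat.one_div_pos_of_nat (α := ℝ) (n := n)) |>.imp fun x hx => hx.symm
      exact ⟨m, by rw [dist_comm]; exact hm⟩
    · intro h
      rw [← hF.closure_eq, Metric.mem_closure_iff]
      intro ε hε
      obtain ⟨n, hn⟩ := exists_nat_one_div_lt hε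
      obtain ⟨m, hm⟩ := h n
      exact ⟨_, (TopologicalSpace.denseSeq F m).2, hm.trans hn⟩
  rw [this]
  exact MeasurableSet.iInter fun n => MeasurableSet.iUnion fun m =>
    measurableSet_lt (hdist _) measurable_const

/-- The bound sees only the marginal, so one approximation of the integrand serves a whole family of
measures with this marginal. -/
lemma abs_integral_sub_le_of_fst {K S : Type*} [MeasurableSpace K]
    [MetricSpace S] [CompactSpace S] [MeasurableSpace S] [BorelSpace S]
    {G h : K → C(S, ℝ)} {ν : Measure K} {μ : Measure (K × S)} [IsFiniteMeasure μ]
    (hμ : μ.fst = ν) (hG : StronglyMeasurable G) (hh : StronglyMeasurable h)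
    (hGi : Integrable G ν) (hhi : Integrable h ν) :
    |∫ p, G p.1 p.2 ∂μ - ∫ p, h p.1 p.2 ∂μ| ≤ ∫ k, ‖G k - h k‖ ∂ν := by
  have hev : ∀ {G : K → C(S, ℝ)}, StronglyMeasurable G →
      StronglyMeasurable fun p : K × S => G p.1 p.2 := fun {G} hG => by
    have hc : Continuous fun p : C(S, ℝ) × S => p.1 p.2 := continuous_eval
    exact hc.comp_stronglyMeasurable ((hG.comp_measurable measurable_fst).prodMk
      measurable_snd.stronglyMeasurable)
  have hi : ∀ {G : K → C(S, ℝ)}, StronglyMeasurable G → Integrable G ν →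
      Integrable (fun p : K × S => G p.1 p.2) μ := fun {G} hG hGi => by
    rw [← hμ] at hGi
    refine Integrable.mono' (hGi.norm.comp_measurable measurable_fst) (hev hG).aestronglyMeasurable
      (ae_of_all _ fun p => ?_)
    exact (G p.1).norm_coe_le_norm p.2
  rw [← integral_sub (hi hG hGi) (hi hh hhi)]
  refine (norm_integral_le_integral_norm (fun p : K × S => G p.1 p.2 - h p.1 p.2)).trans ?_
  have hd : Integrable (fun k => ‖G k - h k‖) ν := (hGi.sub hhi).norm
  rw [← hμ] at hd ⊢
  rw [Measure.fst, integral_map measurable_fst.aemeasurable hd.aestronglyMeasurable]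
  refine integral_mono ((hi hG hGi).sub (hi hh hhi)).norm (hd.comp_measurable measurable_fst)
    fun p => ?_
  exact (G p.1 - h p.1).norm_coe_le_norm p.2

/-- A family of probability measures on `Y × S` with the same marginal on `Y` converges along every
ultrafilter, when tested against Carathéodory functions with an integrable bound. -/
theorem exists_limit_of_fst_eq {Y S ι : Type*} [MeasurableSpace Y] [StandardBorelSpace Y]
    [MetricSpace S] [CompactSpace S] [MeasurableSpace S] [BorelSpace S] (U : Ultrafilter ι)
    {ν : Measure Y} (μ : ι → Measure (Y × S)) (hμ : ∀ i, IsProbabilityMeasure (μ i))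
    (hfst : ∀ i, (μ i).fst = ν) :
    ∃ ρ : Measure (Y × S), IsProbabilityMeasure ρ ∧ ρ.fst = ν ∧
      ∀ (g : Y → S → ℝ) (H : Y → ℝ), (Measurable fun p : Y × S => g p.1 p.2) →
        (∀ y, Continuous (g y)) → Integrable H ν → (∀ y s, |g y s| ≤ H y) →
        Tendsto (fun i => ∫ p, g p.1 p.2 ∂(μ i)) U (𝓝 (∫ p, g p.1 p.2 ∂ρ)) := by
  have hι : Nonempty ι := nonempty_of_neBot (U : Filter ι)
  obtain ⟨i₀⟩ := hι
  have hν : IsProbabilityMeasure ν := by rw [← hfst i₀]; infer_instance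
  have hYS : Nonempty (Y × S) := nonempty_of_isProbabilityMeasure (μ i₀)
  have hYne : Nonempty Y := hYS.map Prod.fst
  -- The base is embedded measurably in the Cantor space, which makes the product with S a compact
  -- metric space; r is a measurable left inverse used to return to Y. No topology on Y is involved.
  obtain ⟨e, he⟩ : ∃ e : Y → (ℕ → Bool), MeasurableEmbedding e :=
    ⟨_, (MeasurableSpace.measurable_mapNatBool Y).measurableEmbedding
      (MeasurableSpace.injective_mapNatBool Y)⟩
  obtain ⟨r, hr, hre⟩ := he.exists_measurable_extend measurable_id fun _ => hYne
  have hre' : ∀ y, r (e y) = y := fun y => congr_fun hre y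
  set ν' := ν.map e with hν'
  have hpe : Measurable (Prod.map e (id : S → S)) := he.measurable.prodMap measurable_id
  have hpr : Measurable (Prod.map r (id : S → S)) := hr.prodMap measurable_id
  have hpi : ∀ i, IsProbabilityMeasure ((μ i).map (Prod.map e (id : S → S))) := fun i =>
    Measure.isProbabilityMeasure_map hpe.aemeasurable
  let μ' : ι → ProbabilityMeasure ((ℕ → Bool) × S) := fun i => ⟨_, hpi i⟩
  have hμ'fst : ∀ i, (μ' i : Measure ((ℕ → Bool) × S)).fst = ν' := fun i => by
    change ((μ i).map (Prod.map e id)).fst = ν'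
    rw [hν', ← hfst i, Measure.fst, Measure.fst, Measure.map_map measurable_fst hpe,
      Measure.map_map he.measurable measurable_fst]
    rfl
  obtain ⟨ρ', hρ'⟩ : ∃ ρ' : ProbabilityMeasure ((ℕ → Bool) × S), Tendsto μ' U (𝓝 ρ') := by
    obtain ⟨ρ', -, h⟩ := isCompact_univ.ultrafilter_le_nhds (U.map μ') (by simp)
    exact ⟨ρ', h⟩
  have hlim := ProbabilityMeasure.tendsto_iff_forall_integral_tendsto.1 hρ'
  have hρfst : (ρ' : Measure ((ℕ → Bool) × S)).fst = ν' := by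
    have : IsProbabilityMeasure ν' := Measure.isProbabilityMeasure_map he.measurable.aemeasurable
    -- Functions of the first coordinate have constant integrals along the family, so the weak limit
    -- keeps the marginal.
    refine ext_of_forall_integral_eq_of_IsFiniteMeasure fun f => ?_
    have h1 := hlim (f.compContinuous ⟨Prod.fst, continuous_fst⟩)
    have h2 : ∀ m : Measure ((ℕ → Bool) × S), ∫ p, f p.1 ∂m = ∫ k, f k ∂m.fst := fun m => by
      rw [Measure.fst, integral_map measurable_fst.aemeasurable
        f.continuous.measurable.aestronglyMeasurable]
    simp only [BoundedContinuousFunction.compContinuous_apply, ContinuousMap.coe_mk, h2,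
      hμ'fst] at h1
    exact tendsto_nhds_unique tendsto_const_nhds h1 |>.symm
  refine ⟨(ρ' : Measure ((ℕ → Bool) × S)).map (Prod.map r id),
    Measure.isProbabilityMeasure_map hpr.aemeasurable, ?_, ?_⟩
  · have : ((ρ' : Measure ((ℕ → Bool) × S)).map (Prod.map r id)).fst = ν'.map r := by
      rw [← hρfst, Measure.fst, Measure.fst, Measure.map_map measurable_fst hpr,
        Measure.map_map hr measurable_fst]
      rfl
    rw [this, hν', Measure.map_map hr he.measurable, hre, Measure.map_id]
  intro g H hg hgc hH hgH
  let G : (ℕ → Bool) → C(S, ℝ) := fun k => ⟨g (r k), hgc _⟩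
  have hGm : StronglyMeasurable G := stronglyMeasurable_continuousMap G fun s =>
    hg.fun_comp (f := fun k => (r k, s)) (by fun_prop)
  have hGi : Integrable G ν' := by
    refine Integrable.mono' (g := fun k => |H (r k)|) ?_ hGm.aestronglyMeasurable
      (ae_of_all _ fun k => ?_)
    · rw [hν', he.integrable_map_iff]
      have : (fun k => |H (r k)|) ∘ e = fun y => |H y| := by funext y; simp [hre']
      rw [this]
      exact hH.abs
    · exact (ContinuousMap.norm_le _ (abs_nonneg _)).2 fun s => (hgH _ s).trans (le_abs_self _)
  have hI : ∀ i, ∫ p, g p.1 p.2 ∂(μ i) = ∫ p, G p.1 p.2 ∂(μ' i : Measure ((ℕ → Bool) × S)) :=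
    fun i => by
    change _ = ∫ p, g (r p.1) p.2 ∂((μ i).map (Prod.map e id))
    rw [integral_map hpe.aemeasurable (hg.fun_comp (f := fun p : (ℕ → Bool) × S => (r p.1, p.2))
      (by fun_prop)).aestronglyMeasurable]
    simp [hre']
  have hI' : ∫ p, g p.1 p.2 ∂((ρ' : Measure ((ℕ → Bool) × S)).map (Prod.map r id))
      = ∫ p, G p.1 p.2 ∂(ρ' : Measure ((ℕ → Bool) × S)) := by
    rw [integral_map hpr.aemeasurable hg.aestronglyMeasurable]
    rfl
  simp only [hI, hI']
  rw [Metric.tendsto_nhds]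
  intro ε hε
  -- A Carathéodory function is a Bochner integrable map into C(S, ℝ). An L¹ approximation by a
  -- continuous map h costs at most ε/4 on each side of the limit, uniformly in the family, and weak
  -- convergence applies to h for another ε/4.
  obtain ⟨h, hh, hhi⟩ := hGi.exists_boundedContinuous_integral_sub_le (ε := ε / 4) (by positivity)
  have hb : ∀ m : Measure ((ℕ → Bool) × S), IsFiniteMeasure m → m.fst = ν' →
      |∫ p, G p.1 p.2 ∂m - ∫ p, h p.1 p.2 ∂m| ≤ ε / 4 := fun m _ hm =>
    (abs_integral_sub_le_of_fst hm hGm h.continuous.stronglyMeasurable hGi hhi).trans hh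
  have hc : Continuous fun p : (ℕ → Bool) × S => h p.1 p.2 :=
    (continuous_eval (X := S) (Y := ℝ)).comp
      ((h.continuous.comp continuous_fst).prodMk continuous_snd)
  let hf : BoundedContinuousFunction ((ℕ → Bool) × S) ℝ :=
    BoundedContinuousFunction.mkOfCompact ⟨_, hc⟩
  have h3 := Metric.tendsto_nhds.1 (hlim hf) (ε / 4) (by positivity)
  refine h3.mono fun i hi => ?_
  have e1 := hb _ inferInstance (hμ'fst i)
  have e2 := hb _ inferInstance hρfst
  rw [Real.dist_eq] at hi ⊢
  change |∫ p, h p.1 p.2 ∂(μ' i : Measure ((ℕ → Bool) × S))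
    - ∫ p, h p.1 p.2 ∂(ρ' : Measure ((ℕ → Bool) × S))| < ε / 4 at hi
  rw [abs_le] at e1 e2
  rw [abs_lt] at hi ⊢
  constructor <;> linarith

end Young

/-! ### Carathéodory functions on the projective bundle -/

namespace ProjModel

variable {Y V Z : Type*} [MeasurableSpace Y] [NormedAddCommGroup V] [NormedSpace ℝ V]
  [MeasurableSpace V] [MeasurableSpace Z] (M : ProjModel Y V Z)

/-- Measurable functions that are continuous along the fibres (away from the cemetery), with an
integrable bound. -/
structure IsCaratheodory (ν : Measure Y) (ψ : Z → ℝ) : Prop where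
  measurable : Measurable ψ
  continuous : ∀ y, Continuous fun s : Metric.sphere (0 : V) 1 => ψ (M.mk y s)
  bound : ∃ H : Y → ℝ, Integrable H ν ∧ ∀ y (s : Metric.sphere (0 : V) 1), |ψ (M.mk y s)| ≤ H y

/-- Convergence of measures tested against Carathéodory functions. -/
def TendstoLift {ι : Type*} (ν : Measure Y) (μ : ι → Measure Z) (U : Filter ι) (μ' : Measure Z) :
    Prop :=
  ∀ ψ, M.IsCaratheodory ν ψ → Tendsto (fun i => ∫ z, ψ z ∂(μ i)) U (𝓝 (∫ z, ψ z ∂μ'))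

open Classical in
/-- A unit vector in each line. -/
def sec (c₀ : Metric.sphere (0 : V) 1) (z : Z) : Metric.sphere (0 : V) 1 :=
  if h : M.vec z = 0 then c₀ else ⟨M.vec z, by simp [M.norm_vec z h]⟩

variable (c₀ : Metric.sphere (0 : V) 1)

lemma coe_sec {z : Z} (hz : z ∉ M.dead) : (M.sec c₀ z : V) = M.vec z := by
  have : M.vec z ≠ 0 := hz
  simp [sec, this]

lemma mk_sec {z : Z} (hz : z ∉ M.dead) : M.mk (M.base z) (M.sec c₀ z) = z := by
  rw [M.coe_sec c₀ hz, M.mk_base_vec]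

lemma mk_notMem_dead (y : Y) (s : Metric.sphere (0 : V) 1) : M.mk y s ∉ M.dead := by
  have : (s : V) ≠ 0 := ne_zero_of_mem_unit_sphere s
  exact fun h => this ((M.vec_mk_eq_zero_iff y s).1 h)

lemma mk_neg (y : Y) (c : V) : M.mk y (-c) = M.mk y c := by
  rw [← neg_one_smul ℝ c, M.mk_smul y c _ (by norm_num)]

/-- A real line contains exactly two unit vectors. Even functions therefore do not notice that the
selection `sec` is not continuous. -/
lemma sec_mk (y : Y) (s : Metric.sphere (0 : V) 1) :
    M.sec c₀ (M.mk y s) = s ∨ M.sec c₀ (M.mk y s) = -s := by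
  obtain ⟨a, ha, h⟩ := M.vec_mk y (s : V)
  have hs : ‖(s : V)‖ = 1 := norm_eq_of_mem_sphere s
  have h1 : ‖M.vec (M.mk y s)‖ = 1 := M.norm_vec _ (M.mk_notMem_dead y s)
  rw [h, norm_smul, hs, mul_one, Real.norm_eq_abs] at h1
  rcases eq_or_eq_neg_of_abs_eq h1 with rfl | rfl
  · left; apply Subtype.ext; rw [M.coe_sec c₀ (M.mk_notMem_dead y s), h, one_smul]
  · right; apply Subtype.ext; rw [M.coe_sec c₀ (M.mk_notMem_dead y s), h, neg_one_smul, coe_neg_sphere]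

variable [BorelSpace V]

lemma measurable_sec : Measurable (M.sec c₀) := by
  classical
  refine (MeasurableEmbedding.subtype_coe
    Metric.isClosed_sphere.measurableSet).measurable_comp_iff.1 ?_
  have : ((↑) : Metric.sphere (0 : V) 1 → V) ∘ M.sec c₀
      = fun z => if z ∈ M.dead then (c₀ : V) else M.vec z := by
    funext z
    by_cases hz : M.vec z = 0 <;> simp [sec, dead, hz]
  rw [this]
  exact Measurable.ite M.measurableSet_dead measurable_const M.measurable_vec

omit [BorelSpace V] in
lemma ae_notMem_dead {μ : Measure Z} (hd : μ M.dead = 0) : ∀ᵐ z ∂μ, z ∉ M.dead := by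
  rw [ae_iff]; simpa using hd

omit [BorelSpace V] in
lemma map_mk_sec {μ : Measure Z} (hd : μ M.dead = 0) :
    μ.map (fun z => M.mk (M.base z) (M.sec c₀ z)) = μ := by
  conv_rhs => rw [← Measure.map_id (μ := μ)]
  exact Measure.map_congr ((M.ae_notMem_dead hd).mono fun z hz => M.mk_sec c₀ hz)

omit [BorelSpace V] in
lemma measurable_mk_sphere :
    Measurable fun p : Y × Metric.sphere (0 : V) 1 => M.mk p.1 p.2 :=
  M.measurable_mk.fun_comp (f := fun p : Y × Metric.sphere (0 : V) 1 => (p.1, (p.2 : V)))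
    (measurable_fst.prodMk (measurable_subtype_coe.comp measurable_snd))

variable [FiniteDimensional ℝ V]

instance : CompactSpace (Metric.sphere (0 : V) 1) :=
  have := FiniteDimensional.proper ℝ V
  isCompact_iff_compactSpace.1 (isCompact_sphere 0 1)

/-- The selection of unit vectors moves the measures to Y times the compact sphere, where a limit
exists, and `mk` brings it back. The selection is only measurable, but the test functions enter
through `mk`, whose composition with them is continuous on the sphere. -/
theorem exists_tendstoLift [StandardBorelSpace Y] [Nontrivial V] {ι : Type*} (U : Ultrafilter ι)
    {ν : Measure Y} (μ : ι → Measure Z) (hμ : ∀ i, IsProbabilityMeasure (μ i))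
    (hbase : ∀ i, (μ i).map M.base = ν) (hdead : ∀ i, μ i M.dead = 0) :
    ∃ μ' : Measure Z, IsProbabilityMeasure μ' ∧ μ'.map M.base = ν ∧ μ' M.dead = 0 ∧
      M.TendstoLift ν μ U μ' := by
  obtain ⟨c₀⟩ : Nonempty (Metric.sphere (0 : V) 1) :=
    (NormedSpace.sphere_nonempty (E := V) (x := 0) (r := 1)).2 zero_le_one |>.to_subtype
  have hbs : Measurable fun z => (M.base z, M.sec c₀ z) :=
    M.measurable_base.prodMk (M.measurable_sec c₀)
  obtain ⟨ρ, hρ, hρν, hlim⟩ := exists_limit_of_fst_eq U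
    (fun i => (μ i).map fun z => (M.base z, M.sec c₀ z))
    (fun i => Measure.isProbabilityMeasure_map hbs.aemeasurable) (ν := ν) fun i => by
      rw [← hbase i, Measure.fst, Measure.map_map measurable_fst hbs]; rfl
  refine ⟨ρ.map fun p => M.mk p.1 p.2,
    Measure.isProbabilityMeasure_map M.measurable_mk_sphere.aemeasurable, ?_, ?_, ?_⟩
  · rw [Measure.map_map M.measurable_base M.measurable_mk_sphere, ← hρν, Measure.fst]
    congr 1
    funext p
    exact M.base_mk _ _
  · rw [Measure.map_apply M.measurable_mk_sphere M.measurableSet_dead]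
    convert! measure_empty (μ := ρ)
    ext p
    simpa using M.mk_notMem_dead p.1 p.2
  · intro ψ hψ
    obtain ⟨H, hH, hb⟩ := hψ.bound
    have h := hlim (fun y s => ψ (M.mk y s)) H (hψ.measurable.fun_comp M.measurable_mk_sphere)
      hψ.continuous hH hb
    rw [integral_map M.measurable_mk_sphere.aemeasurable hψ.measurable.aestronglyMeasurable]
    refine h.congr fun i => ?_
    rw [integral_map hbs.aemeasurable
      (hψ.measurable.fun_comp M.measurable_mk_sphere).aestronglyMeasurable]
    exact integral_congr_ae ((M.ae_notMem_dead (hdead i)).mono fun z hz => by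
      simp only [M.mk_sec c₀ hz])

lemma _root_.continuous_integral_continuousMap {S : Type*} [TopologicalSpace S] [CompactSpace S]
    [SecondCountableTopology S] [MeasurableSpace S] [BorelSpace S] (m : Measure S)
    [IsFiniteMeasure m] : Continuous fun h : C(S, ℝ) => ∫ s, h s ∂m := by
  refine continuous_iff_continuousAt.2 fun h₀ => ?_
  refine continuousAt_of_dominated (bound := fun _ => ‖h₀‖ + 1)
    (Eventually.of_forall fun h => h.continuous.measurable.aestronglyMeasurable) ?_
    (integrable_const _)
    (ae_of_all _ fun s => (continuous_eval_const s).continuousAt)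
  have : ∀ᶠ h : C(S, ℝ) in 𝓝 h₀, ‖h‖ < ‖h₀‖ + 1 :=
    continuous_norm.continuousAt.eventually (gt_mem_nhds (lt_add_one _))
  exact this.mono fun h hh => ae_of_all _ fun s => (h.norm_coe_le_norm s).trans hh.le

/-- There is a sequence of Carathéodory functions that separates the measures without mass on the
cemetery. -/
theorem exists_determining_sequence [StandardBorelSpace Y] [Nontrivial V] :
    ∃ G : ℕ → Z → ℝ, (∀ (ν : Measure Y) [IsFiniteMeasure ν] (j : ℕ), M.IsCaratheodory ν (G j)) ∧
      (∀ j z, |G j z| ≤ 1) ∧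
      ∀ μ₁ μ₂ : Measure Z, IsProbabilityMeasure μ₁ → IsProbabilityMeasure μ₂ →
        μ₁ M.dead = 0 → μ₂ M.dead = 0 → (∀ j, ∫ z, G j z ∂μ₁ = ∫ z, G j z ∂μ₂) → μ₁ = μ₂ := by
  rcases isEmpty_or_nonempty Y with hY | hY
  · have : IsEmpty Z := ⟨fun z => hY.elim (M.base z)⟩
    refine ⟨fun _ _ => 0, fun ν _ j => ⟨measurable_const, fun y => hY.elim y,
      ⟨fun _ => 0, by simp, fun y => hY.elim y⟩⟩, by simp, fun μ₁ μ₂ _ _ _ _ _ => ?_⟩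
    exact Subsingleton.elim _ _
  obtain ⟨c₀⟩ : Nonempty (Metric.sphere (0 : V) 1) :=
    (NormedSpace.sphere_nonempty (E := V) (x := 0) (r := 1)).2 zero_le_one |>.to_subtype
  obtain ⟨e, he⟩ : ∃ e : Y → (ℕ → Bool), MeasurableEmbedding e :=
    ⟨_, (MeasurableSpace.measurable_mapNatBool Y).measurableEmbedding
      (MeasurableSpace.injective_mapNatBool Y)⟩
  obtain ⟨r, hr, hre⟩ := he.exists_measurable_extend measurable_id fun _ => hY
  have hre' : ∀ y, r (e y) = y := fun y => congr_fun hre y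
  let S := Metric.sphere (0 : V) 1
  have hcn : Continuous fun s : S => -s :=
    Continuous.subtype_mk (continuous_neg.comp continuous_subtype_val) _
  let φ : Z → (ℕ → Bool) × S := fun z => (e (M.base z), M.sec c₀ z)
  let φ' : Z → (ℕ → Bool) × S := fun z => (e (M.base z), -M.sec c₀ z)
  have hφ : Measurable φ := (he.measurable.comp M.measurable_base).prodMk (M.measurable_sec c₀)
  have hφ' : Measurable φ' :=
    (he.measurable.comp M.measurable_base).prodMk (hcn.measurable.comp (M.measurable_sec c₀))
  let h : ℕ → C((ℕ → Bool) × S, ℝ) := TopologicalSpace.denseSeq _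
  -- Summing over both unit vectors of the line restores continuity along the sphere; the
  -- denominator makes the functions bounded by 1.
  let G : ℕ → Z → ℝ := fun j z => (h j (φ z) + h j (φ' z)) / (2 * (‖h j‖ + 1))
  have hpos : ∀ j, 0 < 2 * (‖h j‖ + 1) := fun j => by positivity
  have hG1 : ∀ j z, |G j z| ≤ 1 := fun j z => by
    have h1 := (h j).norm_coe_le_norm (φ z)
    have h2 := (h j).norm_coe_le_norm (φ' z)
    rw [Real.norm_eq_abs] at h1 h2
    rw [abs_div, abs_of_pos (hpos j), div_le_one (hpos j)]
    linarith [abs_add_le (h j (φ z)) (h j (φ' z))]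
  have hGm : ∀ j, Measurable (G j) := fun j =>
    (((h j).continuous.measurable.comp hφ).add ((h j).continuous.measurable.comp hφ')).div_const _
  refine ⟨G, fun ν _ j => ⟨hGm j, fun y => ?_, ⟨fun _ => 1, integrable_const _, fun y s => hG1 j _⟩⟩,
    hG1, fun μ₁ μ₂ hμ₁ hμ₂ hd₁ hd₂ heq => ?_⟩
  · have : (fun s : S => G j (M.mk y s))
        = fun s => (h j (e y, s) + h j (e y, -s)) / (2 * (‖h j‖ + 1)) := by
      funext s
      simp only [G, φ, φ', M.base_mk]
      rcases M.sec_mk c₀ y s with hs | hs <;> rw [hs]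
      rw [neg_neg, add_comm]
    rw [this]
    exact (((h j).continuous.comp (continuous_const.prodMk continuous_id)).add
      ((h j).continuous.comp (continuous_const.prodMk hcn))).div_const _
  -- The symmetrized lift of μ to the sphere bundle. Its integrals against continuous functions are
  -- what the sequence G records, and its image under `mk` is μ + μ, so μ can be recovered.
  · let m : Measure Z → Measure ((ℕ → Bool) × S) := fun μ => μ.map φ + μ.map φ'
    have hmi : ∀ (μ : Measure Z) [IsProbabilityMeasure μ] (g : C((ℕ → Bool) × S, ℝ)),
        ∫ p, g p ∂(m μ) = ∫ z, (g (φ z) + g (φ' z)) ∂μ := fun μ _ g => by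
      have hb : ∀ {χ : Z → (ℕ → Bool) × S}, Measurable χ → Integrable (fun z => g (χ z)) μ :=
        fun {χ} hχ => Integrable.of_bound (g.continuous.measurable.comp hχ).aestronglyMeasurable ‖g‖
          (ae_of_all _ fun z => g.norm_coe_le_norm _)
      have hb' : ∀ {χ : Z → (ℕ → Bool) × S}, Measurable χ → Integrable g (μ.map χ) := fun {χ} hχ =>
        (integrable_map_measure g.continuous.measurable.aestronglyMeasurable hχ.aemeasurable).2 (hb hχ)
      rw [integral_add_measure (hb' hφ) (hb' hφ'), integral_add (hb hφ) (hb hφ'),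
        integral_map hφ.aemeasurable g.continuous.measurable.aestronglyMeasurable,
        integral_map hφ'.aemeasurable g.continuous.measurable.aestronglyMeasurable]
    have hseq : ∀ j, ∫ p, h j p ∂(m μ₁) = ∫ p, h j p ∂(m μ₂) := fun j => by
      have := heq j
      simp only [G, integral_div] at this
      rw [hmi, hmi]
      exact (div_left_inj' (hpos j).ne').1 this
    have hall : ∀ g : C((ℕ → Bool) × S, ℝ), ∫ p, g p ∂(m μ₁) = ∫ p, g p ∂(m μ₂) := fun g => by
      have := (TopologicalSpace.denseRange_denseSeq C((ℕ → Bool) × S, ℝ)).equalizer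
        (continuous_integral_continuousMap (m μ₁)) (continuous_integral_continuousMap (m μ₂))
        (funext hseq)
      exact congr_fun this g
    have hmm : m μ₁ = m μ₂ :=
      ext_of_forall_integral_eq_of_IsFiniteMeasure fun f => hall f.toContinuousMap
    have hback : ∀ μ : Measure Z, μ M.dead = 0 →
        (m μ).map (fun p => M.mk (r p.1) p.2) = μ + μ := fun μ hd => by
      have hmk : Measurable fun p : (ℕ → Bool) × S => M.mk (r p.1) p.2 :=
        M.measurable_mk_sphere.fun_comp (f := fun p : (ℕ → Bool) × S => (r p.1, p.2)) (by fun_prop)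
      rw [Measure.map_add _ _ hmk, Measure.map_map hmk hφ, Measure.map_map hmk hφ']
      have e1 : (fun p : (ℕ → Bool) × S => M.mk (r p.1) p.2) ∘ φ
          = fun z => M.mk (M.base z) (M.sec c₀ z) := by funext z; simp [φ, hre']
      have e2 : (fun p : (ℕ → Bool) × S => M.mk (r p.1) p.2) ∘ φ'
          = fun z => M.mk (M.base z) (M.sec c₀ z) := by
        funext z; simp [φ', hre', M.mk_neg]
      rw [e1, e2, M.map_mk_sec c₀ hd]
    have h2 : μ₁ + μ₁ = μ₂ + μ₂ := by rw [← hback μ₁ hd₁, ← hback μ₂ hd₂, hmm]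
    ext s hs
    have h3 := congr_arg (fun μ : Measure Z => μ s) h2
    simp only [Measure.add_apply, ← two_mul] at h3
    exact (ENNReal.mul_right_inj two_ne_zero ENNReal.ofNat_ne_top).1 h3

end ProjModel

/-! ### Limits of almost invariant measures -/

namespace ProjModel

variable {Y V Z : Type*} [MeasurableSpace Y] [NormedAddCommGroup V] [NormedSpace ℝ V]
  [MeasurableSpace V] [MeasurableSpace Z] (M : ProjModel Y V Z) {q : Kernel Y Y}
  {A : Y → Y → V →L[ℝ] V} {ν : Measure Y}

/-- The joint law of a line and the next base point. -/
def edge (q : Kernel Y Y) (μ : Measure Z) : Measure (Z × Y) :=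
  μ ⊗ₘ q.comap M.base M.measurable_base

instance [IsMarkovKernel q] (μ : Measure Z) [IsProbabilityMeasure μ] :
    IsProbabilityMeasure (M.edge q μ) :=
  inferInstanceAs (IsProbabilityMeasure (μ ⊗ₘ q.comap M.base M.measurable_base))

lemma measurable_base_edge : Measurable fun r : Z × Y => (M.base r.1, r.2) :=
  (M.measurable_base.comp measurable_fst).prodMk measurable_snd

lemma edge_map_base [IsMarkovKernel q] {μ : Measure Z} [SFinite μ] (hμ : μ.map M.base = ν) :
    (M.edge q μ).map (fun r => (M.base r.1, r.2)) = ν ⊗ₘ q := by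
  refine Measure.ext_of_lintegral _ fun g hg => ?_
  rw [lintegral_map hg M.measurable_base_edge, edge, Measure.lintegral_compProd
    (hg.fun_comp M.measurable_base_edge), ← hμ, Measure.lintegral_compProd hg,
    lintegral_map hg.lintegral_kernel_prod_right' M.measurable_base]
  rfl

lemma edge_fst [IsMarkovKernel q] {μ : Measure Z} [SFinite μ] : (M.edge q μ).map Prod.fst = μ :=
  Measure.fst_compProd _ _

lemma ae_edge_norm_vec [IsMarkovKernel q] {μ : Measure Z} [SFinite μ] (hd : μ M.dead = 0) :
    ∀ᵐ r ∂(M.edge q μ), ‖M.vec r.1‖ = 1 := by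
  have h := M.ae_notMem_dead hd
  rw [← M.edge_fst (q := q) (μ := μ)] at h
  exact (ae_of_ae_map measurable_fst.aemeasurable h).mono fun r hr => M.norm_vec _ hr

variable [IsMarkovKernel q]

section Edge

variable {w : Y → Y → V → ℝ} {h : Y → Y → ℝ}
  (hw : Measurable fun p : (Y × V) × Y => w p.1.1 p.2 p.1.2)
  (hcont : ∀ y y', Continuous fun s : Metric.sphere (0 : V) 1 => w y y' s)
  (heven : ∀ y y' c, w y y' (-c) = w y y' c)
  (hint : Integrable (fun p : Y × Y => h p.1 p.2) (ν ⊗ₘ q))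
  (hh : Measurable fun p : Y × Y => h p.1 p.2)
  (hb : ∀ y y' (s : Metric.sphere (0 : V) 1), |w y y' s| ≤ h y y')
include hw hint hb

omit [IsMarkovKernel q] in
include hcont heven hh in
/-- Averages over one step of functions that are continuous in the line are Carathéodory
functions. -/
lemma isCaratheodory_edge [IsMarkovKernel q] [SFinite ν] : M.IsCaratheodory ν
    (({y | ∫⁻ y', ‖h y y'‖ₑ ∂(q y) < ⊤}.indicator fun _ => (1 : ℝ)) ∘ M.base *
      fun z => ∫ y', w (M.base z) y' (M.vec z) ∂(q (M.base z))) := by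
  -- The indicator removes the base points where the dominating function is not integrable in y', at
  -- which continuity along the fibre could fail. They form a ν-null set.
  have hgood : MeasurableSet {y | ∫⁻ y', ‖h y y'‖ₑ ∂(q y) < ⊤} :=
    measurableSet_lt (hh.enorm.lintegral_kernel_prod_right' (κ := q)) measurable_const
  refine ⟨?_, fun y => ?_, ⟨fun y => ∫ y', ‖h y y'‖ ∂(q y), ?_, fun y s => ?_⟩⟩
  · refine ((measurable_const.indicator hgood).comp M.measurable_base).mul ?_
    have h1 : Measurable fun r : Z × Y => w (M.base r.1) r.2 (M.vec r.1) :=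
      hw.fun_comp ((M.measurable_base_vec.comp measurable_fst).prodMk measurable_snd)
    exact (h1.stronglyMeasurable.integral_kernel_prod_right'
      (κ := q.comap M.base M.measurable_base)).measurable
  · simp only [Pi.mul_apply, Function.comp, M.base_mk]
    by_cases hy : y ∈ {y | ∫⁻ y', ‖h y y'‖ₑ ∂(q y) < ⊤}
    · simp only [Set.indicator_of_mem hy, one_mul]
      have hvec : ∀ y' (s : Metric.sphere (0 : V) 1), w y y' (M.vec (M.mk y s)) = w y y' s :=
        fun y' s => by
        rw [← M.coe_sec s (M.mk_notMem_dead y s)]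
        rcases M.sec_mk s y s with hs | hs <;> rw [hs]
        rw [coe_neg_sphere, heven]
      simp only [hvec]
      refine continuous_of_dominated (bound := h y) (fun s => ?_)
        (fun s => ae_of_all _ fun y' => hb y y' s) ?_ (ae_of_all _ fun y' => hcont y y')
      · exact (hw.fun_comp (f := fun y' => ((y, (s : V)), y')) (by fun_prop)).aestronglyMeasurable
      · exact ⟨(hh.fun_comp (f := fun y' => (y, y')) (by fun_prop)).aestronglyMeasurable, hy⟩
    · simp only [Set.indicator_of_notMem hy, zero_mul]
      exact continuous_const
  · exact (Measure.integrable_compProd_iff hint.aestronglyMeasurable).1 hint |>.2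
  · simp only [Pi.mul_apply, Function.comp, M.base_mk]
    have hn : 0 ≤ ∫ y', ‖h y y'‖ ∂(q y) := integral_nonneg fun _ => norm_nonneg _
    by_cases hy : y ∈ {y | ∫⁻ y', ‖h y y'‖ₑ ∂(q y) < ⊤}
    · simp only [Set.indicator_of_mem hy, one_mul]
      have hi : Integrable (h y) (q y) :=
        ⟨(hh.fun_comp (f := fun y' => (y, y')) (by fun_prop)).aestronglyMeasurable, hy⟩
      rw [← Real.norm_eq_abs]
      refine norm_integral_le_of_norm_le hi.norm (ae_of_all _ fun y' => ?_)
      rw [Real.norm_eq_abs, ← M.coe_sec s (M.mk_notMem_dead y s)]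
      exact (hb y y' _).trans (le_abs_self _)
    · simpa only [Set.indicator_of_notMem hy, zero_mul, abs_zero] using hn

lemma integrable_edge {μ : Measure Z} [SFinite μ] (hμ : μ.map M.base = ν)
    (hd : μ M.dead = 0) :
    Integrable (fun r : Z × Y => w (M.base r.1) r.2 (M.vec r.1)) (M.edge q μ) := by
  rw [← M.edge_map_base hμ] at hint
  have h1 : Measurable fun r : Z × Y => w (M.base r.1) r.2 (M.vec r.1) :=
    hw.fun_comp ((M.measurable_base_vec.comp measurable_fst).prodMk measurable_snd)
  refine Integrable.mono' (hint.comp_measurable M.measurable_base_edge) h1.aestronglyMeasurable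
    ((M.ae_edge_norm_vec hd).mono fun r hr => ?_)
  exact hb _ _ ⟨M.vec r.1, by simpa using hr⟩

-- Integrating out the next base point turns a functional of edges into a Carathéodory function of
-- the line, up to the discarded base points, which are null for every lift of ν.
include hh hcont heven in
lemma tendsto_integral_edge [SFinite ν] {ι : Type*} {U : Filter ι} {μ : ι → Measure Z}
    [∀ i, IsProbabilityMeasure (μ i)]
    {μ' : Measure Z} [IsProbabilityMeasure μ'] (hμ : ∀ i, (μ i).map M.base = ν)
    (hμ' : μ'.map M.base = ν) (hd : ∀ i, μ i M.dead = 0) (hd' : μ' M.dead = 0)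
    (hlim : M.TendstoLift ν μ U μ') :
    Tendsto (fun i => ∫ r, w (M.base r.1) r.2 (M.vec r.1) ∂(M.edge q (μ i))) U
      (𝓝 (∫ r, w (M.base r.1) r.2 (M.vec r.1) ∂(M.edge q μ'))) := by
  have key : ∀ m : Measure Z, SFinite m → m.map M.base = ν → m M.dead = 0 →
      ∫ r, w (M.base r.1) r.2 (M.vec r.1) ∂(M.edge q m)
        = ∫ z, (({y | ∫⁻ y', ‖h y y'‖ₑ ∂(q y) < ⊤}.indicator fun _ => (1 : ℝ)) ∘ M.base *
      fun z => ∫ y', w (M.base z) y' (M.vec z) ∂(q (M.base z))) z ∂m := by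
    intro m _ hm hmd
    have hi := M.integrable_edge hw hint hb hm hmd
    rw [edge] at hi ⊢
    rw [Measure.integral_compProd hi]
    refine integral_congr_ae ?_
    have hgood : ∀ᵐ y ∂ν, ∫⁻ y', ‖h y y'‖ₑ ∂(q y) < ⊤ := by
      have := ((Measure.integrable_compProd_iff hint.aestronglyMeasurable).1 hint).1
      exact this.mono fun y hy => hy.2
    rw [← hm] at hgood
    refine (ae_of_ae_map M.measurable_base.aemeasurable hgood).mono fun z hz => ?_
    simp only [Pi.mul_apply, Function.comp]
    rw [Set.indicator_of_mem (by exact hz), one_mul]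
    rfl
  rw [key μ' inferInstance hμ' hd']
  exact (hlim _ (M.isCaratheodory_edge hw hcont heven hint hh hb)).congr fun i =>
    (key _ inferInstance (hμ i) (hd i)).symm

end Edge

/-- A continuous cutoff near the origin. -/
def cutoff (δ : ℝ) (c : V) : ℝ := min 1 (‖c‖ / δ)

omit [NormedSpace ℝ V] [MeasurableSpace V] in
lemma cutoff_nonneg {δ : ℝ} (hδ : 0 < δ) (c : V) : 0 ≤ cutoff δ c :=
  le_min zero_le_one (by positivity)

omit [NormedSpace ℝ V] [MeasurableSpace V] in
lemma cutoff_le_one (δ : ℝ) (c : V) : cutoff δ c ≤ 1 := min_le_left _ _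

omit [NormedSpace ℝ V] [MeasurableSpace V] in
lemma continuous_cutoff (δ : ℝ) : Continuous (cutoff δ : V → ℝ) := by
  unfold cutoff; fun_prop

/-- The cutoff makes fibrewise continuous functions continuous at the origin. -/
lemma continuous_cutoff_mul {ψ : Z → ℝ} (hψ : M.IsCaratheodory ν ψ) (hb : ∀ z, |ψ z| ≤ 1) {δ : ℝ}
    (hδ : 0 < δ) (y : Y) : Continuous fun c : V => cutoff δ c * ψ (M.mk y c) := by
  rw [continuous_iff_continuousAt]
  intro c
  by_cases hc : c = 0
  · subst hc
    have h0 : cutoff δ (0 : V) = 0 := by simp [cutoff]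
    rw [ContinuousAt, h0, zero_mul]
    have h1 := (continuous_cutoff (V := V) δ).tendsto 0
    rw [h0] at h1
    refine squeeze_zero_norm (fun c => ?_) h1
    rw [norm_mul, Real.norm_eq_abs, Real.norm_eq_abs, abs_of_nonneg (cutoff_nonneg hδ c)]
    exact mul_le_of_le_one_right (cutoff_nonneg hδ c) (hb _)
  · have h2 : ContinuousOn (fun c : V => ψ (M.mk y c)) {0}ᶜ := by
      rw [continuousOn_iff_continuous_domRestrict]
      have hn : Continuous fun c : ({0}ᶜ : Set V) =>
          (⟨‖(c : V)‖⁻¹ • (c : V), by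
            rw [mem_sphere_zero_iff_norm]
            exact norm_smul_inv_norm (𝕜 := ℝ) c.2⟩ : Metric.sphere (0 : V) 1) := by
        refine Continuous.subtype_mk (Continuous.smul (Continuous.inv₀ (by fun_prop) fun c => ?_)
          continuous_subtype_val) _
        exact norm_ne_zero_iff.2 c.2
      refine ((hψ.continuous y).comp hn).congr fun c => ?_
      simp only [Function.comp, Set.domRestrict_apply]
      rw [M.mk_smul _ _ _ (inv_ne_zero (norm_ne_zero_iff.2 c.2))]
    exact (continuous_cutoff δ).continuousAt.mul
      (h2.continuousAt (isOpen_compl_singleton.mem_nhds hc))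

variable [BorelSpace V] [FiniteDimensional ℝ V]

/-- A family of measures is tight if lines are rarely contracted strongly. -/
def IsTightFamily (q : Kernel Y Y) (A : Y → Y → V →L[ℝ] V) {ι : Type*} (μ : ι → Measure Z) : Prop :=
  ∀ ε > 0, ∃ δ > 0, ∀ i, ∫ r, (1 - cutoff δ (A (M.base r.1) r.2 (M.vec r.1))) ∂(M.edge q (μ i)) ≤ ε

/-- Limits of almost invariant tight families are invariant. -/
theorem kernel_comp_eq_of_tendstoLift [StandardBorelSpace Y] [Nontrivial V] [IsProbabilityMeasure ν]
    (hA : Measurable fun p : Y × Y => A p.1 p.2) {ι : Type*} {U : Filter ι} [U.NeBot]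
    {μ : ι → Measure Z} [∀ i, IsProbabilityMeasure (μ i)] {μ' : Measure Z} [IsProbabilityMeasure μ']
    (hμ : ∀ i, (μ i).map M.base = ν) (hμ' : μ'.map M.base = ν) (hd : ∀ i, μ i M.dead = 0)
    (hd' : μ' M.dead = 0) (hlim : M.TendstoLift ν μ U μ') (htight : M.IsTightFamily q A μ)
    (hinv : ∀ ψ : Z → ℝ, Measurable ψ → (∀ z, |ψ z| ≤ 1) →
      Tendsto (fun i => ∫ z, ψ z ∂(M.kernel q A ∘ₘ μ i) - ∫ z, ψ z ∂(μ i)) U (𝓝 0)) :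
    M.kernel q A ∘ₘ μ' = μ' := by
  have := M.isMarkovKernel_kernel (q := q) hA
  have hA1 : ∀ y y', Continuous fun s : Metric.sphere (0 : V) 1 => A y y' s := fun y y' =>
    (A y y').continuous.comp continuous_subtype_val
  have hAv : Measurable fun r : Z × Y => A (M.base r.1) r.2 (M.vec r.1) := M.measurable_apply_vec hA
  have hcm : ∀ δ, Measurable (cutoff δ : V → ℝ) := fun δ => (continuous_cutoff δ).measurable
  have hone : Integrable (fun _ : Y × Y => (1 : ℝ)) (ν ⊗ₘ q) := integrable_const 1
  have hcut : ∀ {δ : ℝ}, 0 < δ → ∀ c : V, |1 - cutoff δ c| ≤ 1 := fun {δ} hδ c => by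
    rw [abs_of_nonneg (by linarith [cutoff_le_one δ c])]
    linarith [cutoff_nonneg hδ c]
  have hnear : ∀ {δ : ℝ}, 0 < δ → Tendsto
      (fun i => ∫ r, (1 - cutoff δ (A (M.base r.1) r.2 (M.vec r.1))) ∂(M.edge q (μ i))) U
      (𝓝 (∫ r, (1 - cutoff δ (A (M.base r.1) r.2 (M.vec r.1))) ∂(M.edge q μ'))) := fun {δ} hδ => by
    refine M.tendsto_integral_edge (w := fun y y' c => 1 - cutoff δ (A y y' c)) (h := fun _ _ => 1)
      ?_ ?_ ?_ hone measurable_const (fun y y' s => hcut hδ _) hμ hμ' hd hd' hlim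
    · exact measurable_const.sub ((hcm δ).comp (measurable_apply_cocycle hA))
    · exact fun y y' => continuous_const.sub ((continuous_cutoff δ).comp (hA1 y y'))
    · intro y y' c; simp [cutoff]
  -- The function 1 - cutoff is continuous in the line, so the tightness bound passes to the limit
  -- measure.
  have hnear' : ∀ ε > 0, ∃ δ > 0, (∀ i, ∫ r, (1 - cutoff δ (A (M.base r.1) r.2 (M.vec r.1)))
      ∂(M.edge q (μ i)) ≤ ε) ∧
      ∫ r, (1 - cutoff δ (A (M.base r.1) r.2 (M.vec r.1))) ∂(M.edge q μ') ≤ ε := fun ε hε => by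
    obtain ⟨δ, hδ, h⟩ := htight ε hε
    exact ⟨δ, hδ, h, le_of_tendsto' (hnear hδ) h⟩
  -- On an edge whose vector is killed, 1 - cutoff equals 1, so the mass of such edges is at most
  -- every ε > 0.
  have hdead : (M.kernel q A ∘ₘ μ') M.dead = 0 := by
    rw [M.kernel_comp_eq_map hA, Measure.map_apply (M.measurable_step hA) M.measurableSet_dead]
    change M.edge q μ' _ = 0
    set D := (fun r : Z × Y => M.mk r.2 (A (M.base r.1) r.2 (M.vec r.1))) ⁻¹' M.dead with hD
    have hDm : MeasurableSet D := M.measurable_step hA M.measurableSet_dead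
    rw [← measureReal_eq_zero_iff]
    refine le_antisymm (le_of_forall_pos_le_add fun ε hε => ?_) measureReal_nonneg
    obtain ⟨δ, hδ, -, h⟩ := hnear' ε hε
    rw [zero_add]
    refine le_trans ?_ h
    rw [← integral_indicator_one hDm]
    refine integral_mono ((integrable_const (1 : ℝ)).indicator hDm)
      (Integrable.of_bound ((measurable_const.sub ((hcm δ).comp hAv)).aestronglyMeasurable) 1
        (ae_of_all _ fun r => hcut hδ _)) fun r => ?_
    by_cases hr : r ∈ D
    · have : A (M.base r.1) r.2 (M.vec r.1) = 0 := (M.vec_mk_eq_zero_iff _ _).1 hr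
      simp [hr, this, cutoff]
    · simp only [Set.indicator_of_notMem hr]
      linarith [cutoff_le_one δ (A (M.base r.1) r.2 (M.vec r.1))]
  obtain ⟨G, hG, hG1, hdet⟩ := M.exists_determining_sequence
  refine hdet _ _ inferInstance inferInstance hdead hd' fun j => ?_
  have hmap : ∀ m : Measure Z, SFinite m → ∫ z, G j z ∂(M.kernel q A ∘ₘ m)
      = ∫ r, G j (M.mk r.2 (A (M.base r.1) r.2 (M.vec r.1))) ∂(M.edge q m) := fun m _ => by
    rw [M.kernel_comp_eq_map hA, integral_map (M.measurable_step hA).aemeasurable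
      (hG ν j).measurable.aestronglyMeasurable]
    rfl
  have hGs : Measurable fun r : Z × Y => G j (M.mk r.2 (A (M.base r.1) r.2 (M.vec r.1))) :=
    (hG ν j).measurable.fun_comp (M.measurable_step hA)
  -- The cost of inserting the cutoff is at most the mass near the kernel. It is uniformly small by
  -- tightness, and the cutoff integrand is continuous even where A kills the vector.
  have hdiff : ∀ {δ : ℝ}, 0 < δ → ∀ m : Measure Z, IsProbabilityMeasure m →
      |∫ z, G j z ∂(M.kernel q A ∘ₘ m) - ∫ r, cutoff δ (A (M.base r.1) r.2 (M.vec r.1)) *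
        G j (M.mk r.2 (A (M.base r.1) r.2 (M.vec r.1))) ∂(M.edge q m)|
      ≤ ∫ r, (1 - cutoff δ (A (M.base r.1) r.2 (M.vec r.1))) ∂(M.edge q m) := by
    intro δ hδ m _
    have hi1 : Integrable (fun r : Z × Y => G j (M.mk r.2 (A (M.base r.1) r.2 (M.vec r.1))))
        (M.edge q m) :=
      Integrable.of_bound hGs.aestronglyMeasurable 1 (ae_of_all _ fun r => hG1 j _)
    have hi2 : Integrable (fun r : Z × Y => cutoff δ (A (M.base r.1) r.2 (M.vec r.1)) *
        G j (M.mk r.2 (A (M.base r.1) r.2 (M.vec r.1)))) (M.edge q m) := by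
      refine Integrable.of_bound (((hcm δ).comp hAv).mul hGs).aestronglyMeasurable 1
        (ae_of_all _ fun r => ?_)
      rw [norm_mul, Real.norm_eq_abs, Real.norm_eq_abs, abs_of_nonneg (cutoff_nonneg hδ _)]
      exact mul_le_one₀ (cutoff_le_one _ _) (abs_nonneg _) (hG1 j _)
    have hi3 : Integrable (fun r : Z × Y => 1 - cutoff δ (A (M.base r.1) r.2 (M.vec r.1)))
        (M.edge q m) :=
      Integrable.of_bound ((measurable_const.sub ((hcm δ).comp hAv)).aestronglyMeasurable) 1
        (ae_of_all _ fun r => hcut hδ _)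
    rw [hmap m inferInstance, ← integral_sub hi1 hi2, ← Real.norm_eq_abs]
    refine norm_integral_le_of_norm_le hi3 (ae_of_all _ fun r => ?_)
    rw [← one_sub_mul, norm_mul, Real.norm_eq_abs, Real.norm_eq_abs, abs_of_nonneg
      (by linarith [cutoff_le_one δ (A (M.base r.1) r.2 (M.vec r.1))])]
    exact mul_le_of_le_one_right (by linarith [cutoff_le_one δ (A (M.base r.1) r.2 (M.vec r.1))])
      (hG1 j _)
  -- One half of ε pays for the cutoff under the limit measure, the other half for the cutoff under
  -- the approximating measures; their defect of invariance tends to 0.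
  refine eq_of_abs_sub_nonpos (le_of_forall_pos_le_add fun ε hε => ?_)
  obtain ⟨δ, hδ, h1, h2⟩ := hnear' (ε / 2) (by positivity)
  have hb : Tendsto (fun i => ∫ r, cutoff δ (A (M.base r.1) r.2 (M.vec r.1)) *
        G j (M.mk r.2 (A (M.base r.1) r.2 (M.vec r.1))) ∂(M.edge q (μ i))) U
      (𝓝 (∫ r, cutoff δ (A (M.base r.1) r.2 (M.vec r.1)) *
        G j (M.mk r.2 (A (M.base r.1) r.2 (M.vec r.1))) ∂(M.edge q μ'))) := by
    refine M.tendsto_integral_edge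
      (w := fun y y' c => cutoff δ (A y y' c) * G j (M.mk y' (A y y' c))) (h := fun _ _ => 1)
      ?_ ?_ ?_ hone measurable_const (fun y y' s => ?_) hμ hμ' hd hd' hlim
    · exact ((hcm δ).comp (measurable_apply_cocycle hA)).mul ((hG ν j).measurable.comp
        (M.measurable_mk.comp (measurable_snd.prodMk (measurable_apply_cocycle hA))))
    · exact fun y y' => (M.continuous_cutoff_mul (hG ν j) (hG1 j) hδ y').comp (hA1 y y')
    · intro y y' c; simp [cutoff, M.mk_neg]
    · rw [abs_mul, abs_of_nonneg (cutoff_nonneg hδ _)]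
      exact mul_le_one₀ (cutoff_le_one _ _) (abs_nonneg _) (hG1 j _)
  have hc := hlim _ (hG ν j)
  have ha := (hinv _ (hG ν j).measurable (hG1 j)).abs
  have hd2 := hdiff hδ μ' inferInstance
  have hle : |∫ r, cutoff δ (A (M.base r.1) r.2 (M.vec r.1)) *
        G j (M.mk r.2 (A (M.base r.1) r.2 (M.vec r.1))) ∂(M.edge q μ') - ∫ z, G j z ∂μ'|
      ≤ ε / 2 + |(0 : ℝ)| := by
    refine le_of_tendsto_of_tendsto' (hb.sub hc).abs (ha.const_add (ε / 2)) fun i => ?_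
    have hd1 := (hdiff hδ (μ i) inferInstance).trans (h1 i)
    rw [abs_sub_comm] at hd1
    exact (abs_sub_le _ _ _).trans (add_le_add hd1 le_rfl)
  rw [abs_zero, add_zero] at hle
  refine (abs_sub_le _ _ _).trans ((add_le_add (hd2.trans h2) hle).trans ?_)
  linarith

end ProjModel

/-! ### Upper semicontinuity of the potential and tightness criteria. -/

lemma max_elog_neg {t : ℝ} (ht : 0 ≤ t) (R : ℝ) :
    max (elog t) ((-R : ℝ) : EReal) = ((Real.log (max t (Real.exp (-R))) : ℝ) : EReal) := by
  rcases ht.eq_or_lt with rfl | h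
  · rw [elog_zero, max_eq_right (Real.exp_pos _).le, Real.log_exp]
    exact max_eq_right bot_le
  · rw [elog_of_pos h]
    rcases le_total t (Real.exp (-R)) with h1 | h1
    · rw [max_eq_right h1, Real.log_exp, max_eq_right]
      have := Real.log_le_log h h1
      rw [Real.log_exp] at this
      exact_mod_cast this
    · rw [max_eq_left h1, max_eq_left]
      have := Real.log_le_log (Real.exp_pos _) h1
      rw [Real.log_exp] at this
      exact_mod_cast this

lemma abs_log_max_exp_le {t a R : ℝ} (hta : t ≤ a) (hR : 0 ≤ R) :
    |Real.log (max t (Real.exp (-R)))| ≤ Real.posLog a + R := by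
  have h0 : 0 ≤ Real.posLog a := Real.posLog_nonneg
  have hlow : -R ≤ Real.log (max t (Real.exp (-R))) := by
    have := Real.log_le_log (Real.exp_pos _) (le_max_right t (Real.exp (-R)))
    rwa [Real.log_exp] at this
  have hup : Real.log (max t (Real.exp (-R))) ≤ Real.posLog a := by
    have hpos : 0 < max t (Real.exp (-R)) := lt_max_of_lt_right (Real.exp_pos _)
    rcases le_total a 1 with ha | ha
    · refine (Real.log_nonpos hpos.le (max_le (hta.trans ha) ?_)).trans h0
      exact Real.exp_le_one_iff.2 (by linarith)
    · refine (Real.log_le_log hpos (max_le hta ?_)).trans (le_max_right 0 (Real.log a))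
      exact (Real.exp_le_one_iff.2 (by linarith)).trans ha
  rw [abs_le]
  constructor <;> linarith

namespace ProjModel

variable {Y V Z : Type*} [MeasurableSpace Y] [NormedAddCommGroup V] [NormedSpace ℝ V]
  [MeasurableSpace V] [MeasurableSpace Z] [BorelSpace V] [FiniteDimensional ℝ V]
  (M : ProjModel Y V Z) {q : Kernel Y Y} [IsMarkovKernel q]
  {A : Y → Y → V →L[ℝ] V} {ν : Measure Y}

/-- The logarithmic stretch along an edge. -/
def stretch (A : Y → Y → V →L[ℝ] V) (r : Z × Y) : EReal :=
  elog (‖A (M.base r.1) r.2 (M.vec r.1)‖ / ‖M.vec r.1‖)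

lemma measurable_stretch (hA : Measurable fun p : Y × Y => A p.1 p.2) : Measurable (M.stretch A) :=
  measurable_elog.comp
    ((M.measurable_apply_vec hA).norm.div (M.measurable_vec.comp measurable_fst).norm)

omit [FiniteDimensional ℝ V] [BorelSpace V] in
lemma lintegral_pos_stretch_le (hA : Measurable fun p : Y × Y => A p.1 p.2) {μ : Measure Z}
    [SFinite μ] (hμ : μ.map M.base = ν) :
    ∫⁻ r, (M.stretch A r).toENNReal ∂(M.edge q μ)
      ≤ ∫⁻ p, ENNReal.ofReal (Real.posLog ‖A p.1 p.2‖) ∂(ν ⊗ₘ q) := by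
  rw [← M.lintegral_posLog_edge hA hμ]
  refine lintegral_mono fun r => ?_
  rw [stretch, toENNReal_elog _ (by positivity)]
  exact ENNReal.ofReal_le_ofReal (Real.posLog_le_posLog (by positivity)
    (ContinuousLinearMap.ratio_le_opNorm _ _))

lemma extIntegral_potential_eq (hA : Measurable fun p : Y × Y => A p.1 p.2)
    (hint : ∫⁻ p, ENNReal.ofReal (Real.posLog ‖A p.1 p.2‖) ∂(ν ⊗ₘ q) ≠ ⊤)
    {μ : Measure Z} [SFinite μ] (hμ : μ.map M.base = ν) :
    extIntegral μ (M.potential q A) = extIntegral (M.edge q μ) (M.stretch A) :=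
  (extIntegral_compProd _ (M.measurable_stretch hA)
    (ne_top_of_le_ne_top hint (M.lintegral_pos_stretch_le hA hμ))).symm

omit [FiniteDimensional ℝ V] [BorelSpace V] in
lemma max_stretch_ae {μ : Measure Z} [SFinite μ] (hd : μ M.dead = 0) (R : ℝ) :
    ∀ᵐ r ∂(M.edge q μ), max (M.stretch A r) ((-R : ℝ) : EReal)
      = ((Real.log (max ‖A (M.base r.1) r.2 (M.vec r.1)‖ (Real.exp (-R))) : ℝ) : EReal) :=
  (M.ae_edge_norm_vec hd).mono fun r hr => by
    rw [stretch, hr, div_one, max_elog_neg (norm_nonneg _)]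

omit [FiniteDimensional ℝ V] [BorelSpace V] [MeasurableSpace V] in
lemma integrable_posLog_add [IsFiniteMeasure ν] (hA : Measurable fun p : Y × Y => A p.1 p.2)
    (hint : ∫⁻ p, ENNReal.ofReal (Real.posLog ‖A p.1 p.2‖) ∂(ν ⊗ₘ q) ≠ ⊤) (R : ℝ) :
    Integrable (fun p : Y × Y => Real.posLog ‖A p.1 p.2‖ + R) (ν ⊗ₘ q) := by
  refine Integrable.add ⟨(Real.continuous_posLog.measurable.comp hA.norm).aestronglyMeasurable, ?_⟩
    (integrable_const R)
  rw [hasFiniteIntegral_iff_norm]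
  simp only [Real.norm_eq_abs, abs_of_nonneg Real.posLog_nonneg]
  exact hint.lt_top

/-- The integral of the annealed potential is upper semicontinuous. -/
theorem le_extIntegral_potential_of_tendstoLift [IsProbabilityMeasure ν]
    (hA : Measurable fun p : Y × Y => A p.1 p.2)
    (hint : ∫⁻ p, ENNReal.ofReal (Real.posLog ‖A p.1 p.2‖) ∂(ν ⊗ₘ q) ≠ ⊤)
    {ι : Type*} {U : Filter ι} [U.NeBot]
    {μ : ι → Measure Z} [∀ i, IsProbabilityMeasure (μ i)] {μ' : Measure Z} [IsProbabilityMeasure μ']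
    (hμ : ∀ i, (μ i).map M.base = ν) (hμ' : μ'.map M.base = ν) (hd : ∀ i, μ i M.dead = 0)
    (hd' : μ' M.dead = 0) (hlim : M.TendstoLift ν μ U μ') {L : EReal} {l : ι → EReal}
    (hl : Tendsto l U (𝓝 L)) (h : ∀ i, l i ≤ extIntegral (μ i) (M.potential q A)) :
    L ≤ extIntegral μ' (M.potential q A) := by
  rw [M.extIntegral_potential_eq hA hint hμ']
  refine le_extIntegral_of_forall_truncation (M.measurable_stretch hA)
    (ne_top_of_le_ne_top hint (M.lintegral_pos_stretch_le hA hμ')) fun R => ?_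
  -- Truncated at -R, the logarithmic stretch of a unit vector is continuous in the vector and
  -- dominated by log⁺‖A‖ + R, so its integrals converge. It lies above the stretch, and the
  -- truncation is removed by `le_extIntegral_of_forall_truncation`.
  set w : Y → Y → V → ℝ := fun y y' c => Real.log (max ‖A y y' c‖ (Real.exp (-(R : ℝ)))) with hw
  have hwm : Measurable fun p : (Y × V) × Y => w p.1.1 p.2 p.1.2 :=
    Real.measurable_log.comp ((measurable_apply_cocycle hA).norm.max measurable_const)
  have hh : Measurable fun p : Y × Y => Real.posLog ‖A p.1 p.2‖ + R :=
    (Real.continuous_posLog.measurable.comp hA.norm).add_const _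
  have hb : ∀ y y' (s : Metric.sphere (0 : V) 1), |w y y' s| ≤ Real.posLog ‖A y y'‖ + R :=
    fun y y' s => abs_log_max_exp_le ((A y y').le_of_opNorm_le le_rfl _ |>.trans_eq (by simp))
      (Nat.cast_nonneg R)
  have hci := integrable_posLog_add hA hint R
  have hlimw := M.tendsto_integral_edge hwm (fun y y' => ?_) (fun y y' c => ?_) hci hh hb hμ hμ'
    hd hd' hlim
  · have hm : ∀ m : Measure Z, SFinite m → m.map M.base = ν → m M.dead = 0 →
        extIntegral (M.edge q m) (fun r => max (M.stretch A r) ((-(R : ℝ) : ℝ) : EReal))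
          = ((∫ r, w (M.base r.1) r.2 (M.vec r.1) ∂(M.edge q m) : ℝ) : EReal) := fun m _ hm hmd => by
      rw [extIntegral_congr_ae (M.max_stretch_ae hmd (R : ℝ)), extIntegral_coe_of_integrable]
      exact M.integrable_edge hwm hci hb hm hmd
    rw [hm μ' inferInstance hμ' hd']
    refine le_of_tendsto_of_tendsto' hl ((continuous_coe_real_ereal.tendsto _).comp hlimw)
      fun i => (h i).trans ?_
    rw [Function.comp, ← hm (μ i) inferInstance (hμ i) (hd i),
      M.extIntegral_potential_eq hA hint (hμ i)]
    exact extIntegral_mono_ae (ae_of_all _ fun r => le_max_left _ _)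
  · refine Continuous.log (Continuous.max ((A y y').continuous.comp continuous_subtype_val).norm
      continuous_const) fun s => ?_
    exact (lt_max_of_lt_right (Real.exp_pos _)).ne'
  · simp [hw]

/-- Families whose annealed potential has integrals bounded below are tight. -/
theorem isTightFamily_of_le_potential
    (hA : Measurable fun p : Y × Y => A p.1 p.2)
    (hint : ∫⁻ p, ENNReal.ofReal (Real.posLog ‖A p.1 p.2‖) ∂(ν ⊗ₘ q) ≠ ⊤)
    {ι : Type*} {μ : ι → Measure Z} [∀ i, IsProbabilityMeasure (μ i)]
    (hμ : ∀ i, (μ i).map M.base = ν) (hd : ∀ i, μ i M.dead = 0) {L : ℝ}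
    (h : ∀ i, (L : EReal) ≤ extIntegral (μ i) (M.potential q A)) : M.IsTightFamily q A μ := by
  intro ε hε
  set C := (∫⁻ p, ENNReal.ofReal (Real.posLog ‖A p.1 p.2‖) ∂(ν ⊗ₘ q)).toReal with hC
  -- A Markov inequality at scale δ = e^{-R}: where 1 - cutoff is positive the negative part of the
  -- stretch is at least R, so R ∫ (1 - cutoff) ≤ C - L ≤ R ε. The maximum with 1 keeps R positive.
  set R := max 1 ((C - L) / ε) with hR
  have hR0 : 0 < R := lt_max_of_lt_left one_pos
  refine ⟨Real.exp (-R), Real.exp_pos _, fun i => ?_⟩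
  have hcm : Measurable fun r : Z × Y =>
      1 - cutoff (Real.exp (-R)) (A (M.base r.1) r.2 (M.vec r.1)) :=
    measurable_const.sub ((continuous_cutoff _).measurable.comp (M.measurable_apply_vec hA))
  have hnn : ∀ r : Z × Y, 0 ≤ 1 - cutoff (Real.exp (-R)) (A (M.base r.1) r.2 (M.vec r.1)) :=
    fun r => sub_nonneg.2 (cutoff_le_one _ _)
  rw [integral_eq_lintegral_of_nonneg_ae (ae_of_all _ hnn) hcm.aestronglyMeasurable]
  set I := ∫⁻ r, ENNReal.ofReal (1 - cutoff (Real.exp (-R)) (A (M.base r.1) r.2 (M.vec r.1)))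
    ∂(M.edge q (μ i)) with hI
  set N := ∫⁻ r, (-(M.stretch A r)).toENNReal ∂(M.edge q (μ i)) with hN
  set P := ∫⁻ r, (M.stretch A r).toENNReal ∂(M.edge q (μ i)) with hP
  have h1 := h i
  rw [M.extIntegral_potential_eq hA hint (hμ i)] at h1
  have hNtop : N ≠ ⊤ := lintegral_neg_ne_top_of_extIntegral fun hbot => by
    rw [hbot] at h1; exact absurd h1 (not_le.2 (EReal.bot_lt_coe L))
  have hPle : P ≤ _ := M.lintegral_pos_stretch_le hA (hμ i)
  have hPtop : P ≠ ⊤ := ne_top_of_le_ne_top hint hPle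
  have hNreal : N.toReal ≤ C - L := by
    rw [extIntegral, ← EReal.coe_ennreal_toReal hNtop, ← EReal.coe_ennreal_toReal hPtop,
      ← EReal.coe_sub, EReal.coe_le_coe_iff] at h1
    have := ENNReal.toReal_mono hint hPle
    linarith
  have hIN : ENNReal.ofReal R * I ≤ N := by
    rw [hI, ← lintegral_const_mul _ hcm.ennreal_ofReal]
    refine lintegral_mono_ae ((M.ae_edge_norm_vec (hd i)).mono fun r hr => ?_)
    rw [← ENNReal.ofReal_mul hR0.le]
    rcases le_total (Real.exp (-R)) ‖A (M.base r.1) r.2 (M.vec r.1)‖ with h2 | h2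
    · have : cutoff (Real.exp (-R)) (A (M.base r.1) r.2 (M.vec r.1)) = 1 :=
        min_eq_left ((one_le_div (Real.exp_pos _)).2 h2)
      simp [this]
    · have h3 : M.stretch A r ≤ ((-R : ℝ) : EReal) := by
        rw [stretch, hr, div_one, ← Real.log_exp (-R), ← elog_of_pos (Real.exp_pos _)]
        exact elog_mono h2
      have h4 : ((R : ℝ) : EReal) ≤ -(M.stretch A r) := by
        rw [EReal.le_neg]; exact_mod_cast h3
      refine le_trans ?_ (EReal.toENNReal_le_toENNReal h4)
      rw [EReal.toENNReal_of_ne_top (EReal.coe_ne_top _), EReal.toReal_coe]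
      exact ENNReal.ofReal_le_ofReal (mul_le_of_le_one_right hR0.le
        (by linarith [cutoff_nonneg (Real.exp_pos (-R)) (A (M.base r.1) r.2 (M.vec r.1))]))
  have h5 := ENNReal.toReal_mono hNtop hIN
  rw [ENNReal.toReal_mul, ENNReal.toReal_ofReal hR0.le] at h5
  have h6 : (C - L) / ε ≤ R := le_max_right _ _
  rw [div_le_iff₀ hε] at h6
  exact le_of_mul_le_mul_left (h5.trans (hNreal.trans h6)) hR0

omit [BorelSpace V] [MeasurableSpace V] in
lemma _root_.isClosed_setOf_exists_sphere_norm_apply_le (ε : ℝ) :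
    IsClosed {L : V →L[ℝ] V | ∃ s : Metric.sphere (0 : V) 1, ‖L s‖ ≤ ε} := by
  have h : IsClosed {p : (V →L[ℝ] V) × Metric.sphere (0 : V) 1 | ‖p.1 p.2‖ ≤ ε} :=
    isClosed_le (by fun_prop) continuous_const
  have h2 := isClosedMap_fst_of_compactSpace (X := V →L[ℝ] V) (Y := Metric.sphere (0 : V) 1) _ h
  convert! h2
  ext L
  simp

omit [BorelSpace V] [MeasurableSpace V] in
lemma _root_.exists_lt_norm_apply_of_injective {L : V →L[ℝ] V} (hL : Function.Injective L) :
    ∃ n : ℕ, ∀ s : Metric.sphere (0 : V) 1, 1 / ((n : ℝ) + 1) < ‖L s‖ := by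
  rcases isEmpty_or_nonempty (Metric.sphere (0 : V) 1) with hS | hS
  · exact ⟨0, fun s => hS.elim s⟩
  obtain ⟨s, -, hs⟩ := (isCompact_univ (X := Metric.sphere (0 : V) 1)).exists_isMinOn
    Set.univ_nonempty (f := fun s => ‖L s‖)
    ((L.continuous.comp continuous_subtype_val).norm.continuousOn)
  have hpos : 0 < ‖L s‖ := norm_pos_iff.2 fun h0 => ne_zero_of_mem_unit_sphere s
    (hL (h0.trans (map_zero L).symm))
  obtain ⟨n, hn⟩ := exists_nat_one_div_lt hpos
  exact ⟨n, fun t => hn.trans_le (hs (Set.mem_univ t))⟩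

/-- Over an injective cocycle all families are tight. -/
theorem isTightFamily_of_injective [IsProbabilityMeasure ν]
    (hA : Measurable fun p : Y × Y => A p.1 p.2) (hinj : ∀ y y', Function.Injective (A y y'))
    {ι : Type*} {μ : ι → Measure Z} [∀ i, IsProbabilityMeasure (μ i)]
    (hμ : ∀ i, (μ i).map M.base = ν) (hd : ∀ i, μ i M.dead = 0) : M.IsTightFamily q A μ := by
  intro ε hε
  -- The maps that contract some unit vector to length at most 1/(n + 1). By compactness of the
  -- sphere these sets are closed and contain no injective map in their intersection, so their
  -- preimages have small mass under `ν ⊗ₘ q`, the common base marginal of the edges of all lifts.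
  let B : ℕ → Set (V →L[ℝ] V) := fun n =>
    {L | ∃ s : Metric.sphere (0 : V) 1, ‖L s‖ ≤ 1 / ((n : ℝ) + 1)}
  have hBm : ∀ n, MeasurableSet ((fun p : Y × Y => A p.1 p.2) ⁻¹' B n) := fun n =>
    hA (isClosed_setOf_exists_sphere_norm_apply_le _).measurableSet
  have hanti : Antitone fun n => (fun p : Y × Y => A p.1 p.2) ⁻¹' B n := by
    intro m n hmn p ⟨s, hs⟩
    exact ⟨s, hs.trans (one_div_le_one_div_of_le (by positivity) (by gcongr))⟩
  have hempty : ⋂ n, (fun p : Y × Y => A p.1 p.2) ⁻¹' B n = ∅ := by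
    rw [Set.eq_empty_iff_forall_notMem]
    intro p hp
    obtain ⟨n, hn⟩ := exists_lt_norm_apply_of_injective (hinj p.1 p.2)
    obtain ⟨s, hs⟩ := Set.mem_iInter.1 hp n
    exact absurd hs (not_le.2 (hn s))
  have htend := tendsto_measure_iInter_atTop (μ := ν ⊗ₘ q) (fun n => (hBm n).nullMeasurableSet)
    hanti ⟨0, measure_ne_top _ _⟩
  rw [hempty, measure_empty] at htend
  obtain ⟨n, hn⟩ := (htend.eventually (gt_mem_nhds (ENNReal.ofReal_pos.2 hε))).exists
  refine ⟨1 / ((n : ℝ) + 1), by positivity, fun i => ?_⟩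
  have hδ : (0 : ℝ) < 1 / ((n : ℝ) + 1) := by positivity
  set D := (fun r : Z × Y => (M.base r.1, r.2)) ⁻¹' ((fun p : Y × Y => A p.1 p.2) ⁻¹' B n)
    with hD
  have hDm : MeasurableSet D := M.measurable_base_edge (hBm n)
  have hDε : (M.edge q (μ i)).real D ≤ ε := by
    rw [measureReal_def, hD, ← Measure.map_apply M.measurable_base_edge (hBm n),
      M.edge_map_base (hμ i)]
    exact ENNReal.toReal_le_of_le_ofReal hε.le hn.le
  refine le_trans ?_ hDε
  rw [← integral_indicator_one hDm]
  refine integral_mono_ae (Integrable.of_bound (measurable_const.sub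
    ((continuous_cutoff _).measurable.comp (M.measurable_apply_vec hA))).aestronglyMeasurable 1
      (ae_of_all _ fun r => ?_)) ((integrable_const (1 : ℝ)).indicator hDm)
    ((M.ae_edge_norm_vec (hd i)).mono fun r hr => ?_)
  · rw [Real.norm_eq_abs]
    rw [abs_of_nonneg (sub_nonneg.2 (cutoff_le_one _ _))]
    linarith [cutoff_nonneg hδ (A (M.base r.1) r.2 (M.vec r.1))]
  · simp only
    by_cases hrD : r ∈ D
    · rw [Set.indicator_of_mem hrD]
      have := cutoff_nonneg hδ (A (M.base r.1) r.2 (M.vec r.1))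
      simp only [Pi.one_apply]
      linarith
    · rw [Set.indicator_of_notMem hrD]
      have h1 : 1 / ((n : ℝ) + 1) < ‖A (M.base r.1) r.2 (M.vec r.1)‖ := by
        by_contra hcon
        exact hrD ⟨⟨M.vec r.1, by simpa using hr⟩, not_lt.1 hcon⟩
      have h2 : cutoff (1 / ((n : ℝ) + 1)) (A (M.base r.1) r.2 (M.vec r.1)) = 1 :=
        min_eq_left ((one_le_div hδ).2 h1.le)
      rw [h2, sub_self]

end ProjModel

/-! ### Extreme maximizing measures -/

lemma pathRate_ne_top {Y V : Type*} [MeasurableSpace Y] [NormedAddCommGroup V] [NormedSpace ℝ V]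
    {q : Kernel Y Y} [IsMarkovKernel q] {ν : Measure Y} [IsProbabilityMeasure ν]
    {A : Y → Y → V →L[ℝ] V} (hν : q ∘ₘ ν = ν)
    (hA : Measurable fun p : Y × Y => A p.1 p.2)
    (hint : ∫⁻ p, ENNReal.ofReal (Real.posLog ‖A p.1 p.2‖) ∂(ν ⊗ₘ q) ≠ ⊤) :
    pathRate q ν A ≠ ⊤ := by
  have h1 : pathRate q ν A ≤ pathGrowth q ν A 1 := by
    refine (iInf_le _ ⟨1, le_rfl⟩).trans (le_of_eq ?_)
    simp
  have h2 := h1.trans (pathGrowth_le hν hA hint 1)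
  refine ne_top_of_le_ne_top ?_ h2
  exact_mod_cast EReal.coe_ne_top _

/-- The extended integral is affine in the measure. -/
lemma extIntegral_convex {Z : Type*} [MeasurableSpace Z] {μ₁ μ₂ : Measure Z} {a b : ℝ≥0∞}
    (ha : 0 < a) (hb : 0 < b) (hab : a + b = 1) {f : Z → EReal}
    (h₁ : ∫⁻ z, (f z).toENNReal ∂μ₁ ≠ ⊤) (h₂ : ∫⁻ z, (f z).toENNReal ∂μ₂ ≠ ⊤) :
    extIntegral (a • μ₁ + b • μ₂) f
      = (a.toReal : EReal) * extIntegral μ₁ f + (b.toReal : EReal) * extIntegral μ₂ f := by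
  have hat : a ≠ ⊤ := ne_top_of_le_ne_top ENNReal.one_ne_top (hab ▸ le_self_add)
  have hbt : b ≠ ⊤ := ne_top_of_le_ne_top ENNReal.one_ne_top (hab ▸ le_add_self)
  rw [extIntegral_add_measure, ← extIntegral_smul_measure (ENNReal.toReal_pos ha.ne' hat) h₁,
    ← extIntegral_smul_measure (ENNReal.toReal_pos hb.ne' hbt) h₂, ENNReal.ofReal_toReal hat,
    ENNReal.ofReal_toReal hbt]
  · rw [lintegral_smul_measure]; exact ENNReal.mul_ne_top hat h₁
  · rw [lintegral_smul_measure]; exact ENNReal.mul_ne_top hbt h₂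

/-- In a nontrivial convex combination with the maximal value both terms are maximal. -/
lemma EReal.le_of_convex_le {x y s : EReal} {a b : ℝ} (ha : 0 < a) (hb : 0 < b) (hab : a + b = 1)
    (hx : x ≤ s) (hy : y ≤ s) (hst : s ≠ ⊤) (hsb : s ≠ ⊥)
    (h : s ≤ (a : EReal) * x + (b : EReal) * y) : s ≤ x := by
  lift s to ℝ using ⟨hst, hsb⟩
  induction x with
  | bot => rw [EReal.coe_mul_bot_of_pos ha, EReal.bot_add] at h; exact h
  | top => exact le_top
  | coe x =>
    induction y with
    | bot => rw [EReal.coe_mul_bot_of_pos hb, EReal.add_bot] at h; exact absurd h (by simp)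
    | top => exact absurd hy (by simp)
    | coe y =>
      norm_cast at hx hy h ⊢
      have h1 := mul_le_mul_of_nonneg_left hy hb.le
      have h2 : a * s + b * s = s := by rw [← add_mul, hab, one_mul]
      exact le_of_mul_le_mul_left (by linarith) ha

namespace ProjModel

variable {Y V Z : Type*} [MeasurableSpace Y] [NormedAddCommGroup V] [NormedSpace ℝ V]
  [MeasurableSpace V] [MeasurableSpace Z] [BorelSpace V] [FiniteDimensional ℝ V]
  (M : ProjModel Y V Z) {q : Kernel Y Y} [IsMarkovKernel q]
  {A : Y → Y → V →L[ℝ] V} {ν : Measure Y}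

section Compact

variable [StandardBorelSpace Y] [Nontrivial V] [IsProbabilityMeasure ν]

omit [FiniteDimensional ℝ V] in
lemma summable_sq_integral {G : ℕ → Z → ℝ} (hG : ∀ j z, |G j z| ≤ 1) (μ : Measure Z)
    [IsProbabilityMeasure μ] (j : ℕ) : ‖(1 / 2 : ℝ) ^ j * (∫ z, G j z ∂μ) ^ 2‖ ≤ (1 / 2 : ℝ) ^ j := by
  have h : ‖∫ z, G j z ∂μ‖ ≤ 1 := by
    have := norm_integral_le_of_norm_le_const (μ := μ) (C := 1) (f := G j)
      (ae_of_all _ fun z => (Real.norm_eq_abs _).trans_le (hG j z))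
    simpa using this
  rw [norm_mul, norm_pow, norm_pow]
  have h1 : ‖(1 / 2 : ℝ)‖ = 1 / 2 := by norm_num
  rw [h1]
  exact mul_le_of_le_one_right (by positivity) (pow_le_one₀ (norm_nonneg _) h)

omit [IsMarkovKernel q] in
/-- A compact face without mass on the cemetery contains an extreme point. -/
theorem exists_mem_extremePoints {K : Set (Measure Z)} (hK : K ⊆ M.lifts q A ν) (hne : K.Nonempty)
    (hdead : ∀ μ ∈ K, μ M.dead = 0)
    (hface : ∀ μ₁ ∈ M.lifts q A ν, ∀ μ₂ ∈ M.lifts q A ν, ∀ a b : ℝ≥0∞, 0 < a → 0 < b → a + b = 1 →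
      a • μ₁ + b • μ₂ ∈ K → μ₁ ∈ K)
    (hcomp : ∀ μ : ℕ → Measure Z, (∀ n, μ n ∈ K) →
      ∃ μ' ∈ K, M.TendstoLift ν μ (hyperfilter ℕ : Filter ℕ) μ') :
    ∃ μ ∈ K, μ ∈ (M.lifts q A ν).extremePoints ℝ≥0∞ := by
  obtain ⟨G, hG, hG1, hdet⟩ := M.exists_determining_sequence
  -- A weighted sum of squares of affine functionals that separate the measures off the cemetery:
  -- continuous for the convergence in use and strictly convex there. A maximizer of J on the face
  -- is extreme.
  let J : Measure Z → ℝ := fun μ => ∑' j, (1 / 2 : ℝ) ^ j * (∫ z, G j z ∂μ) ^ 2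
  have hgeo : Summable fun j : ℕ => (1 / 2 : ℝ) ^ j := summable_geometric_two
  have hsum : ∀ μ : Measure Z, IsProbabilityMeasure μ →
      Summable fun j => (1 / 2 : ℝ) ^ j * (∫ z, G j z ∂μ) ^ 2 := fun μ _ =>
    Summable.of_norm_bounded hgeo (summable_sq_integral hG1 μ)
  have hbdd : BddAbove (J '' K) := by
    refine ⟨∑' j : ℕ, (1 / 2 : ℝ) ^ j, ?_⟩
    rintro _ ⟨μ, hμ, rfl⟩
    have := (hK hμ).1
    exact (hsum μ this).tsum_le_tsum (fun j => (le_abs_self _).trans (summable_sq_integral hG1 μ j))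
      hgeo
  -- The supremum is attained: a maximizing sequence has a limit in K along the ultrafilter, and J
  -- passes to it by dominated convergence.
  obtain ⟨u, -, hu, huK⟩ := exists_seq_tendsto_sSup (hne.image J) hbdd
  choose μ hμK hμu using huK
  obtain ⟨μ', hμ', hlim⟩ := hcomp μ hμK
  have hJ : J μ' = sSup (J '' K) := by
    have h1 : Tendsto (fun n => J (μ n)) (hyperfilter ℕ : Filter ℕ) (𝓝 (J μ')) := by
      refine tendsto_tsum_of_dominated_convergence hgeo (fun j => ?_)
        (Eventually.of_forall fun n j => ?_)
      · exact ((hlim _ (hG ν j)).pow 2).const_mul _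
      · have := (hK (hμK n)).1
        exact summable_sq_integral hG1 (μ n) j
    have h2 : Tendsto (fun n => J (μ n)) (hyperfilter ℕ : Filter ℕ) (𝓝 (sSup (J '' K))) := by
      simp only [hμu]
      exact hu.mono_left Nat.hyperfilter_le_atTop
    exact tendsto_nhds_unique h1 h2
  refine ⟨μ', hμ', hK hμ', ?_⟩
  rintro μ₁ hμ₁ μ₂ hμ₂ ⟨a, b, ha, hb, hab, rfl⟩
  have h1K := hface μ₁ hμ₁ μ₂ hμ₂ a b ha hb hab hμ'
  have h2K := hface μ₂ hμ₂ μ₁ hμ₁ b a hb ha (by rw [add_comm, hab]) (by rwa [add_comm])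
  have hp1 := hμ₁.1
  have hp2 := hμ₂.1
  have hat : a ≠ ⊤ := ne_top_of_le_ne_top ENNReal.one_ne_top (hab ▸ le_self_add)
  have hbt : b ≠ ⊤ := ne_top_of_le_ne_top ENNReal.one_ne_top (hab ▸ le_add_self)
  have ha' : 0 < a.toReal := ENNReal.toReal_pos ha.ne' hat
  have hb' : 0 < b.toReal := ENNReal.toReal_pos hb.ne' hbt
  have hab' : a.toReal + b.toReal = 1 := by
    rw [← ENNReal.toReal_add hat hbt, hab, ENNReal.toReal_one]
  have hGi : ∀ (m : Measure Z) [IsFiniteMeasure m] j, Integrable (G j) m := fun m _ j =>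
    Integrable.of_bound (hG ν j).measurable.aestronglyMeasurable 1 (ae_of_all _ (hG1 j))
  have hGab : ∀ j, ∫ z, G j z ∂(a • μ₁ + b • μ₂)
      = a.toReal * ∫ z, G j z ∂μ₁ + b.toReal * ∫ z, G j z ∂μ₂ := fun j => by
    rw [integral_add_measure ((hGi μ₁ j).smul_measure hat) ((hGi μ₂ j).smul_measure hbt),
      integral_smul_measure, integral_smul_measure, smul_eq_mul, smul_eq_mul]
  have hle1 : J μ₁ ≤ J (a • μ₁ + b • μ₂) := hJ ▸ le_csSup hbdd ⟨_, h1K, rfl⟩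
  have hle2 : J μ₂ ≤ J (a • μ₁ + b • μ₂) := hJ ▸ le_csSup hbdd ⟨_, h2K, rfl⟩
  -- Quantitative strict convexity: a J(μ₁) + b J(μ₂) - J(a μ₁ + b μ₂) = a b ∑ D j. Maximality makes
  -- the left side nonpositive, so every D j vanishes.
  let D : ℕ → ℝ := fun j => (1 / 2 : ℝ) ^ j * (∫ z, G j z ∂μ₁ - ∫ z, G j z ∂μ₂) ^ 2
  have hD0 : ∀ j, 0 ≤ D j := fun j => by positivity
  have hDeq : ∀ j, a.toReal * b.toReal * D j
      = a.toReal * ((1 / 2 : ℝ) ^ j * (∫ z, G j z ∂μ₁) ^ 2)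
        + b.toReal * ((1 / 2 : ℝ) ^ j * (∫ z, G j z ∂μ₂) ^ 2)
        - (1 / 2 : ℝ) ^ j * (∫ z, G j z ∂(a • μ₁ + b • μ₂)) ^ 2 := fun j => by
    rw [hGab j]
    have : b.toReal = 1 - a.toReal := by linarith
    simp only [D, this]
    ring
  have hs1 := (hsum μ₁ hp1).mul_left a.toReal
  have hs2 := (hsum μ₂ hp2).mul_left b.toReal
  have hs3 := hsum _ (hK hμ').1
  have hDs : Summable fun j => a.toReal * b.toReal * D j := by
    simp only [hDeq]
    exact (hs1.add hs2).sub hs3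
  have hDt : ∑' j, a.toReal * b.toReal * D j
      = a.toReal * J μ₁ + b.toReal * J μ₂ - J (a • μ₁ + b • μ₂) := by
    simp only [hDeq]
    rw [(hs1.add hs2).tsum_sub hs3, hs1.tsum_add hs2, tsum_mul_left, tsum_mul_left]
  have hDz : ∑' j, a.toReal * b.toReal * D j = 0 := by
    refine le_antisymm ?_ (tsum_nonneg fun j => mul_nonneg (by positivity) (hD0 j))
    rw [hDt]
    have h1 := mul_le_mul_of_nonneg_left hle1 ha'.le
    have h2 := mul_le_mul_of_nonneg_left hle2 hb'.le
    have h3 : a.toReal * J (a • μ₁ + b • μ₂) + b.toReal * J (a • μ₁ + b • μ₂)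
        = J (a • μ₁ + b • μ₂) := by rw [← add_mul, hab', one_mul]
    linarith
  have hzero := (hasSum_zero_iff_of_nonneg fun j =>
    mul_nonneg (mul_pos ha' hb').le (hD0 j)).1 (hDz ▸ hDs.hasSum)
  have h12 : μ₁ = μ₂ := by
    refine hdet μ₁ μ₂ hp1 hp2 (hdead _ h1K) (hdead _ h2K) fun j => ?_
    have hj := congr_fun hzero j
    have h3 : D j = 0 := (mul_eq_zero.1 hj).resolve_left (mul_pos ha' hb').ne'
    have h4 := (mul_eq_zero.1 h3).resolve_left (by positivity)
    exact sub_eq_zero.1 (pow_eq_zero_iff two_ne_zero |>.1 h4)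
  rw [← h12, ← add_smul, hab, one_smul]

/-- Tight almost invariant sequences accumulate at invariant measures. -/
theorem exists_mem_lifts_tendstoLift (hA : Measurable fun p : Y × Y => A p.1 p.2)
    {μ : ℕ → Measure Z} (hprob : ∀ i, IsProbabilityMeasure (μ i))
    (hμ : ∀ i, (μ i).map M.base = ν) (hd : ∀ i, μ i M.dead = 0) (htight : M.IsTightFamily q A μ)
    (hinv : ∀ ψ : Z → ℝ, Measurable ψ → (∀ z, |ψ z| ≤ 1) → Tendsto
      (fun i => ∫ z, ψ z ∂(M.kernel q A ∘ₘ μ i) - ∫ z, ψ z ∂(μ i)) atTop (𝓝 0)) :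
    ∃ μ' ∈ M.lifts q A ν, μ' M.dead = 0 ∧ M.TendstoLift ν μ (hyperfilter ℕ : Filter ℕ) μ' := by
  obtain ⟨μ', hp, hb, hd', hlim⟩ := M.exists_tendstoLift (hyperfilter ℕ) μ hprob hμ hd
  refine ⟨μ', ⟨hp, ?_, hb⟩, hd', hlim⟩
  exact M.kernel_comp_eq_of_tendstoLift hA hμ hb hd hd' hlim htight fun ψ hψ hψ1 =>
    (hinv ψ hψ hψ1).mono_left Nat.hyperfilter_le_atTop

omit [StandardBorelSpace Y] [Nontrivial V] in
/-- Time averages are almost invariant. -/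
lemma tendsto_average_sub (hA : Measurable fun p : Y × Y => A p.1 p.2) (μ : Measure (Y × V))
    [IsProbabilityMeasure μ] (ψ : Z → ℝ) (hψ : Measurable ψ) (hψ1 : ∀ z, |ψ z| ≤ 1) : Tendsto
      (fun n : ℕ => ∫ z, ψ z ∂(M.kernel q A ∘ₘ M.average q A μ (n + 1))
        - ∫ z, ψ z ∂(M.average q A μ (n + 1))) atTop (𝓝 0) := by
  have hlim : Tendsto (fun n : ℕ => (((n + 1 : ℕ) : ℝ))⁻¹ * (2 * 1)) atTop (𝓝 0) := by
    have := (tendsto_inv_atTop_nhds_zero_nat (𝕜 := ℝ)).comp (tendsto_add_atTop_nat 1)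
    simpa using this.mul_const (2 : ℝ)
  refine squeeze_zero_norm (fun n => ?_) hlim
  have := M.isProbabilityMeasure_average (q := q) hA μ (n := n + 1) (by omega)
  have := M.isMarkovKernel_kernel (q := q) hA
  rw [integral_bind_of_bounded _ _ hψ hψ1]
  exact M.abs_integral_kernel_average_sub_le hA μ (n + 1) hψ hψ1

end Compact

section Cemetery

omit [FiniteDimensional ℝ V] [BorelSpace V] [IsMarkovKernel q] in
lemma measurable_mk_zero : Measurable fun y => M.mk y 0 :=
  M.measurable_mk.fun_comp (f := fun y => (y, (0 : V))) (by fun_prop)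

omit [FiniteDimensional ℝ V] [IsMarkovKernel q] in
lemma map_mk_zero_dead [IsProbabilityMeasure ν] : (ν.map fun y => M.mk y 0) M.dead = 1 := by
  rw [Measure.map_apply M.measurable_mk_zero M.measurableSet_dead]
  convert! measure_univ (μ := ν)
  exact Set.eq_univ_of_forall fun y => (M.vec_mk_eq_zero_iff y 0).2 rfl

/-- The lift of `ν` to the cemetery is an extreme invariant measure. -/
theorem cemetery_mem_extremePoints [IsProbabilityMeasure ν]
    (hA : Measurable fun p : Y × Y => A p.1 p.2) (hν : q ∘ₘ ν = ν) :
    (ν.map fun y => M.mk y 0) ∈ (M.lifts q A ν).extremePoints ℝ≥0∞ := by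
  have hm := M.measurable_mk_zero
  refine ⟨⟨Measure.isProbabilityMeasure_map hm.aemeasurable, ?_, ?_⟩, ?_⟩
  · refine Measure.ext_of_lintegral _ fun G hG => ?_
    have hbind : ∫⁻ y, G (M.mk y 0) ∂ν = ∫⁻ y, ∫⁻ y', G (M.mk y' 0) ∂(q y) ∂ν := by
      conv_lhs => rw [← hν]
      rw [Measure.lintegral_bind q.measurable.aemeasurable (hG.fun_comp hm).aemeasurable]
    rw [Measure.lintegral_bind (Kernel.measurable _).aemeasurable hG.aemeasurable,
      lintegral_map hG.lintegral_kernel hm, lintegral_map hG hm, hbind]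
    refine lintegral_congr fun y => ?_
    have h0 : M.vec (M.mk y 0) = 0 := (M.vec_mk_eq_zero_iff y 0).2 rfl
    rw [M.kernel_apply hA]
    simp only [h0, map_zero, M.base_mk]
    rw [lintegral_map hG hm]
  · rw [Measure.map_map M.measurable_base hm]
    have : M.base ∘ (fun y => M.mk y 0) = id := funext fun y => M.base_mk y 0
    rw [this, Measure.map_id]
  -- A component of a measure carried by the cemetery is carried by it as well, and such a measure
  -- is determined by its base marginal.
  · rintro μ₁ hμ₁ μ₂ hμ₂ ⟨a, b, ha, hb, hab, hsum⟩
    have hp := hμ₁.1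
    have hcd : μ₁ M.deadᶜ = 0 := by
      have h1 : (a • μ₁ + b • μ₂) M.deadᶜ = 0 := by
        have : IsProbabilityMeasure (ν.map fun y => M.mk y 0) :=
          Measure.isProbabilityMeasure_map hm.aemeasurable
        rw [hsum, prob_compl_eq_zero_iff M.measurableSet_dead, M.map_mk_zero_dead]
      rw [Measure.add_apply, Measure.smul_apply, smul_eq_mul, add_eq_zero, mul_eq_zero] at h1
      exact h1.1.resolve_left ha.ne'
    have hae : ∀ᵐ z ∂μ₁, z ∈ M.dead := by rw [ae_iff]; exact hcd
    rw [← hμ₁.2.2, Measure.map_map hm M.measurable_base]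
    conv_lhs => rw [← Measure.map_id (μ := μ₁)]
    refine Measure.map_congr (hae.mono fun z hz => ?_)
    have hz0 : M.vec z = 0 := hz
    simp only [id, Function.comp]
    rw [← hz0, M.mk_base_vec]

lemma extIntegral_cemetery [IsProbabilityMeasure ν] (hA : Measurable fun p : Y × Y => A p.1 p.2) :
    extIntegral (ν.map fun y => M.mk y 0) (M.potential q A) = ⊥ := by
  by_contra h
  have := M.dead_null_of_extIntegral hA h
  rw [M.map_mk_zero_dead] at this
  exact one_ne_zero this

end Cemetery

section Injective

variable [StandardBorelSpace Y] [Nontrivial V] [IsProbabilityMeasure ν]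

omit [StandardBorelSpace Y] [Nontrivial V] [IsProbabilityMeasure ν] in
lemma vecLaw_zero_null (hA : Measurable fun p : Y × Y => A p.1 p.2)
    (hinj : ∀ y y', Function.Injective (A y y')) (μ : Measure (Y × V)) [IsProbabilityMeasure μ]
    (hμ : μ {p | p.2 = 0} = 0) (n : ℕ) : vecLaw q A μ n {p | p.2 = 0} = 0 := by
  have hs : MeasurableSet {p : Y × V | p.2 = 0} := measurable_snd (measurableSet_singleton 0)
  induction n with
  | zero => exact hμ
  | succ n ih =>
    have := isProbabilityMeasure_vecLaw (q := q) hA μ n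
    rw [vecLaw, vecKernel_comp_eq_map hA, Measure.map_apply (measurable_vecStep hA) hs]
    have h1 : (fun r : (Y × V) × Y => (r.2, A r.1.1 r.2 r.1.2)) ⁻¹' {p : Y × V | p.2 = 0}
        = Prod.fst ⁻¹' {p : Y × V | p.2 = 0} := by
      ext r
      simp only [Set.mem_preimage, Set.mem_ofPred_eq]
      exact ⟨fun h => hinj _ _ (h.trans (map_zero _).symm), fun h => by rw [h, map_zero]⟩
    rw [h1, ← Measure.map_apply measurable_fst hs]
    change (vecLaw q A μ n ⊗ₘ _).fst _ = 0
    rw [Measure.fst_compProd, ih]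

omit [StandardBorelSpace Y] [Nontrivial V] [IsProbabilityMeasure ν] in
lemma average_dead_null (hA : Measurable fun p : Y × Y => A p.1 p.2)
    (hinj : ∀ y y', Function.Injective (A y y')) (μ : Measure (Y × V)) [IsProbabilityMeasure μ]
    (hμ : μ {p | p.2 = 0} = 0) (n : ℕ) : M.average q A μ n M.dead = 0 := by
  rw [average, Measure.smul_apply, Measure.finsetSum_apply]
  refine smul_eq_zero_of_right _ (Finset.sum_eq_zero fun j _ => ?_)
  rw [Measure.map_apply M.measurable_mk M.measurableSet_dead]
  convert! vecLaw_zero_null (q := q) hA hinj μ hμ j using 2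
  ext p
  exact M.vec_mk_eq_zero_iff _ _

/-- Over an injective cocycle there is an extreme invariant measure without mass on the
cemetery. -/
theorem exists_extremePoint_of_injective (hA : Measurable fun p : Y × Y => A p.1 p.2)
    (hinj : ∀ y y', Function.Injective (A y y')) (hν : q ∘ₘ ν = ν) :
    ∃ μ ∈ (M.lifts q A ν).extremePoints ℝ≥0∞, μ M.dead = 0 := by
  obtain ⟨c₀⟩ : Nonempty (Metric.sphere (0 : V) 1) :=
    (NormedSpace.sphere_nonempty (E := V) (x := 0) (r := 1)).2 zero_le_one |>.to_subtype
  suffices hex : ∃ μ ∈ {μ ∈ M.lifts q A ν | μ M.dead = 0},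
      μ ∈ (M.lifts q A ν).extremePoints ℝ≥0∞ by
    obtain ⟨μ, hμ, h⟩ := hex
    exact ⟨μ, h, hμ.2⟩
  refine M.exists_mem_extremePoints (fun μ hμ => hμ.1) ?_ (fun μ hμ => hμ.2) ?_ ?_
  -- Any nonzero constant initial vector serves: injectivity keeps the chain away from 0, and hence
  -- the averages off the cemetery.
  · let μ₀ : Measure (Y × V) := ν ⊗ₘ Kernel.const Y (Measure.dirac (c₀ : V))
    have hs : MeasurableSet {p : Y × V | p.2 = 0} := measurable_snd (measurableSet_singleton 0)
    have hμ₀ : μ₀ {p | p.2 = 0} = 0 := by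
      rw [Measure.compProd_apply hs]
      have h0 : (c₀ : V) ≠ 0 := ne_zero_of_mem_unit_sphere c₀
      simp [h0]
    have hfst : μ₀.fst = ν := Measure.fst_compProd _ _
    have hd := fun n => M.average_dead_null (q := q) hA hinj μ₀ hμ₀ (n + 1)
    have hp := fun n : ℕ => M.isProbabilityMeasure_average (q := q) hA μ₀ (n := n + 1) (by omega)
    have hb := fun n : ℕ => M.average_map_base (q := q) hA hν μ₀ hfst (n := n + 1) (by omega)
    obtain ⟨μ', h1, h2, -⟩ := M.exists_mem_lifts_tendstoLift (q := q) hA hp hb hd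
      (M.isTightFamily_of_injective hA hinj hb hd) (M.tendsto_average_sub hA μ₀)
    exact ⟨μ', h1, h2⟩
  -- The lifts without mass on the cemetery form a face, because a null set of a mixture is null for
  -- its components.
  · rintro μ₁ h₁ μ₂ - a b ha - - ⟨-, h⟩
    refine ⟨h₁, ?_⟩
    rw [Measure.add_apply, Measure.smul_apply, smul_eq_mul, add_eq_zero, mul_eq_zero] at h
    exact h.1.resolve_left ha.ne'
  · intro μ hμ
    have hp := fun n => (hμ n).1.1
    have hb := fun n => (hμ n).1.2.2
    have hi := fun n => (hμ n).1.2.1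
    have hd := fun n => (hμ n).2
    obtain ⟨μ', h1, h2, h3⟩ := M.exists_mem_lifts_tendstoLift (q := q) hA hp hb hd
      (M.isTightFamily_of_injective hA hinj hb hd) fun ψ _ _ => by
        simp only [hi, sub_self]; exact tendsto_const_nhds
    exact ⟨μ', ⟨h1, h2⟩, h3⟩

end Injective

end ProjModel

/-! ### Attainment of the growth rate at an extreme point. -/

section Main

variable {Y V Z : Type*} [MeasurableSpace Y] [StandardBorelSpace Y] [NormedAddCommGroup V]
  [InnerProductSpace ℝ V] [FiniteDimensional ℝ V] [MeasurableSpace V] [BorelSpace V] [Nontrivial V]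
  [MeasurableSpace Z] (M : ProjModel Y V Z) {q : Kernel Y Y} [IsMarkovKernel q]
  {A : Y → Y → V →L[ℝ] V} {ν : Measure Y} [IsProbabilityMeasure ν]

/-- If the growth rate is finite, there is an extreme invariant measure that realises it. -/
theorem ProjModel.exists_extremePoint_of_ne_bot (hA : Measurable fun p : Y × Y => A p.1 p.2)
    (hint : ∫⁻ p, ENNReal.ofReal (Real.posLog ‖A p.1 p.2‖) ∂(ν ⊗ₘ q) ≠ ⊤) (hν : q ∘ₘ ν = ν)
    (hbot : pathRate q ν A ≠ ⊥) :
    ∃ μ ∈ (M.lifts q A ν).extremePoints ℝ≥0∞,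
      extIntegral μ (M.potential q A) = pathRate q ν A := by
  have htop := pathRate_ne_top hν hA hint
  obtain ⟨S, hS⟩ : ∃ S : ℝ, pathRate q ν A = S := ⟨_, (EReal.coe_toReal htop hbot).symm⟩
  have hup : ∀ μ ∈ M.lifts q A ν, extIntegral μ (M.potential q A) ≤ pathRate q ν A := fun μ hμ =>
    M.extIntegral_potential_le hA hint hν hμ
  have hdead : ∀ {μ : Measure Z} {L : ℝ}, (L : EReal) ≤ extIntegral μ (M.potential q A) →
      μ M.dead = 0 := fun {μ L} h => M.dead_null_of_extIntegral hA fun h0 => by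
    rw [h0] at h; exact absurd h (by simp)
  suffices hex : ∃ μ ∈ {μ ∈ M.lifts q A ν | pathRate q ν A ≤ extIntegral μ (M.potential q A)},
      μ ∈ (M.lifts q A ν).extremePoints ℝ≥0∞ by
    obtain ⟨μ, hμ, h⟩ := hex
    exact ⟨μ, h, le_antisymm (hup μ hμ.1) hμ.2⟩
  refine M.exists_mem_extremePoints (fun μ hμ => hμ.1) ?_
    (fun μ hμ => hdead (L := S) (hS ▸ hμ.2)) ?_ ?_
  · obtain ⟨C, hC⟩ := M.exists_pathRate_le_average hA hint hν
    set μ₀ := ν ⊗ₘ Kernel.const Y (stdGaussian V) with hμ₀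
    have hfst : μ₀.fst = ν := Measure.fst_compProd _ _
    have hp := fun n : ℕ => M.isProbabilityMeasure_average (q := q) hA μ₀ (n := n + 1) (by omega)
    have hb := fun n : ℕ => M.average_map_base (q := q) hA hν μ₀ hfst (n := n + 1) (by omega)
    -- A bound uniform in n is enough for tightness and for the absence of mass on the cemetery; the
    -- sharper bound S - C/(n + 1) is used only for semicontinuity.
    have hlow : ∀ n : ℕ, ((S - |C| : ℝ) : EReal)
        ≤ extIntegral (M.average q A μ₀ (n + 1)) (M.potential q A) := fun n => by
      refine le_trans ?_ (hC (n + 1) (by omega))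
      rw [hS, ← EReal.coe_add, EReal.coe_le_coe_iff]
      have h1 : ((n + 1 : ℕ) : ℝ)⁻¹ ≤ 1 := inv_le_one_of_one_le₀ (by simp)
      have h2 : ((n + 1 : ℕ) : ℝ)⁻¹ * C ≤ 1 * |C| :=
        (mul_le_mul_of_nonneg_left (le_abs_self C) (by positivity)).trans
          (mul_le_mul_of_nonneg_right h1 (abs_nonneg C))
      linarith
    have hd := fun n : ℕ => hdead (hlow n)
    obtain ⟨μ', h1, h2, h3⟩ := M.exists_mem_lifts_tendstoLift (q := q) hA hp hb hd
      (M.isTightFamily_of_le_potential hA hint hb hd hlow) (M.tendsto_average_sub hA μ₀)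
    have := h1.1
    refine ⟨μ', h1, M.le_extIntegral_potential_of_tendstoLift hA hint hb h1.2.2 hd h2 h3
      (l := fun n : ℕ => ((S + -(((n + 1 : ℕ) : ℝ)⁻¹ * C) : ℝ) : EReal)) ?_ fun n => ?_⟩
    · rw [hS]
      refine (continuous_coe_real_ereal.tendsto S).comp (Tendsto.mono_left ?_
        Nat.hyperfilter_le_atTop)
      have := (tendsto_inv_atTop_nhds_zero_nat (𝕜 := ℝ)).comp (tendsto_add_atTop_nat 1)
      have h4 := (this.mul_const C).neg.const_add S
      simpa using h4
    · have := hC (n + 1) (by omega)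
      rwa [hS, ← EReal.coe_add] at this
  -- The integral is affine and at most the finite rate on all lifts, so a mixture reaches the rate
  -- only if its components do: the maximizers form a face.
  · rintro μ₁ h₁ μ₂ h₂ a b ha hb hab ⟨-, h⟩
    have hp1 := h₁.1
    have hp2 := h₂.1
    have hat : a ≠ ⊤ := ne_top_of_le_ne_top ENNReal.one_ne_top (hab ▸ le_self_add)
    have hbt : b ≠ ⊤ := ne_top_of_le_ne_top ENNReal.one_ne_top (hab ▸ le_add_self)
    rw [extIntegral_convex ha hb hab (M.lintegral_pos_potential hA hint h₁.2.2)
      (M.lintegral_pos_potential hA hint h₂.2.2)] at h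
    exact ⟨h₁, EReal.le_of_convex_le (ENNReal.toReal_pos ha.ne' hat) (ENNReal.toReal_pos hb.ne' hbt)
      (by rw [← ENNReal.toReal_add hat hbt, hab, ENNReal.toReal_one]) (hup _ h₁) (hup _ h₂) htop hbot
      h⟩
  · intro μ hμ
    have hp := fun n => (hμ n).1.1
    have hb := fun n => (hμ n).1.2.2
    have hi := fun n => (hμ n).1.2.1
    have hlow := fun n => hS ▸ (hμ n).2
    have hd := fun n => hdead (hlow n)
    obtain ⟨μ', h1, h2, h3⟩ := M.exists_mem_lifts_tendstoLift (q := q) hA hp hb hd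
      (M.isTightFamily_of_le_potential hA hint hb hd hlow) fun ψ _ _ => by
        simp only [hi, sub_self]; exact tendsto_const_nhds
    have := h1.1
    exact ⟨μ', ⟨h1, M.le_extIntegral_potential_of_tendstoLift hA hint hb h1.2.2 hd h2 h3
      tendsto_const_nhds fun n => (hμ n).2⟩, h3⟩

/-- The growth rate is attained at an extreme invariant measure, without mass on the cemetery if the
cocycle is injective. -/
theorem ProjModel.exists_extremePoint_eq_pathRate (hA : Measurable fun p : Y × Y => A p.1 p.2)
    (hint : ∫⁻ p, ENNReal.ofReal (Real.posLog ‖A p.1 p.2‖) ∂(ν ⊗ₘ q) ≠ ⊤) (hν : q ∘ₘ ν = ν) :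
    ∃ μ ∈ (M.lifts q A ν).extremePoints ℝ≥0∞,
      extIntegral μ (M.potential q A) = pathRate q ν A ∧
        ((∀ y y', Function.Injective (A y y')) → μ M.dead = 0) := by
  -- If the rate is -∞, the upper bound makes every lift a maximizer, so only extremality and the
  -- mass of the cemetery matter.
  by_cases hbot : pathRate q ν A = ⊥
  · by_cases hinj : ∀ y y', Function.Injective (A y y')
    · obtain ⟨μ, hμ, hd⟩ := M.exists_extremePoint_of_injective hA hinj hν
      refine ⟨μ, hμ, ?_, fun _ => hd⟩
      have := M.extIntegral_potential_le hA hint hν hμ.1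
      rw [hbot] at this ⊢
      exact le_bot_iff.1 this
    · exact ⟨_, M.cemetery_mem_extremePoints hA hν, by rw [M.extIntegral_cemetery hA, hbot],
        fun h => absurd h hinj⟩
  · obtain ⟨μ, hμ, h⟩ := M.exists_extremePoint_of_ne_bot hA hint hν hbot
    exact ⟨μ, hμ, h, fun _ => M.dead_null_of_extIntegral hA (h ▸ hbot)⟩

end Main

/-! ### Norms of exterior powers -/

section ExteriorPower

variable {W W' : Type*} [NormedAddCommGroup W] [InnerProductSpace ℝ W] [FiniteDimensional ℝ W]
  [NormedAddCommGroup W'] [InnerProductSpace ℝ W'] [FiniteDimensional ℝ W'] (k : ℕ)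

instance : MeasurableSpace (⋀[ℝ]^k W) := borel _

instance : BorelSpace (⋀[ℝ]^k W) := ⟨rfl⟩

/-- Left multiplication `v ↦ (w ↦ v ∧ w)`. -/
def wedgeLeft : W →ₗ[ℝ] ⋀[ℝ]^k W →L[ℝ] ⋀[ℝ]^(k + 1) W :=
  (LinearMap.toContinuousLinearMap (𝕜 := ℝ) (E := ⋀[ℝ]^k W) (F' := ⋀[ℝ]^(k + 1) W)).toLinearMap ∘ₗ
    exteriorPower.alternatingMapLinearEquiv.toLinearMap ∘ₗ
      (exteriorPower.ιMulti ℝ (k + 1) (M := W)).curryLeft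

lemma wedgeLeft_ιMulti (v : W) (w : Fin k → W) :
    wedgeLeft k v (exteriorPower.ιMulti ℝ k w)
      = exteriorPower.ιMulti ℝ (k + 1) (Matrix.vecCons v w) := by
  simp [wedgeLeft]

lemma exists_norm_wedgeLeft_le :
    ∃ C : ℝ, 0 ≤ C ∧ ∀ (v : W) (w : ⋀[ℝ]^k W), ‖wedgeLeft k v w‖ ≤ C * ‖v‖ * ‖w‖ := by
  let b := stdOrthonormalBasis ℝ W
  refine ⟨∑ i, ‖wedgeLeft k (b i)‖, Finset.sum_nonneg fun i _ => ContinuousLinearMap.opNorm_nonneg _, fun v w => ?_⟩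
  refine ((wedgeLeft k v).le_opNorm w).trans (mul_le_mul_of_nonneg_right ?_ (norm_nonneg _))
  conv_lhs => rw [← b.sum_repr v, map_sum]
  rw [Finset.sum_mul]
  refine (norm_sum_le _ _).trans (Finset.sum_le_sum fun i _ => ?_)
  rw [map_smul, norm_smul, mul_comm]
  refine mul_le_mul_of_nonneg_left ?_ (norm_nonneg _)
  rw [b.repr_apply_apply]
  refine (norm_inner_le_norm _ _).trans ?_
  rw [b.orthonormal.norm_eq_one, one_mul]

/-- Induction on k, splitting off the first factor by the continuous map `wedgeLeft`. -/
lemma continuous_ιMulti : Continuous fun w : Fin k → W => exteriorPower.ιMulti ℝ k w := by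
  induction k with
  | zero =>
    have h : (fun w : Fin 0 → W => exteriorPower.ιMulti ℝ 0 w)
        = fun _ => exteriorPower.ιMulti ℝ 0 (fun i : Fin 0 => i.elim0) :=
      funext fun w => congr_arg _ (Subsingleton.elim _ _)
    rw [h]
    exact continuous_const
  | succ k ih =>
    have h : Continuous (wedgeLeft (W := W) k) := LinearMap.continuous_of_finiteDimensional _
    have h2 : Continuous fun w : Fin (k + 1) → W =>
        wedgeLeft k (w 0) (exteriorPower.ιMulti ℝ k (Matrix.vecTail w)) :=
      (h.comp (continuous_apply 0)).clm_apply
        (ih.comp (continuous_pi fun i => continuous_apply (Fin.succ i)))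
    refine h2.congr fun w => ?_
    rw [wedgeLeft_ιMulti]
    congr 1
    exact Matrix.cons_head_tail w

omit [FiniteDimensional ℝ W'] in
lemma OrthonormalBasis.exteriorPower_apply {ι : Type*} [Fintype ι] [LinearOrder ι]
    (b : OrthonormalBasis ι ℝ W) (s : Set.powersetCard ι k) :
    b.exteriorPower k s = exteriorPower.ιMulti_family ℝ k b s := by
  rw [← OrthonormalBasis.coe_toBasis, b.toBasis_exteriorPower, exteriorPower.coe_basis,
    OrthonormalBasis.coe_toBasis]

/-- The exterior power of a linear map as a continuous linear map. -/
def wedgeMap (L : W →L[ℝ] W') : ⋀[ℝ]^k W →L[ℝ] ⋀[ℝ]^k W' :=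
  LinearMap.toContinuousLinearMap (exteriorPower.map k (L : W →ₗ[ℝ] W'))

lemma wedgeMap_apply (L : W →L[ℝ] W') (v : ⋀[ℝ]^k W) :
    wedgeMap k L v = exteriorPower.map k (L : W →ₗ[ℝ] W') v := rfl

lemma wedgeMap_id : wedgeMap k (ContinuousLinearMap.id ℝ W) = ContinuousLinearMap.id ℝ _ := by
  ext1 v
  rw [wedgeMap_apply, ContinuousLinearMap.coe_id, exteriorPower.map_id]
  rfl

lemma wedgeMap_comp {W'' : Type*} [NormedAddCommGroup W''] [InnerProductSpace ℝ W'']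
    [FiniteDimensional ℝ W''] (L : W' →L[ℝ] W'') (L' : W →L[ℝ] W') :
    wedgeMap k (L ∘L L') = wedgeMap k L ∘L wedgeMap k L' := by
  ext1 v
  change exteriorPower.map k ((L : W' →ₗ[ℝ] W'') ∘ₗ (L' : W →ₗ[ℝ] W')) v = _
  rw [exteriorPower.map_comp]
  rfl

/-- In finite dimension it is enough to evaluate at vectors, and by linearity at decomposable ones,
where continuity is that of the wedge product. -/
lemma continuous_wedgeMap : Continuous (wedgeMap k : (W →L[ℝ] W') → _) := by
  refine continuous_clm_apply.2 fun v => ?_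
  have hv : v ∈ Submodule.span ℝ (Set.range (exteriorPower.ιMulti ℝ k (M := W))) := by
    rw [exteriorPower.ιMulti_span]; trivial
  induction hv using Submodule.span_induction with
  | mem v hv =>
    obtain ⟨w, rfl⟩ := hv
    simp only [wedgeMap_apply, exteriorPower.map_apply_ιMulti]
    exact (continuous_ιMulti k).comp (continuous_pi fun i => by
      exact (ContinuousLinearMap.apply ℝ W' (w i)).continuous)
  | zero => simp only [map_zero]; exact continuous_const
  | add v v' _ _ h h' => simp only [map_add]; exact h.add h'
  | smul a v _ h => simp only [map_smul]; exact h.const_smul a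

/-- Splitting off one factor of a basis vector, ⋀^{k+1} L (u ∧ w) = Lu ∧ ⋀^k L w. This makes the
growth rate -∞ propagate from k to k + 1; the dimensional constant disappears after division by n.
-/
lemma exists_norm_wedgeMap_succ_le :
    ∃ C : ℝ, 0 < C ∧ ∀ L : W →L[ℝ] W',
      ‖wedgeMap (k + 1) L‖ ≤ C * (‖L‖ * ‖wedgeMap k L‖) := by
  obtain ⟨C, hC0, hC⟩ := exists_norm_wedgeLeft_le (W := W') k
  let b := stdOrthonormalBasis ℝ W
  let B := b.exteriorPower (k + 1)
  let u : ∀ s : Set.powersetCard (Fin (Module.finrank ℝ W)) (k + 1), Fin (k + 1) → W :=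
    fun s => b ∘ Set.powersetCard.ofFinEmbEquiv.symm s
  have hu : ∀ s, B s = exteriorPower.ιMulti ℝ (k + 1) (u s) := b.exteriorPower_apply (k + 1)
  let N : ℝ := ∑ s, C * ‖u s 0‖ * ‖exteriorPower.ιMulti ℝ k (Matrix.vecTail (u s))‖
  have hN : 0 ≤ N := Finset.sum_nonneg fun s _ => by positivity
  refine ⟨N + 1, by positivity, fun L => ?_⟩
  have hLs : ∀ s, ‖wedgeMap (k + 1) L (B s)‖
      ≤ C * ‖u s 0‖ * ‖exteriorPower.ιMulti ℝ k (Matrix.vecTail (u s))‖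
        * (‖L‖ * ‖wedgeMap k L‖) := fun s => by
    have h1 : wedgeMap (k + 1) L (B s)
        = wedgeLeft k (L (u s 0)) (wedgeMap k L (exteriorPower.ιMulti ℝ k (Matrix.vecTail (u s)))) := by
      rw [hu, wedgeMap_apply, wedgeMap_apply, exteriorPower.map_apply_ιMulti,
        exteriorPower.map_apply_ιMulti, wedgeLeft_ιMulti]
      congr 1
      exact (Matrix.cons_head_tail _).symm
    rw [h1]
    refine (hC _ _).trans ?_
    have h2 := L.le_opNorm (u s 0)
    have h3 := (wedgeMap k L).le_opNorm (exteriorPower.ιMulti ℝ k (Matrix.vecTail (u s)))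
    calc C * ‖L (u s 0)‖ * ‖wedgeMap k L (exteriorPower.ιMulti ℝ k (Matrix.vecTail (u s)))‖
        ≤ C * (‖L‖ * ‖u s 0‖)
          * (‖wedgeMap k L‖ * ‖exteriorPower.ιMulti ℝ k (Matrix.vecTail (u s))‖) := by gcongr
      _ = _ := by ring
  have hpos : 0 ≤ ‖L‖ * ‖wedgeMap k L‖ := by positivity
  refine ContinuousLinearMap.opNorm_le_bound _ (by positivity) fun v => ?_
  conv_lhs => rw [← B.sum_repr v, map_sum]
  refine (norm_sum_le _ _).trans ?_
  have h4 : ∀ s, ‖wedgeMap (k + 1) L (B.repr v s • B s)‖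
      ≤ C * ‖u s 0‖ * ‖exteriorPower.ιMulti ℝ k (Matrix.vecTail (u s))‖
        * (‖L‖ * ‖wedgeMap k L‖) * ‖v‖ := fun s => by
    rw [map_smul, norm_smul, mul_comm]
    refine mul_le_mul (hLs s) ?_ (norm_nonneg _) (by positivity)
    rw [B.repr_apply_apply]
    refine (norm_inner_le_norm _ _).trans ?_
    rw [B.orthonormal.norm_eq_one, one_mul]
  refine (Finset.sum_le_sum fun s _ => h4 s).trans ?_
  rw [← Finset.sum_mul, ← Finset.sum_mul]
  gcongr
  exact le_add_of_nonneg_right zero_le_one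

/-- Used to transfer the integrability of log⁺ from the cocycle to its exterior powers. -/
lemma exists_norm_wedgeMap_le :
    ∃ C : ℝ, 0 < C ∧ ∀ L : W →L[ℝ] W', ‖wedgeMap k L‖ ≤ C * ‖L‖ ^ k := by
  induction k with
  | zero =>
    refine ⟨‖wedgeMap 0 (0 : W →L[ℝ] W')‖ + 1,
      add_pos_of_nonneg_of_pos (ContinuousLinearMap.opNorm_nonneg _) one_pos, fun L => ?_⟩
    have h : wedgeMap 0 L = wedgeMap 0 (0 : W →L[ℝ] W') := by
      change LinearMap.toContinuousLinearMap _ = LinearMap.toContinuousLinearMap _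
      congr 1
    rw [h, pow_zero, mul_one]
    exact le_add_of_nonneg_right zero_le_one
  | succ k ih =>
    obtain ⟨C, hC0, hC⟩ := ih
    obtain ⟨C', hC0', hC'⟩ := exists_norm_wedgeMap_succ_le (W := W) (W' := W') k
    refine ⟨C' * C, mul_pos hC0' hC0, fun L => (hC' L).trans ?_⟩
    calc C' * (‖L‖ * ‖wedgeMap k L‖) ≤ C' * (‖L‖ * (C * ‖L‖ ^ k)) := by
          gcongr
          exact hC L
      _ = C' * C * ‖L‖ ^ (k + 1) := by ring

/-- The exterior power of a linear isometry. -/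
def wedgeIso (U : W ≃ₗᵢ[ℝ] W') : ⋀[ℝ]^k W ≃ₗᵢ[ℝ] ⋀[ℝ]^k W' where
  toLinearEquiv := LinearEquiv.ofLinearMap (exteriorPower.map k U.toLinearEquiv.toLinearMap)
    (exteriorPower.map k U.symm.toLinearEquiv.toLinearMap)
    (by rw [← exteriorPower.map_comp, ← exteriorPower.map_id]; congr 1; ext v; simp)
    (by rw [← exteriorPower.map_comp, ← exteriorPower.map_id]; congr 1; ext v; simp)
  norm_map' v := by
    let b := stdOrthonormalBasis ℝ W
    let B := b.exteriorPower k
    let B' := (b.map U).exteriorPower k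
    -- An orthonormal basis of the exterior power is sent to an orthonormal basis, so the
    -- coordinates, and with them the norm, are preserved.
    have hBB : ∀ s, exteriorPower.map k U.toLinearEquiv.toLinearMap (B s) = B' s := fun s => by
      rw [b.exteriorPower_apply, (b.map U).exteriorPower_apply, exteriorPower.map_apply_ιMulti_family]
      rfl
    have h1 : exteriorPower.map k U.toLinearEquiv.toLinearMap v = ∑ s, B.repr v s • B' s := by
      conv_lhs => rw [← B.sum_repr v, map_sum]
      simp only [map_smul, hBB]
    have h2 : B'.repr (exteriorPower.map k U.toLinearEquiv.toLinearMap v) = B.repr v := by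
      rw [h1]
      ext s
      simp [B'.repr_self, Finset.sum_apply, Pi.single_apply]
    change ‖exteriorPower.map k U.toLinearEquiv.toLinearMap v‖ = ‖v‖
    rw [← B'.repr.norm_map, h2, B.repr.norm_map]

lemma wedgeIso_apply (U : W ≃ₗᵢ[ℝ] W') (v : ⋀[ℝ]^k W) :
    wedgeIso k U v = exteriorPower.map k U.toLinearEquiv.toLinearMap v := rfl

lemma wedgeIso_symm (U : W ≃ₗᵢ[ℝ] W') : (wedgeIso k U).symm = wedgeIso k U.symm := rfl

end ExteriorPower

lemma nontrivial_exteriorPower {k d : ℕ} (hkd : k ≤ d) :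
    Nontrivial (⋀[ℝ]^k (EuclideanSpace ℝ (Fin d))) := by
  rw [← Module.finrank_pos_iff (R := ℝ), exteriorPower.finrank_eq, finrank_euclideanSpace,
    Fintype.card_fin]
  exact Nat.choose_pos hkd

/-- Intertwined linear maps have the same norm. -/
lemma linOpNorm_eq_of_intertwine {V₁ V₂ W₁ W₂ : Type*} [NormedAddCommGroup V₁]
    [InnerProductSpace ℝ V₁] [FiniteDimensional ℝ V₁] [NormedAddCommGroup V₂]
    [InnerProductSpace ℝ V₂] [FiniteDimensional ℝ V₂] [NormedAddCommGroup W₁]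
    [InnerProductSpace ℝ W₁] [NormedAddCommGroup W₂]
    [InnerProductSpace ℝ W₂] (U₁ : V₁ ≃ₗᵢ[ℝ] W₁) (U₂ : V₂ ≃ₗᵢ[ℝ] W₂)
    (B : V₁ →ₗ[ℝ] V₂) (A : W₁ →L[ℝ] W₂) (h : ∀ v, A (U₁ v) = U₂ (B v)) : linOpNorm B = ‖A‖ := by
  refine le_antisymm ?_ ?_
  · refine ContinuousLinearMap.opNorm_le_bound _ (norm_nonneg _) fun v => ?_
    change ‖B v‖ ≤ _
    rw [← U₂.norm_map, ← h, ← U₁.norm_map v]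
    exact A.le_opNorm _
  · refine ContinuousLinearMap.opNorm_le_bound _ (norm_nonneg _) fun w => ?_
    obtain ⟨v, rfl⟩ := U₁.surjective w
    rw [h, U₂.norm_map, U₁.norm_map]
    exact (LinearMap.toContinuousLinearMap B).le_opNorm v

/-! ### A measurable choice of a unit vector in each line -/

section LineUnit

variable {V : Type*} [NormedAddCommGroup V] [InnerProductSpace ℝ V] [FiniteDimensional ℝ V]

lemma real_sign_mul {a b : ℝ} (ha : a ≠ 0) (hb : b ≠ 0) :
    Real.sign (a * b) = Real.sign a * Real.sign b := by
  rcases lt_or_gt_of_ne ha with h | h <;> rcases lt_or_gt_of_ne hb with h' | h'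
  · rw [Real.sign_of_neg h, Real.sign_of_neg h', Real.sign_of_pos (mul_pos_of_neg_of_neg h h')]
    norm_num
  · rw [Real.sign_of_neg h, Real.sign_of_pos h', Real.sign_of_neg (mul_neg_of_neg_of_pos h h')]
    norm_num
  · rw [Real.sign_of_pos h, Real.sign_of_neg h', Real.sign_of_neg (mul_neg_of_pos_of_neg h h')]
    norm_num
  · rw [Real.sign_of_pos h, Real.sign_of_pos h', Real.sign_of_pos (mul_pos h h')]
    norm_num

/-- The sign of the first nonvanishing coordinate among those listed. -/
def lineSignAux (c : V) : List (Fin (Module.finrank ℝ V)) → ℝ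
  | [] => 0
  | i :: l => if (stdOrthonormalBasis ℝ V).repr c i = 0 then lineSignAux c l
      else Real.sign ((stdOrthonormalBasis ℝ V).repr c i)

/-- The sign of the first nonvanishing coordinate. -/
def lineSign (c : V) : ℝ := lineSignAux c (List.finRange _)

/-- A unit vector depending only on the line spanned by `c`. -/
def lineUnit (c : V) : V := (lineSign c * ‖c‖⁻¹) • c

lemma lineSignAux_smul (a : ℝ) (ha : a ≠ 0) (c : V) (l : List (Fin (Module.finrank ℝ V))) :
    lineSignAux (a • c) l = Real.sign a * lineSignAux c l := by
  induction l with
  | nil => simp [lineSignAux]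
  | cons i l ih =>
    simp only [lineSignAux, map_smul, PiLp.smul_apply, smul_eq_mul, mul_eq_zero, ha, false_or, ih]
    split_ifs with h
    · rfl
    · rw [real_sign_mul ha h]

lemma abs_lineSignAux (c : V) (l : List (Fin (Module.finrank ℝ V)))
    (h : ∃ i ∈ l, (stdOrthonormalBasis ℝ V).repr c i ≠ 0) : |lineSignAux c l| = 1 := by
  induction l with
  | nil => simp at h
  | cons i l ih =>
    simp only [lineSignAux]
    split_ifs with hi
    · obtain ⟨j, hj, hj'⟩ := h
      rcases List.mem_cons.1 hj with rfl | hj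
      · exact absurd hi hj'
      · exact ih ⟨j, hj, hj'⟩
    · rcases Real.sign_apply_eq_of_ne_zero _ hi with h1 | h1 <;> rw [h1] <;> simp

lemma abs_lineSign {c : V} (hc : c ≠ 0) : |lineSign c| = 1 := by
  refine abs_lineSignAux c _ ?_
  by_contra! hcon
  refine hc ((stdOrthonormalBasis ℝ V).repr.map_eq_zero_iff.1 ?_)
  ext i
  exact hcon i (List.mem_finRange i)

lemma lineUnit_smul {a : ℝ} (ha : a ≠ 0) (c : V) : lineUnit (a • c) = lineUnit c := by
  rw [lineUnit, lineUnit, lineSign, lineSignAux_smul a ha, smul_smul, norm_smul, lineSign]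
  congr 1
  have h1 : Real.sign a * ‖a‖⁻¹ * a = 1 := by
    rcases lt_or_gt_of_ne ha with h | h
    · rw [Real.sign_of_neg h, Real.norm_eq_abs, abs_of_neg h]; field_simp
    · rw [Real.sign_of_pos h, Real.norm_eq_abs, abs_of_pos h]; field_simp
  calc _ = (Real.sign a * ‖a‖⁻¹ * a) * (lineSignAux c (List.finRange _) * ‖c‖⁻¹) := by
        rw [mul_inv]; ring
    _ = _ := by rw [h1, one_mul]

lemma lineUnit_zero : lineUnit (0 : V) = 0 := by simp [lineUnit]

lemma lineUnit_eq_smul {c : V} (hc : c ≠ 0) : ∃ a : ℝ, a ≠ 0 ∧ lineUnit c = a • c := by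
  refine ⟨_, mul_ne_zero ?_ (inv_ne_zero (norm_ne_zero_iff.2 hc)), rfl⟩
  intro h0
  have := abs_lineSign hc
  rw [h0, abs_zero] at this
  exact zero_ne_one this

lemma norm_lineUnit {c : V} (hc : c ≠ 0) : ‖lineUnit c‖ = 1 := by
  rw [lineUnit, norm_smul, norm_mul, Real.norm_eq_abs, abs_lineSign hc, norm_inv, norm_norm, one_mul,
    inv_mul_cancel₀ (norm_ne_zero_iff.2 hc)]

lemma measurable_lineUnit [MeasurableSpace V] [BorelSpace V] : Measurable (lineUnit : V → V) := by
  have hr : ∀ i, Measurable fun c : V => (stdOrthonormalBasis ℝ V).repr c i := fun i =>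
    ((EuclideanSpace.proj (𝕜 := ℝ) i).continuous.comp
      (stdOrthonormalBasis ℝ V).repr.continuous).measurable
  have hl : ∀ l, Measurable fun c : V => lineSignAux c l := fun l => by
    induction l with
    | nil => exact measurable_const
    | cons i l ih =>
      refine Measurable.ite (measurableSet_eq_fun (hr i) measurable_const) ih ?_
      have hs : Measurable Real.sign := by
        unfold Real.sign
        exact Measurable.ite (measurableSet_lt measurable_id measurable_const) measurable_const
          (Measurable.ite (measurableSet_lt measurable_const measurable_id) measurable_const
            measurable_const)
      exact hs.comp (hr i)
  exact ((hl _).mul measurable_norm.inv).smul measurable_id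

end LineUnit

/-! ### Measurable orthonormal frames -/

lemma measurable_of_iUnion {α β ι : Type*} [MeasurableSpace α] [MeasurableSpace β] [Countable ι]
    {f : α → β} (t : ι → Set α) (ht : ∀ i, MeasurableSet (t i)) (htU : ⋃ i, t i = Set.univ)
    (h : ∀ i, Measurable fun a : t i => f a) : Measurable f := by
  intro s hs
  have he : f ⁻¹' s = ⋃ i, (Subtype.val '' ((fun a : t i => f a) ⁻¹' s)) := by
    ext a
    constructor
    · intro ha
      obtain ⟨i, hi⟩ := Set.mem_iUnion.1 (htU.symm ▸ Set.mem_univ a : a ∈ ⋃ i, t i)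
      exact Set.mem_iUnion.2 ⟨i, ⟨a, hi⟩, ha, rfl⟩
    · intro ha
      obtain ⟨i, ⟨b, hb⟩, hb', rfl⟩ := Set.mem_iUnion.1 ha
      exact hb'
  rw [he]
  exact MeasurableSet.iUnion fun i => (ht i).subtype_image (h i hs)

lemma Measurable.congr_fun {α β : Type*} [MeasurableSpace α] [MeasurableSpace β] {f g : α → β}
    (hf : Measurable f) (h : ∀ a, f a = g a) : Measurable g :=
  (funext h : f = g) ▸ hf

namespace MeasurableEuclideanBundle

variable {X : Type*} [MeasurableSpace X] {d : ℕ} {E : X → Type*}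
  [∀ x, NormedAddCommGroup (E x)] [∀ x, InnerProductSpace ℝ (E x)]
  (B : MeasurableEuclideanBundle d E)

/-- The linear frame given by a chart. -/
def chartBasis (i : ℕ) (x : B.baseSet i) : Module.Basis (Fin d) ℝ (E x) :=
  Module.Basis.ofEquivFun (B.triv i x)

lemma triv_chartBasis (i : ℕ) (x : B.baseSet i) (j : Fin d) :
    B.triv i x (B.chartBasis i x j) = Pi.single j 1 := by
  simp [chartBasis]

lemma finrank_fibre (i : ℕ) (x : B.baseSet i) :
    Module.finrank ℝ (E x) = Fintype.card (Fin d) :=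
  Module.finrank_eq_card_basis (B.chartBasis i x)

/-- By polarization, since only the norm is assumed measurable in the charts. -/
lemma measurable_inner_chart (i : ℕ) :
    Measurable fun p : B.baseSet i × (Fin d → ℝ) × (Fin d → ℝ) =>
      inner ℝ ((B.triv i p.1).symm p.2.1) ((B.triv i p.1).symm p.2.2) := by
  simp only [real_inner_eq_norm_add_mul_self_sub_norm_mul_self_sub_norm_mul_self_div_two, ← map_add]
  have h (g : (Fin d → ℝ) × (Fin d → ℝ) → (Fin d → ℝ)) (hg : Measurable g) :
      Measurable fun p : B.baseSet i × (Fin d → ℝ) × (Fin d → ℝ) =>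
        ‖(B.triv i p.1).symm (g p.2)‖ :=
    (B.measurable_norm i).fun_comp (measurable_fst.prodMk (hg.comp measurable_snd))
  have h1 := h (fun c => c.1 + c.2) (measurable_fst.add measurable_snd)
  have h2 := h (fun c => c.1) measurable_fst
  have h3 := h (fun c => c.2) measurable_snd
  exact (((h1.mul h1).sub (h2.mul h2)).sub (h3.mul h3)).div_const 2

lemma measurable_inner_of_triv {α : Type*} [MeasurableSpace α] (i : ℕ) {x : α → B.baseSet i}
    (hx : Measurable x) {v w : ∀ a, E (x a)} (hv : Measurable fun a => B.triv i (x a) (v a))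
    (hw : Measurable fun a => B.triv i (x a) (w a)) :
    Measurable fun a => inner ℝ (v a) (w a) := by
  have := (B.measurable_inner_chart i).fun_comp (hx.prodMk (hv.prodMk hw))
  simpa using this

/-- Each Gram–Schmidt vector is a combination of a chart vector and the earlier ones, with quotients
of measurable inner products as coefficients. -/
lemma measurable_triv_gramSchmidt (i : ℕ) (j : Fin d) :
    Measurable fun x : B.baseSet i =>
      B.triv i x (InnerProductSpace.gramSchmidt ℝ (B.chartBasis i x) j) := by
  induction j using WellFoundedLT.induction with
  | ind j ih =>
    have hb : ∀ j, Measurable fun x : B.baseSet i => B.triv i x (B.chartBasis i x j) := fun j => by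
      simp only [triv_chartBasis]
      exact measurable_const
    have h : ∀ x : B.baseSet i, B.triv i x (InnerProductSpace.gramSchmidt ℝ (B.chartBasis i x) j)
        = B.triv i x (B.chartBasis i x j) - ∑ l ∈ Finset.Iio j,
          (inner ℝ (InnerProductSpace.gramSchmidt ℝ (B.chartBasis i x) l) (B.chartBasis i x j)
            / inner ℝ (InnerProductSpace.gramSchmidt ℝ (B.chartBasis i x) l)
              (InnerProductSpace.gramSchmidt ℝ (B.chartBasis i x) l)) •
          B.triv i x (InnerProductSpace.gramSchmidt ℝ (B.chartBasis i x) l) := fun x => by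
      have := InnerProductSpace.gramSchmidt_def'' ℝ (B.chartBasis i x) j
      rw [eq_sub_iff_add_eq]
      conv_rhs => rw [this]
      rw [map_add, map_sum]
      simp only [map_smul, real_inner_self_eq_norm_sq, RCLike.ofReal_real_eq_id, id]
    simp only [h]
    refine (hb j).sub (Finset.measurable_sum _ fun l hl => ?_)
    have hl' := ih l (Finset.mem_Iio.1 hl)
    exact ((B.measurable_inner_of_triv i measurable_id hl' (hb j)).div
      (B.measurable_inner_of_triv i measurable_id hl' hl')).smul hl'

variable [∀ x, FiniteDimensional ℝ (E x)]

/-- The orthonormal basis obtained from a chart by the Gram–Schmidt process. -/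
def chartOrthonormalBasis (i : ℕ) (x : B.baseSet i) : OrthonormalBasis (Fin d) ℝ (E x) :=
  InnerProductSpace.gramSchmidtOrthonormalBasis (B.finrank_fibre i x) (B.chartBasis i x)

lemma measurable_triv_chartOrthonormalBasis (i : ℕ) (j : Fin d) :
    Measurable fun x : B.baseSet i => B.triv i x (B.chartOrthonormalBasis i x j) := by
  have h : ∀ x : B.baseSet i, B.triv i x (B.chartOrthonormalBasis i x j)
      = (Real.sqrt (inner ℝ (InnerProductSpace.gramSchmidt ℝ (B.chartBasis i x) j)
              (InnerProductSpace.gramSchmidt ℝ (B.chartBasis i x) j)))⁻¹ •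
          B.triv i x (InnerProductSpace.gramSchmidt ℝ (B.chartBasis i x) j) := fun x => by
    have hne : InnerProductSpace.gramSchmidtNormed ℝ (B.chartBasis i x) j ≠ 0 := fun h0 => by
      have := InnerProductSpace.gramSchmidtNormed_unit_length (𝕜 := ℝ) j
        (B.chartBasis i x).linearIndependent
      rw [h0, norm_zero] at this
      exact zero_ne_one this
    rw [chartOrthonormalBasis, InnerProductSpace.gramSchmidtOrthonormalBasis_apply _ hne,
      InnerProductSpace.gramSchmidtNormed, map_smul, ← norm_eq_sqrt_real_inner]
    rfl
  simp only [h]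
  have hg := B.measurable_triv_gramSchmidt i j
  exact ((B.measurable_inner_of_triv i measurable_id hg hg).sqrt.inv).smul hg

/-- The isometry of the fibres with the Euclidean space given by a chart. -/
def chartFrame (i : ℕ) (x : B.baseSet i) : E x ≃ₗᵢ[ℝ] EuclideanSpace ℝ (Fin d) :=
  (B.chartOrthonormalBasis i x).repr

lemma measurable_chartFrame (i : ℕ) :
    Measurable fun p : B.baseSet i × (Fin d → ℝ) =>
      B.chartFrame i p.1 ((B.triv i p.1).symm p.2) := by
  suffices hs : Measurable fun p : B.baseSet i × (Fin d → ℝ) =>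
      WithLp.ofLp (B.chartFrame i p.1 ((B.triv i p.1).symm p.2)) from
    (MeasurableEquiv.toLp 2 (Fin d → ℝ)).measurable.comp hs
  refine measurable_pi_iff.2 fun j => ?_
  have h : ∀ p : B.baseSet i × (Fin d → ℝ), B.chartFrame i p.1 ((B.triv i p.1).symm p.2) j
      = inner ℝ (B.chartOrthonormalBasis i p.1 j) ((B.triv i p.1).symm p.2) := fun p =>
    (B.chartOrthonormalBasis i p.1).repr_apply_apply _ j
  change Measurable fun p : B.baseSet i × (Fin d → ℝ) =>
    B.chartFrame i p.1 ((B.triv i p.1).symm p.2) j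
  simp only [h]
  refine B.measurable_inner_of_triv i measurable_fst
    ((B.measurable_triv_chartOrthonormalBasis i j).comp measurable_fst) ?_
  simp only [LinearEquiv.apply_symm_apply]
  exact measurable_snd

lemma measurable_chartFrame_symm (i : ℕ) :
    Measurable fun p : B.baseSet i × EuclideanSpace ℝ (Fin d) =>
      B.triv i p.1 ((B.chartFrame i p.1).symm p.2) := by
  have h : ∀ p : B.baseSet i × EuclideanSpace ℝ (Fin d),
      B.triv i p.1 ((B.chartFrame i p.1).symm p.2)
        = ∑ j, p.2 j • B.triv i p.1 (B.chartOrthonormalBasis i p.1 j) := fun p => by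
    rw [chartFrame, ← OrthonormalBasis.sum_repr_symm, map_sum]
    simp only [map_smul]
  simp only [h]
  refine Finset.measurable_sum _ fun j _ => Measurable.fun_smul ?_ ?_
  · exact (EuclideanSpace.proj (𝕜 := ℝ) j).continuous.measurable.comp measurable_snd
  · exact (B.measurable_triv_chartOrthonormalBasis i j).comp measurable_fst

omit [∀ x, FiniteDimensional ℝ (E x)] in
lemma exists_mem_baseSet (x : X) : ∃ i, x ∈ B.baseSet i :=
  Set.mem_iUnion.1 (B.iUnion_baseSet.symm ▸ Set.mem_univ x)

open Classical in
/-- The first chart around a point. -/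
def chartAt (x : X) : ℕ := Nat.find (B.exists_mem_baseSet x)

omit [∀ x, FiniteDimensional ℝ (E x)] in
lemma mem_baseSet_chartAt (x : X) : x ∈ B.baseSet (B.chartAt x) := by
  classical exact Nat.find_spec (B.exists_mem_baseSet x)

omit [∀ x, FiniteDimensional ℝ (E x)] in
lemma measurable_chartAt : Measurable B.chartAt := by
  classical exact measurable_find B.exists_mem_baseSet B.measurableSet_baseSet

/-- A measurable choice of isometries of the fibres with the Euclidean space. -/
def frame (x : X) : E x ≃ₗᵢ[ℝ] EuclideanSpace ℝ (Fin d) :=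
  B.chartFrame (B.chartAt x) ⟨x, B.mem_baseSet_chartAt x⟩

lemma frame_eq {i : ℕ} {x : X} (hi : B.chartAt x = i) (hx : x ∈ B.baseSet i) :
    B.frame x = B.chartFrame i ⟨x, hx⟩ := by
  subst hi; rfl

omit [∀ x, FiniteDimensional ℝ (E x)] in
lemma mem_baseSet_of_chartAt_eq {i : ℕ} {x : X} (hi : B.chartAt x = i) : x ∈ B.baseSet i :=
  hi ▸ B.mem_baseSet_chartAt x

omit [∀ x, FiniteDimensional ℝ (E x)] in
lemma measurable_triv_of_triv {α : Type*} [MeasurableSpace α] {i j : ℕ} {x : α → X}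
    (hx : Measurable x) (hi : ∀ a, x a ∈ B.baseSet i) (hj : ∀ a, x a ∈ B.baseSet j)
    {v : ∀ a, E (x a)} (hv : Measurable fun a => B.triv i ⟨x a, hi a⟩ (v a)) :
    Measurable fun a => B.triv j ⟨x a, hj a⟩ (v a) := by
  have hx' : Measurable fun a => (⟨x a, hi a, hj a⟩ : ↥(B.baseSet i ∩ B.baseSet j)) := hx.subtype_mk
  have := (B.measurable_coordChange i j).comp (hx'.prodMk hv)
  refine this.congr_fun fun a => ?_
  exact congr_arg _ (LinearEquiv.symm_apply_apply _ _)

lemma measurable_chartFrame_of_triv {α : Type*} [MeasurableSpace α] {i : ℕ} {x : α → X}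
    (hx : Measurable x) (hi : ∀ a, x a ∈ B.baseSet i)
    {v : ∀ a, E (x a)} (hv : Measurable fun a => B.triv i ⟨x a, hi a⟩ (v a)) :
    Measurable fun a => B.chartFrame i ⟨x a, hi a⟩ (v a) := by
  have hx' : Measurable fun a => (⟨x a, hi a⟩ : B.baseSet i) := hx.subtype_mk
  have := (B.measurable_chartFrame i).comp (hx'.prodMk hv)
  refine this.congr_fun fun a => ?_
  exact congr_arg _ (LinearEquiv.symm_apply_apply _ _)

/-- The frame is glued from charts: on each of the countably many pieces where the first chart is j,
one changes to chart j and applies its own orthonormal frame. -/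
lemma measurable_frame_of_triv {α : Type*} [MeasurableSpace α] {i : ℕ} {x : α → X}
    (hx : Measurable x) (hi : ∀ a, x a ∈ B.baseSet i)
    {v : ∀ a, E (x a)} (hv : Measurable fun a => B.triv i ⟨x a, hi a⟩ (v a)) :
    Measurable fun a => B.frame (x a) (v a) := by
  refine measurable_of_iUnion (fun j : ℕ => {a | B.chartAt (x a) = j})
    (fun j => (B.measurable_chartAt.comp hx) (measurableSet_singleton j)) (by ext p; simp)
    fun j => ?_
  have hj : ∀ a : {a | B.chartAt (x a) = j}, x a ∈ B.baseSet j :=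
    fun a => B.mem_baseSet_of_chartAt_eq a.2
  have hxj : Measurable fun a : {a | B.chartAt (x a) = j} => x a := hx.comp measurable_subtype_coe
  have h1 := B.measurable_triv_of_triv hxj (fun a => hi a) hj (v := fun a => v a)
    (hv.comp measurable_subtype_coe)
  have h2 := B.measurable_chartFrame_of_triv hxj hj h1
  have h : ∀ a : {a | B.chartAt (x a) = j},
      B.frame (x a) (v a) = B.chartFrame j ⟨x a, hj a⟩ (v a) := fun a => by
    rw [B.frame_eq a.2 (hj a)]
  simp only [h]
  exact h2

lemma measurable_frame_chart (i : ℕ) :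
    Measurable fun p : B.baseSet i × (Fin d → ℝ) => B.frame p.1 ((B.triv i p.1).symm p.2) := by
  refine B.measurable_frame_of_triv (i := i) (measurable_subtype_coe.comp measurable_fst)
    (fun p => p.1.2) ?_
  refine measurable_snd.congr_fun fun p => ?_
  exact (LinearEquiv.apply_symm_apply _ _).symm

/-! ### The total space -/

omit [∀ x, FiniteDimensional ℝ (E x)] in
lemma measurable_total_iff {β : Type*} [MeasurableSpace β] {g : B.Total → β} :
    Measurable g ↔ ∀ i, Measurable fun p : B.baseSet i × (Fin d → ℝ) =>
      g ⟨p.1, (B.triv i p.1).symm p.2⟩ := by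
  constructor
  · exact fun h i s hs => MeasurableSpace.measurableSet_iInf.1 (h hs) i
  · exact fun h s hs => MeasurableSpace.measurableSet_iInf.2 fun i => h i hs

omit [∀ x, FiniteDimensional ℝ (E x)] in
lemma measurable_chart_total (i : ℕ) : Measurable fun p : B.baseSet i × (Fin d → ℝ) =>
    (⟨p.1, (B.triv i p.1).symm p.2⟩ : B.Total) :=
  B.measurable_total_iff.1 measurable_id i

lemma measurable_frame_total : Measurable fun p : B.Total => B.frame p.pt p.vec :=
  B.measurable_total_iff.2 fun i => B.measurable_frame_chart i

lemma measurable_frame_symm_total :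
    Measurable fun p : X × EuclideanSpace ℝ (Fin d) =>
      (⟨p.1, (B.frame p.1).symm p.2⟩ : B.Total) := by
  refine measurable_of_iUnion (fun j : ℕ => {p | B.chartAt p.1 = j})
    (fun j => (B.measurable_chartAt.comp measurable_fst) (measurableSet_singleton j))
    (by ext p; simp) fun j => ?_
  have hm : ∀ p : {p : X × EuclideanSpace ℝ (Fin d) | B.chartAt p.1 = j}, p.1.1 ∈ B.baseSet j :=
    fun p => B.mem_baseSet_of_chartAt_eq p.2
  have h : ∀ p : {p : X × EuclideanSpace ℝ (Fin d) | B.chartAt p.1 = j},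
      (⟨p.1.1, (B.frame p.1.1).symm p.1.2⟩ : B.Total)
        = ⟨p.1.1, (B.triv j ⟨p.1.1, hm p⟩).symm
            (B.triv j ⟨p.1.1, hm p⟩ ((B.chartFrame j ⟨p.1.1, hm p⟩).symm p.1.2))⟩ := fun p => by
    rw [LinearEquiv.symm_apply_apply, B.frame_eq p.2 (hm p)]
  simp only [h]
  have hx : Measurable fun p : {p : X × EuclideanSpace ℝ (Fin d) | B.chartAt p.1 = j} =>
      (⟨p.1.1, hm p⟩ : B.baseSet j) := (measurable_fst.comp measurable_subtype_coe).subtype_mk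
  exact (B.measurable_chart_total j).fun_comp (hx.prodMk
    ((B.measurable_chartFrame_symm j).fun_comp
      (hx.prodMk (measurable_snd.comp measurable_subtype_coe))))

attribute [irreducible] frame

end MeasurableEuclideanBundle

/-! ### The projective bundle in homogeneous coordinates -/

section LineOf

variable {V W : Type*} [AddCommGroup V] [Module ℝ V] [AddCommGroup W] [Module ℝ W]

open Classical in
/-- The line spanned by a vector, or `none` for the zero vector. -/
def lineOf (v : V) : Option (ℙ ℝ V) := if h : v = 0 then none else some (Projectivization.mk ℝ v h)

lemma lineOf_zero : lineOf (0 : V) = none := dif_pos rfl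

lemma lineOf_of_ne {v : V} (h : v ≠ 0) : lineOf v = some (Projectivization.mk ℝ v h) := dif_neg h

lemma lineOf_rep (p : ℙ ℝ V) : lineOf p.rep = some p := by
  rw [lineOf_of_ne p.rep_nonzero, p.mk_rep]

lemma lineOf_smul {a : ℝ} (ha : a ≠ 0) (v : V) : lineOf (a • v) = lineOf v := by
  rcases eq_or_ne v 0 with rfl | hv
  · rw [smul_zero]
  · rw [lineOf_of_ne hv, lineOf_of_ne (smul_ne_zero ha hv)]
    congr 1
    exact (Projectivization.mk_eq_mk_iff' ℝ _ _ _ _).2 ⟨a, rfl⟩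

/-- A vector spanning the line, or `0` for `none`. -/
def lineRep : Option (ℙ ℝ V) → V
  | none => 0
  | some p => p.rep

lemma lineOf_lineRep (p : Option (ℙ ℝ V)) : lineOf (lineRep p) = p := by
  cases p with
  | none => exact lineOf_zero
  | some p => exact lineOf_rep p

lemma lineRep_lineOf (v : V) : ∃ a : ℝ, a ≠ 0 ∧ lineRep (lineOf v) = a • v := by
  rcases eq_or_ne v 0 with rfl | hv
  · exact ⟨1, one_ne_zero, by rw [lineOf_zero, smul_zero]; rfl⟩
  · obtain ⟨a, ha⟩ := Projectivization.exists_smul_eq_mk_rep ℝ v hv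
    exact ⟨a, a.ne_zero, by rw [lineOf_of_ne hv]; exact ha.symm⟩

lemma lineRep_eq_zero_iff {p : Option (ℙ ℝ V)} : lineRep p = 0 ↔ p = none := by
  cases p with
  | none => simp [lineRep]
  | some p => simp [lineRep, p.rep_nonzero]

end LineOf

lemma projAction_eq_lineOf {V W : Type*} [NormedAddCommGroup V] [InnerProductSpace ℝ V]
    [NormedAddCommGroup W] [InnerProductSpace ℝ W]
    (k : ℕ) (L : V →ₗ[ℝ] W) (p : Option (ℙ ℝ (⋀[ℝ]^k V))) :
    projAction k L p = lineOf (exteriorPower.map k L (lineRep p)) := by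
  cases p with
  | none => exact (by rw [lineRep, map_zero, lineOf_zero]; rfl)
  | some p =>
    by_cases h : exteriorPower.map k L p.rep = 0
    · rw [lineRep, h, lineOf_zero]
      exact dif_pos h
    · rw [lineRep, lineOf_of_ne h]
      exact dif_neg h

lemma logStretch_eq_elog {V W : Type*} [NormedAddCommGroup V] [InnerProductSpace ℝ V]
    [FiniteDimensional ℝ V] [NormedAddCommGroup W] [InnerProductSpace ℝ W] [FiniteDimensional ℝ W]
    (k : ℕ) (L : V →ₗ[ℝ] W) (p : Option (ℙ ℝ (⋀[ℝ]^k V))) :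
    logStretch k L p = elog (‖exteriorPower.map k L (lineRep p)‖ / ‖lineRep p‖) := by
  cases p with
  | none => simp [lineRep, logStretch]
  | some p => rfl

namespace MeasurableEuclideanBundle

variable {X : Type*} [MeasurableSpace X] {d : ℕ} {E : X → Type*}
  [∀ x, NormedAddCommGroup (E x)] [∀ x, InnerProductSpace ℝ (E x)]
  (B : MeasurableEuclideanBundle d E) (k : ℕ)

lemma measurable_proj_iff {β : Type*} [MeasurableSpace β] {g : B.Proj k → β} :
    Measurable g ↔ (Measurable fun x : X => g ⟨x, none⟩) ∧
      ∀ i, Measurable fun p => g (B.projCoord k i p) := by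
  constructor
  · exact fun h => ⟨fun s hs => (MeasurableSpace.measurableSet_inf.1 (h hs)).1,
      fun i s hs => MeasurableSpace.measurableSet_iInf.1 (MeasurableSpace.measurableSet_inf.1 (h hs)).2 i⟩
  · exact fun h s hs => MeasurableSpace.measurableSet_inf.2 ⟨h.1 hs,
      MeasurableSpace.measurableSet_iInf.2 fun i => h.2 i hs⟩

lemma measurable_projCoord (i : ℕ) : Measurable (B.projCoord k i) :=
  ((B.measurable_proj_iff k).1 measurable_id).2 i

lemma measurable_proj_none : Measurable fun x : X => (⟨x, none⟩ : B.Proj k) :=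
  ((B.measurable_proj_iff k).1 measurable_id).1

lemma measurable_proj_pt : Measurable (Proj.pt : B.Proj k → X) :=
  (B.measurable_proj_iff k).2 ⟨measurable_id, fun _ => measurable_subtype_coe.comp measurable_fst⟩

/-- The linear chart with values in the Euclidean space. -/
def euclideanTriv (i : ℕ) (x : B.baseSet i) : E x ≃ₗ[ℝ] EuclideanSpace ℝ (Fin d) :=
  (B.triv i x).trans (WithLp.linearEquiv 2 ℝ (Fin d → ℝ)).symm

lemma euclideanTriv_chartBasis (i : ℕ) (x : B.baseSet i) (j : Fin d) :
    B.euclideanTriv i x (B.chartBasis i x j) = EuclideanSpace.basisFun (Fin d) ℝ j := by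
  ext l
  simp [euclideanTriv, triv_chartBasis]

/-- The standard orthonormal basis of the exterior power of the Euclidean space. -/
def _root_.wedgeBasis (d k : ℕ) : OrthonormalBasis (Set.powersetCard (Fin d) k) ℝ
    (⋀[ℝ]^k (EuclideanSpace ℝ (Fin d))) :=
  (EuclideanSpace.basisFun (Fin d) ℝ).exteriorPower k

/-- Coordinates in the varying fibres become coordinates in one fixed space, where the continuity of
the wedge product can be used. -/
lemma wedgeFrame_equivFun (i : ℕ) (x : B.baseSet i) (v : ⋀[ℝ]^k (E x)) :
    (B.wedgeFrame k i x).equivFun v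
      = (wedgeBasis d k).repr (exteriorPower.map k (B.euclideanTriv i x).toLinearMap v) := by
  have hs : ∀ s, exteriorPower.map k (B.euclideanTriv i x).toLinearMap (B.wedgeFrame k i x s)
      = wedgeBasis d k s := fun s => by
    rw [wedgeBasis, OrthonormalBasis.exteriorPower_apply]
    change exteriorPower.map k _ ((B.chartBasis i x).exteriorPower k s) = _
    rw [exteriorPower.coe_basis, exteriorPower.map_apply_ιMulti_family]
    congr 1
    exact funext fun j => B.euclideanTriv_chartBasis i x j
  conv_rhs => rw [← (B.wedgeFrame k i x).sum_equivFun v, map_sum]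
  simp only [map_smul, hs]
  funext s
  simp [Finset.sum_apply, Pi.single_apply]

variable [∀ x, FiniteDimensional ℝ (E x)]

lemma measurable_triv_frame_symm {α : Type*} [MeasurableSpace α] {i : ℕ} {x : α → X}
    (hx : Measurable x) (hi : ∀ a, x a ∈ B.baseSet i) {c : α → EuclideanSpace ℝ (Fin d)}
    (hc : Measurable c) :
    Measurable fun a => B.triv i ⟨x a, hi a⟩ ((B.frame (x a)).symm (c a)) := by
  refine measurable_of_iUnion (fun j : ℕ => {a | B.chartAt (x a) = j})
    (fun j => (B.measurable_chartAt.comp hx) (measurableSet_singleton j)) (by ext p; simp)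
    fun j => ?_
  have hj : ∀ a : {a | B.chartAt (x a) = j}, x a ∈ B.baseSet j :=
    fun a => B.mem_baseSet_of_chartAt_eq a.2
  have hxj : Measurable fun a : {a | B.chartAt (x a) = j} => x a := hx.comp measurable_subtype_coe
  have hxj' : Measurable fun a : {a | B.chartAt (x a) = j} => (⟨x a, hj a⟩ : B.baseSet j) :=
    hxj.subtype_mk
  have h1 : Measurable fun a : {a | B.chartAt (x a) = j} =>
      B.triv j ⟨x a, hj a⟩ ((B.frame (x a)).symm (c a)) := by
    refine ((B.measurable_chartFrame_symm j).comp
      (hxj'.prodMk (hc.comp measurable_subtype_coe))).congr_fun fun a => ?_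
    rw [B.frame_eq a.2 (hj a)]
    rfl
  exact B.measurable_triv_of_triv hxj hj (fun a => hi a) h1

lemma measurable_wedgeFrame_frame_symm {α : Type*} [MeasurableSpace α] {i : ℕ} {x : α → X}
    (hx : Measurable x) (hi : ∀ a, x a ∈ B.baseSet i)
    {c : α → ⋀[ℝ]^k (EuclideanSpace ℝ (Fin d))} (hc : Measurable c) :
    Measurable fun a => (B.wedgeFrame k i ⟨x a, hi a⟩).equivFun
      ((wedgeIso k (B.frame (x a))).symm (c a)) := by
  have h : ∀ a, exteriorPower.map k (B.euclideanTriv i ⟨x a, hi a⟩).toLinearMap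
      ((wedgeIso k (B.frame (x a))).symm (c a))
      = ∑ s, (wedgeBasis d k).repr (c a) s • exteriorPower.ιMulti ℝ k (fun l =>
        B.euclideanTriv i ⟨x a, hi a⟩ ((B.frame (x a)).symm (EuclideanSpace.basisFun (Fin d) ℝ
          (Set.powersetCard.ofFinEmbEquiv.symm s l)))) := fun a => by
    conv_lhs => rw [← (wedgeBasis d k).sum_repr (c a), map_sum, map_sum]
    refine Finset.sum_congr rfl fun s _ => ?_
    rw [map_smul, map_smul, wedgeBasis, OrthonormalBasis.exteriorPower_apply, wedgeIso_symm,
      wedgeIso_apply, exteriorPower.map_apply_ιMulti_family, exteriorPower.map_apply_ιMulti_family]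
    rfl
  have hm : Measurable fun a => exteriorPower.map k (B.euclideanTriv i ⟨x a, hi a⟩).toLinearMap
      ((wedgeIso k (B.frame (x a))).symm (c a)) := by
    simp only [h]
    refine Finset.measurable_sum _ fun s _ => Measurable.fun_smul ?_ ?_
    · exact ((EuclideanSpace.proj (𝕜 := ℝ) s).continuous.comp
        (wedgeBasis d k).repr.continuous).measurable.comp hc
    · refine (continuous_ιMulti k).measurable.comp (measurable_pi_iff.2 fun l => ?_)
      exact (MeasurableEquiv.toLp 2 (Fin d → ℝ)).measurable.comp
        (B.measurable_triv_frame_symm hx hi measurable_const)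
  refine measurable_pi_iff.2 fun s => ?_
  simp only [wedgeFrame_equivFun]
  exact ((EuclideanSpace.proj (𝕜 := ℝ) s).continuous.comp
        (wedgeBasis d k).repr.continuous).measurable.comp hm

/-- The point of the projective bundle with given coordinates. -/
def projMk (x : X) (c : ⋀[ℝ]^k (EuclideanSpace ℝ (Fin d))) : B.Proj k :=
  ⟨x, lineOf ((wedgeIso k (B.frame x)).symm c)⟩

/-- The normalized coordinates of a point of the projective bundle. -/
def projVec (z : B.Proj k) : ⋀[ℝ]^k (EuclideanSpace ℝ (Fin d)) :=
  lineUnit (wedgeIso k (B.frame z.pt) (lineRep z.dir))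

lemma projMk_zero (x : X) : B.projMk k x 0 = ⟨x, none⟩ := by
  rw [projMk, LinearIsometryEquiv.map_zero, lineOf_zero]

lemma projMk_eq_projCoord {j : ℕ} {x : X} (hj : x ∈ B.baseSet j)
    {c : ⋀[ℝ]^k (EuclideanSpace ℝ (Fin d))} (hc : (B.wedgeFrame k j ⟨x, hj⟩).equivFun
      ((wedgeIso k (B.frame x)).symm c) ≠ 0) :
    B.projMk k x c = B.projCoord k j (⟨x, hj⟩, ⟨_, hc⟩) := by
  have hv : (wedgeIso k (B.frame x)).symm c ≠ 0 := (LinearEquiv.map_ne_zero_iff _).1 hc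
  rw [projMk, lineOf_of_ne hv, projCoord]
  simp only [LinearEquiv.symm_apply_apply]

lemma measurable_projMk_chart {α : Type*} [MeasurableSpace α] {j : ℕ} {x : α → X}
    (hx : Measurable x) (hj : ∀ a, x a ∈ B.baseSet j)
    {c : α → ⋀[ℝ]^k (EuclideanSpace ℝ (Fin d))} (hc : Measurable c) (h0 : ∀ a, c a ≠ 0) :
    Measurable fun a => B.projMk k (x a) (c a) := by
  have hxj : Measurable fun a => (⟨x a, hj a⟩ : B.baseSet j) := hx.subtype_mk
  have hne : ∀ a, (B.wedgeFrame k j ⟨x a, hj a⟩).equivFun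
      ((wedgeIso k (B.frame (x a))).symm (c a)) ≠ 0 := fun a =>
    (LinearEquiv.map_ne_zero_iff _).2 ((LinearIsometryEquiv.map_eq_zero_iff _).not.2 (h0 a))
  refine ((B.measurable_projCoord k j).comp
    (hxj.prodMk ((B.measurable_wedgeFrame_frame_symm k hx hj hc).subtype_mk (h := hne)))).congr_fun
    fun a => ?_
  exact (B.projMk_eq_projCoord k (hj a) (hne a)).symm

lemma measurable_projMk_of_ne_zero {α : Type*} [MeasurableSpace α] {x : α → X}
    (hx : Measurable x) {c : α → ⋀[ℝ]^k (EuclideanSpace ℝ (Fin d))} (hc : Measurable c)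
    (h0 : ∀ a, c a ≠ 0) : Measurable fun a => B.projMk k (x a) (c a) := by
  refine measurable_of_iUnion (fun j : ℕ => {a | B.chartAt (x a) = j})
    (fun j => (B.measurable_chartAt.comp hx) (measurableSet_singleton j)) (by ext p; simp)
    fun j => ?_
  exact B.measurable_projMk_chart k (hx.comp measurable_subtype_coe)
    (fun a => B.mem_baseSet_of_chartAt_eq a.2) (hc.comp measurable_subtype_coe) fun a => h0 a

/-- The zero vector names the cemetery section, whose measurable structure is separate from that of
the homogeneous coordinates; hence the split at c = 0. -/
lemma measurable_projMk_comp {α : Type*} [MeasurableSpace α] {x : α → X}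
    (hx : Measurable x) {c : α → ⋀[ℝ]^k (EuclideanSpace ℝ (Fin d))} (hc : Measurable c) :
    Measurable fun a => B.projMk k (x a) (c a) := by
  have hs : MeasurableSet {a | c a = 0} := hc (measurableSet_singleton 0)
  refine measurable_of_restrict_of_restrict_compl hs ?_ ?_
  · refine ((B.measurable_proj_none k).comp (hx.comp measurable_subtype_coe)).congr_fun fun a => ?_
    have ha : c a = 0 := a.2
    change _ = B.projMk k (x a) (c a)
    rw [ha, projMk_zero]
    rfl
  · exact B.measurable_projMk_of_ne_zero k (hx.comp measurable_subtype_coe)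
      (hc.comp measurable_subtype_coe) fun a => a.2

lemma measurable_projMk :
    Measurable fun p : X × ⋀[ℝ]^k (EuclideanSpace ℝ (Fin d)) => B.projMk k p.1 p.2 :=
  B.measurable_projMk_comp k measurable_fst measurable_snd

lemma measurable_projVec : Measurable (B.projVec k) := by
  refine (B.measurable_proj_iff k).2 ⟨?_, fun i => ?_⟩
  · simp only [projVec, lineRep, map_zero]
    exact measurable_const
  -- The representative chosen by `rep` has no measurability, but it is a nonzero multiple of the
  -- coordinate vector and `lineUnit` depends only on the line.
  · have h : ∀ p, B.projVec k (B.projCoord k i p)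
        = lineUnit (∑ s, p.2.1 s • exteriorPower.ιMulti ℝ k (fun l =>
          B.frame p.1 ((B.triv i p.1).symm (Pi.single (Set.powersetCard.ofFinEmbEquiv.symm s l) 1)))) :=
        fun p => by
      have h1 : (B.wedgeFrame k i p.1).equivFun.symm p.2.1 ≠ 0 :=
        (LinearEquiv.map_ne_zero_iff _).2 p.2.2
      obtain ⟨a, ha⟩ := Projectivization.exists_smul_eq_mk_rep ℝ _ h1
      change lineUnit (wedgeIso k (B.frame p.1) (Projectivization.mk ℝ _ h1).rep) = _
      rw [← ha, Units.smul_def, LinearIsometryEquiv.map_smul, lineUnit_smul a.ne_zero,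
        Module.Basis.equivFun_symm_apply, map_sum]
      congr 1
      refine Finset.sum_congr rfl fun s _ => ?_
      rw [LinearIsometryEquiv.map_smul, wedgeFrame, exteriorPower.coe_basis, wedgeIso_apply,
        exteriorPower.map_apply_ιMulti_family, Module.Basis.coe_ofEquivFun]
      rfl
    have hm : ∀ (s : Set.powersetCard (Fin d) k) (l : Fin k), Measurable fun p : B.baseSet i × {c : Set.powersetCard (Fin d) k → ℝ // c ≠ 0} =>
        B.frame p.1 ((B.triv i p.1).symm
          (Pi.single (Set.powersetCard.ofFinEmbEquiv.symm s l) 1)) := fun s l => by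
      refine B.measurable_frame_of_triv (i := i) (measurable_subtype_coe.comp measurable_fst)
        (fun p => p.1.2) ?_
      refine (measurable_const (a := (Pi.single (Set.powersetCard.ofFinEmbEquiv.symm s l) 1 :
        Fin d → ℝ))).congr_fun fun p => ?_
      exact (LinearEquiv.apply_symm_apply _ _).symm
    simp only [h]
    refine measurable_lineUnit.comp (Finset.measurable_sum _ fun s _ => Measurable.fun_smul ?_ ?_)
    · exact (measurable_pi_apply s).comp (measurable_subtype_coe.comp measurable_snd)
    · exact (continuous_ιMulti k).measurable.comp (measurable_pi_iff.2 (hm s))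

lemma exists_projVec_eq_smul (z : B.Proj k) :
    ∃ a : ℝ, a ≠ 0 ∧ B.projVec k z = a • wedgeIso k (B.frame z.pt) (lineRep z.dir) := by
  rcases eq_or_ne (wedgeIso k (B.frame z.pt) (lineRep z.dir)) 0 with h | h
  · exact ⟨1, one_ne_zero, by rw [projVec, h, lineUnit_zero, smul_zero]⟩
  · exact lineUnit_eq_smul h

/-- The projective bundle in homogeneous coordinates. -/
def projModel (T : Type*) [MeasurableSpace T] :
    ProjModel (T × X) (⋀[ℝ]^k (EuclideanSpace ℝ (Fin d))) (T × B.Proj k) where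
  base z := (z.1, z.2.pt)
  vec z := B.projVec k z.2
  mk y c := (y.1, B.projMk k y.2 c)
  measurable_base := measurable_fst.prodMk ((B.measurable_proj_pt k).comp measurable_snd)
  measurable_vec := (B.measurable_projVec k).comp measurable_snd
  measurable_mk := measurable_fst.fst.prodMk
    ((B.measurable_projMk k).fun_comp (measurable_fst.snd.prodMk measurable_snd))
  base_mk _ _ := rfl
  mk_base_vec z := by
    obtain ⟨a, ha, h⟩ := B.exists_projVec_eq_smul k z.2
    simp only [projMk]
    rw [h, map_smul, LinearIsometryEquiv.symm_apply_apply, lineOf_smul ha, lineOf_lineRep]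
  mk_smul y c a ha := by simp only [projMk]; rw [map_smul, lineOf_smul ha]
  vec_mk y c := by
    obtain ⟨a, ha, h⟩ := B.exists_projVec_eq_smul k (B.projMk k y.2 c)
    obtain ⟨b, hb, h'⟩ := lineRep_lineOf ((wedgeIso k (B.frame y.2)).symm c)
    refine ⟨a * b, mul_ne_zero ha hb, ?_⟩
    have h2 : B.projVec k (B.projMk k y.2 c)
        = a • wedgeIso k (B.frame y.2) (lineRep (lineOf ((wedgeIso k (B.frame y.2)).symm c))) := h
    rw [h2, h', map_smul, LinearIsometryEquiv.apply_symm_apply, smul_smul]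
  norm_vec z h := by
    refine norm_lineUnit fun h0 => h ?_
    rw [projVec, h0, lineUnit_zero]

end MeasurableEuclideanBundle

/-! ### Invariant measures of operators given by kernels -/

section Operators

variable {Z : Type*} [MeasurableSpace Z] {P : (Z → ℝ) → Z → ℝ} {κ : Kernel Z Z} [IsMarkovKernel κ]

lemma mem_invariantMeasures_iff (hP : ∀ ψ : Z → ℝ, Measurable ψ → ∀ z, P ψ z = ∫ w, ψ w ∂(κ z))
    {μ : Measure Z} : μ ∈ invariantMeasures P ↔ IsProbabilityMeasure μ ∧ κ ∘ₘ μ = μ := by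
  constructor
  · rintro ⟨hμ, h⟩
    refine ⟨hμ, Measure.ext fun s hs => ?_⟩
    have hψ : Measurable (s.indicator fun _ : Z => (1 : ℝ)) := measurable_const.indicator hs
    have hb : ∀ z, |s.indicator (fun _ : Z => (1 : ℝ)) z| ≤ 1 := fun z => by
      by_cases hz : z ∈ s <;> simp [hz]
    have h1 := h _ hψ ⟨1, hb⟩
    simp only [hP _ hψ] at h1
    rw [← integral_bind_of_bounded κ μ hψ hb, integral_indicator_const _ hs,
      integral_indicator_const _ hs, smul_eq_mul, smul_eq_mul, mul_one, mul_one] at h1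
    exact (measureReal_eq_measureReal_iff).1 h1
  · rintro ⟨hμ, h⟩
    refine ⟨hμ, fun ψ hψ ⟨C, hC⟩ => ?_⟩
    simp only [hP _ hψ]
    rw [← integral_bind_of_bounded κ μ hψ hC, h]

end Operators

/-- An extreme point of the fibre of an ergodic measure is ergodic. -/
lemma mem_ergodicMeasures_of_extreme {Y Z : Type*} [MeasurableSpace Y] [MeasurableSpace Z]
    {P : (Y → ℝ) → Y → ℝ} {P' : (Z → ℝ) → Z → ℝ} {π : Z → Y} (hπ : Measurable π)
    (hP : ∀ ψ : Y → ℝ, ∀ z, P' (fun z => ψ (π z)) z = P ψ (π z))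
    (hPm : ∀ ψ : Y → ℝ, Measurable ψ → (∃ C, ∀ y, |ψ y| ≤ C) → Measurable (P ψ))
    {ν : Measure Y} (hν : ν ∈ ergodicMeasures P) {μ : Measure Z}
    (hμ : μ ∈ {μ ∈ invariantMeasures P' | μ.map π = ν}.extremePoints ℝ≥0∞) :
    μ ∈ ergodicMeasures P' := by
  have hmap : ∀ μ ∈ invariantMeasures P', μ.map π ∈ invariantMeasures P := fun μ' h => by
    have := h.1
    refine ⟨Measure.isProbabilityMeasure_map hπ.aemeasurable, fun ψ hψ ⟨C, hC⟩ => ?_⟩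
    rw [integral_map hπ.aemeasurable (hPm ψ hψ ⟨C, hC⟩).aestronglyMeasurable,
      integral_map hπ.aemeasurable hψ.aestronglyMeasurable]
    have := h.2 _ (hψ.comp hπ) ⟨C, fun z => hC (π z)⟩
    simpa only [Function.comp_def, hP] using this
  refine mem_extremePoints_iff_left.2 ⟨hμ.1.1, fun μ₁ h₁ μ₂ h₂ hseg => ?_⟩
  have hν' := mem_extremePoints_iff_left.1 hν
  -- The projections of the two components are invariant for the base and ν lies between them.
  -- Extremality of ν makes both equal to ν, so the components lie in the fibre, where μ is extreme.
  have hseg' : ν ∈ openSegment ℝ≥0∞ (μ₁.map π) (μ₂.map π) := by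
    obtain ⟨a, b, ha, hb, hab, h⟩ := hseg
    refine ⟨a, b, ha, hb, hab, ?_⟩
    rw [← Measure.map_smul, ← Measure.map_smul, ← Measure.map_add _ _ hπ, h]
    exact hμ.1.2
  have hseg'' : ν ∈ openSegment ℝ≥0∞ (μ₂.map π) (μ₁.map π) := by rwa [openSegment_symm]
  exact (mem_extremePoints_iff_left.1 hμ).2 μ₁
    ⟨h₁, hν'.2 _ (hmap _ h₁) _ (hmap _ h₂) hseg'⟩ μ₂
    ⟨h₂, hν'.2 _ (hmap _ h₂) _ (hmap _ h₁) hseg''⟩ hseg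

/-- The exterior power of the standard Euclidean space. -/
abbrev WedgeSpace (d k : ℕ) := ⋀[ℝ]^k (EuclideanSpace ℝ (Fin d))

lemma measurable_clm_of_apply {α W W' : Type*} [MeasurableSpace α] [NormedAddCommGroup W]
    [InnerProductSpace ℝ W] [FiniteDimensional ℝ W] [NormedAddCommGroup W'] [NormedSpace ℝ W']
    [FiniteDimensional ℝ W'] [MeasurableSpace W'] [BorelSpace W'] {L : α → W →L[ℝ] W'}
    (h : ∀ w, Measurable fun a => L a w) : Measurable L := by
  have : CompleteSpace W' := FiniteDimensional.complete ℝ W'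
  have : SecondCountableTopology (W →L[ℝ] W') :=
    (inferInstance : SecondCountableTopology (W →L[ℝ] W'))
  let b := stdOrthonormalBasis ℝ W
  have hL : ∀ a, L a = ∑ i, ContinuousLinearMap.smulRightL ℝ W W' (innerSL ℝ (b i)) (L a (b i)) :=
      fun a => by
    ext1 w
    conv_lhs => rw [← b.sum_repr w, map_sum]
    rw [sum_apply]
    refine Finset.sum_congr rfl fun i _ => ?_
    rw [map_smul, b.repr_apply_apply]
    rfl
  rw [funext hL]
  exact Finset.measurable_sum _ fun i _ =>
    (ContinuousLinearMap.continuous _).measurable.comp (h (b i))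

lemma measurable_elog_stretch {α V : Type*} [MeasurableSpace α] [NormedAddCommGroup V]
    [NormedSpace ℝ V] [MeasurableSpace V] [BorelSpace V] {L : α → V →L[ℝ] V} (hL : Measurable L)
    (v : V) : Measurable fun a => elog (‖L a v‖ / ‖v‖) :=
  measurable_elog.comp (((ContinuousLinearMap.measurable_apply v).comp hL).norm.div_const _)

/-! ### The bundle morphism in orthonormal frames. -/

namespace EdgeBundleMorphism

variable {T : Type*} [MeasurableSpace T] {X : Type*} [MeasurableSpace X] {d : ℕ} {E : X → Type*}
  [∀ x, NormedAddCommGroup (E x)] [∀ x, InnerProductSpace ℝ (E x)]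
  {B : MeasurableEuclideanBundle d E} (F : EdgeBundleMorphism T B) (Q : Kernel T T)
  [IsMarkovKernel Q]

lemma stepKernel_apply (y : T × X) :
    F.stepKernel Q y = (Q y.1).map fun s => (s, F.base y.1 s y.2) := by
  rw [stepKernel, Kernel.map_apply _ F.measurable_step, Kernel.prod_apply, Kernel.id_apply,
    Kernel.comap_apply, Measure.dirac_prod, Measure.map_map F.measurable_step (by fun_prop)]
  rfl

lemma measurable_step_right (y : T × X) : Measurable fun s => (s, F.base y.1 s y.2) :=
  F.measurable_step.comp measurable_prodMk_left

lemma baseOperator_eq_integral {φ : T × X → ℝ} (hφ : Measurable φ) (y : T × X) :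
    F.baseOperator Q φ y = ∫ w, φ w ∂(F.stepKernel Q y) := by
  rw [stepKernel_apply, integral_map (F.measurable_step_right y).aemeasurable
    hφ.aestronglyMeasurable]
  rfl

variable [∀ x, FiniteDimensional ℝ (E x)] (k : ℕ)

/-- The linear maps `F_{t,s,x}` in the orthonormal frames. -/
def frameMap (y y' : T × X) : EuclideanSpace ℝ (Fin d) →L[ℝ] EuclideanSpace ℝ (Fin d) :=
  LinearMap.toContinuousLinearMap ((B.frame (F.base y.1 y'.1 y.2)).toLinearEquiv.toLinearMap ∘ₗ
    F.lin y.1 y'.1 y.2 ∘ₗ (B.frame y.2).symm.toLinearEquiv.toLinearMap)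

lemma measurable_frame_lin {α : Type*} [MeasurableSpace α] {t s : α → T} {x : α → X}
    (ht : Measurable t) (hs : Measurable s) (hx : Measurable x) (c : EuclideanSpace ℝ (Fin d)) :
    Measurable fun a => B.frame (F.base (t a) (s a) (x a))
      (F.lin (t a) (s a) (x a) ((B.frame (x a)).symm c)) := by
  have h1 : Measurable fun a => (⟨x a, (B.frame (x a)).symm c⟩ : B.Total) :=
    B.measurable_frame_symm_total.comp (hx.prodMk measurable_const)
  have h2 : Measurable fun a => (t a, s a, (⟨x a, (B.frame (x a)).symm c⟩ : B.Total)) :=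
    ht.prodMk (hs.prodMk h1)
  exact B.measurable_frame_total.comp (F.measurable_lin.comp h2)

lemma measurable_frameMap : Measurable fun p : (T × X) × (T × X) => F.frameMap p.1 p.2 :=
  measurable_clm_of_apply fun c => F.measurable_frame_lin measurable_fst.fst measurable_snd.fst
    measurable_fst.snd c

/-- The exterior powers of `F_{t,s,x}` in the orthonormal frames. -/
def wedgeFrameMap (y y' : T × X) : WedgeSpace d k →L[ℝ] WedgeSpace d k :=
  wedgeMap k (F.frameMap y y')

lemma measurable_wedgeFrameMap :
    Measurable fun p : (T × X) × (T × X) => F.wedgeFrameMap k p.1 p.2 :=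
  (continuous_wedgeMap k).measurable.comp F.measurable_frameMap

/-- Functoriality of the exterior power. The target frame is taken at the computed base point, not
at the second component of y', so no compatibility between y and y' is needed. -/
lemma wedgeFrameMap_wedgeIso (y y' : T × X) (v : ⋀[ℝ]^k (E y.2)) :
    F.wedgeFrameMap k y y' (wedgeIso k (B.frame y.2) v)
      = wedgeIso k (B.frame (F.base y.1 y'.1 y.2)) (exteriorPower.map k (F.lin y.1 y'.1 y.2) v) := by
  rw [wedgeFrameMap, wedgeMap_apply, wedgeIso_apply, wedgeIso_apply]
  change (exteriorPower.map k _ ∘ₗ exteriorPower.map k _) v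
    = (exteriorPower.map k _ ∘ₗ exteriorPower.map k _) v
  rw [← exteriorPower.map_comp, ← exteriorPower.map_comp]
  congr 2
  ext1 w
  change B.frame _ (F.lin _ _ _ ((B.frame _).symm (B.frame _ w))) = B.frame _ (F.lin _ _ _ w)
  rw [LinearIsometryEquiv.symm_apply_apply]

lemma wedgeFrameMap_injective (hF : ∀ t s x, Function.Injective (F.lin t s x)) (y y' : T × X) :
    Function.Injective (F.wedgeFrameMap k y y') := by
  have h : Function.Injective ((F.frameMap y y').toLinearMap) :=
    (B.frame (F.base y.1 y'.1 y.2)).injective.comp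
      ((hF y.1 y'.1 y.2).comp (B.frame y.2).symm.injective)
  exact exteriorPower.map_injective_field h

lemma wedgeFrameMap_eq (y y' : T × X) : F.wedgeFrameMap k y y' = wedgeMap k (F.frameMap y y') := rfl

attribute [irreducible] wedgeFrameMap

lemma measurable_wedgeFrameMap_comp {α : Type*} [MeasurableSpace α] (y : T × X) {g : α → T × X}
    (hg : Measurable g) : Measurable fun a => F.wedgeFrameMap k y (g a) := by
  have h : Measurable fun a => (y, g a) := measurable_const.prodMk hg
  exact (F.measurable_wedgeFrameMap k).comp h

/-! ### The annealed operator in coordinates -/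

/-- The kernel of the annealed operator. -/
abbrev projKernel : Kernel (T × B.Proj k) (T × B.Proj k) :=
  (B.projModel k T).kernel (F.stepKernel Q) (F.wedgeFrameMap k)

lemma projMk_wedgeFrameMap (z : T × B.Proj k) (y' : T × X) :
    B.projMk k (F.base z.1 y'.1 z.2.pt) (F.wedgeFrameMap k (z.1, z.2.pt) y' (B.projVec k z.2))
      = ⟨F.base z.1 y'.1 z.2.pt, projAction k (F.lin z.1 y'.1 z.2.pt) z.2.dir⟩ := by
  obtain ⟨a, ha, h⟩ := B.exists_projVec_eq_smul k z.2
  have h1 : F.wedgeFrameMap k (z.1, z.2.pt) y' (wedgeIso k (B.frame z.2.pt) (lineRep z.2.dir))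
      = wedgeIso k (B.frame (F.base z.1 y'.1 z.2.pt))
        (exteriorPower.map k (F.lin z.1 y'.1 z.2.pt) (lineRep z.2.dir)) :=
    F.wedgeFrameMap_wedgeIso k (z.1, z.2.pt) y' (lineRep z.2.dir)
  rw [h, ContinuousLinearMap.map_smul, h1]
  rw [MeasurableEuclideanBundle.projMk, LinearIsometryEquiv.map_smul,
    LinearIsometryEquiv.symm_apply_apply, lineOf_smul ha, projAction_eq_lineOf]

lemma measurable_proj_step (z : T × B.Proj k) : Measurable fun s =>
    (s, (⟨F.base z.1 s z.2.pt, projAction k (F.lin z.1 s z.2.pt) z.2.dir⟩ : B.Proj k)) := by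
  have h : ∀ s, (s, (⟨F.base z.1 s z.2.pt, projAction k (F.lin z.1 s z.2.pt) z.2.dir⟩ : B.Proj k))
      = (B.projModel k T).mk (s, F.base z.1 s z.2.pt) (F.wedgeFrameMap k (z.1, z.2.pt)
        (s, F.base z.1 s z.2.pt) (B.projVec k z.2)) := fun s =>
    Prod.ext rfl (F.projMk_wedgeFrameMap k z (s, F.base z.1 s z.2.pt)).symm
  simp only [h]
  exact ((B.projModel k T).measurable_step (F.measurable_wedgeFrameMap k)).comp
    (measurable_const.prodMk (F.measurable_step_right (z.1, z.2.pt)) :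
      Measurable fun s => (z, (s, F.base z.1 s z.2.pt)))

lemma projKernel_apply (z : T × B.Proj k) : F.projKernel Q k z = (Q z.1).map fun s =>
    (s, (⟨F.base z.1 s z.2.pt, projAction k (F.lin z.1 s z.2.pt) z.2.dir⟩ : B.Proj k)) := by
  rw [projKernel, ProjModel.kernel_apply _ (F.measurable_wedgeFrameMap k)]
  change Measure.map _ (F.stepKernel Q (z.1, z.2.pt)) = _
  have hm : Measurable fun y' => (B.projModel k T).mk y' (F.wedgeFrameMap k
      ((B.projModel k T).base z) y' ((B.projModel k T).vec z)) :=
    ((B.projModel k T).measurable_step (F.measurable_wedgeFrameMap k)).comp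
      (measurable_const.prodMk measurable_id : Measurable fun y' => (z, y'))
  rw [stepKernel_apply, Measure.map_map hm (F.measurable_step_right _)]
  congr 1
  funext s
  exact Prod.ext rfl (F.projMk_wedgeFrameMap k z (s, F.base z.1 s z.2.pt))

lemma annealedOperator_eq_integral {ψ : T × B.Proj k → ℝ} (hψ : Measurable ψ) (z : T × B.Proj k) :
    F.annealedOperator Q k ψ z = ∫ w, ψ w ∂(F.projKernel Q k z) := by
  rw [projKernel_apply, integral_map (F.measurable_proj_step k z).aemeasurable
    hψ.aestronglyMeasurable]
  rfl

lemma logStretch_eq_elog_wedgeFrameMap (z : T × B.Proj k) (s : T) (x' : X) :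
    logStretch k (F.lin z.1 s z.2.pt) z.2.dir
      = elog (‖F.wedgeFrameMap k (z.1, z.2.pt) (s, x') (B.projVec k z.2)‖ / ‖B.projVec k z.2‖) := by
  obtain ⟨a, ha, h⟩ := B.exists_projVec_eq_smul k z.2
  have h1 : F.wedgeFrameMap k (z.1, z.2.pt) (s, x') (wedgeIso k (B.frame z.2.pt) (lineRep z.2.dir))
      = wedgeIso k (B.frame (F.base z.1 s z.2.pt))
        (exteriorPower.map k (F.lin z.1 s z.2.pt) (lineRep z.2.dir)) :=
    F.wedgeFrameMap_wedgeIso k (z.1, z.2.pt) (s, x') (lineRep z.2.dir)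
  rw [h, ContinuousLinearMap.map_smul, h1, norm_smul, norm_smul, LinearIsometryEquiv.norm_map,
    LinearIsometryEquiv.norm_map, mul_div_mul_left _ _ (norm_ne_zero_iff.2 ha),
    logStretch_eq_elog]

lemma measurable_logStretch (z : T × B.Proj k) :
    Measurable fun s => logStretch k (F.lin z.1 s z.2.pt) z.2.dir := by
  have h1 := F.measurable_wedgeFrameMap_comp k (z.1, z.2.pt)
    (F.measurable_step_right (z.1, z.2.pt))
  exact (measurable_elog_stretch h1 (B.projVec k z.2)).congr_fun fun s =>
    (F.logStretch_eq_elog_wedgeFrameMap k z s (F.base z.1 s z.2.pt)).symm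

lemma annealedPotential_eq : F.annealedPotential Q k
    = (B.projModel k T).potential (F.stepKernel Q) (F.wedgeFrameMap k) := by
  funext z
  have hm : Measurable fun y' => elog (‖F.wedgeFrameMap k (z.1, z.2.pt) y' (B.projVec k z.2)‖
      / ‖B.projVec k z.2‖) := by
    have h1 := F.measurable_wedgeFrameMap_comp k (z.1, z.2.pt) measurable_id
    exact measurable_elog_stretch h1 (B.projVec k z.2)
  change extIntegral (Q z.1) _ = extIntegral (F.stepKernel Q (z.1, z.2.pt)) fun y' =>
    elog (‖F.wedgeFrameMap k (z.1, z.2.pt) y' (B.projVec k z.2)‖ / ‖B.projVec k z.2‖)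
  rw [stepKernel_apply, extIntegral_map (F.measurable_step_right _) hm]
  congr 1
  funext s
  exact F.logStretch_eq_elog_wedgeFrameMap k z s (F.base z.1 s z.2.pt)

instance : IsMarkovKernel (F.projKernel Q k) :=
  (B.projModel k T).isMarkovKernel_kernel (F.measurable_wedgeFrameMap k)

lemma invariantLifts_eq (ν : Measure (T × X)) : F.invariantLifts Q ν k
    = (B.projModel k T).lifts (F.stepKernel Q) (F.wedgeFrameMap k) ν := by
  ext μ
  change μ ∈ invariantMeasures _ ∧ _ ↔ _
  rw [mem_invariantMeasures_iff fun ψ hψ z => F.annealedOperator_eq_integral Q k hψ z, and_assoc]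
  rfl

lemma cemetery_eq : F.cemetery k = (B.projModel k T).dead := by
  ext z
  obtain ⟨a, ha, h⟩ := B.exists_projVec_eq_smul k z.2
  change z.2.dir = none ↔ B.projVec k z.2 = 0
  rw [h, smul_eq_zero, or_iff_right ha, LinearIsometryEquiv.map_eq_zero_iff, lineRep_eq_zero_iff]

/-- At a line that is killed with positive probability the integrand is -∞ on a set of positive
measure, which forces the extended integral to be -∞; at a cemetery point it is -∞ identically. -/
lemma degeneracyLocus_subset : F.degeneracyLocus Q k ⊆ {z | F.annealedPotential Q k z = ⊥} := by
  rintro z (hz | ⟨p, hp, hz⟩)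
  · rw [cemetery_eq] at hz
    change F.annealedPotential Q k z = ⊥
    rw [annealedPotential_eq]
    exact ProjModel.potential_eq_bot _ hz
  · refine extIntegral_eq_bot_of_measure_ne_zero (ne_of_gt (hz.trans_le (measure_mono fun s hs => ?_)))
      (F.measurable_logStretch k z)
    have hs' : exteriorPower.map k (F.lin z.1 s z.2.pt) p.rep = 0 := hs
    change logStretch k (F.lin z.1 s z.2.pt) z.2.dir = ⊥
    rw [hp]
    simp [logStretch, hs']

end EdgeBundleMorphism

/-! ### Growth of the exterior powers of the cocycle -/

namespace EdgeBundleMorphism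

variable {T : Type*} [MeasurableSpace T] {X : Type*} [MeasurableSpace X] {d : ℕ} {E : X → Type*}
  [∀ x, NormedAddCommGroup (E x)] [∀ x, InnerProductSpace ℝ (E x)]
  {B : MeasurableEuclideanBundle d E} (F : EdgeBundleMorphism T B) (Q : Kernel T T)
  [IsMarkovKernel Q]

/-- The chain `(t_n, x_n)` driven by `((t_n)_n, x_0)`. -/
def orbit (w : (ℕ → T) × X) (n : ℕ) : T × X := (((F.skew)^[n] w).1 0, ((F.skew)^[n] w).2)

lemma measurable_skew : Measurable F.skew := by
  refine Measurable.prodMk (measurable_pi_iff.2 fun n => (measurable_pi_apply _).comp measurable_fst) ?_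
  have h : Measurable fun z : (ℕ → T) × X => (z.1 0, z.1 1, z.2) :=
    ((measurable_pi_apply 0).comp measurable_fst).prodMk
      (((measurable_pi_apply 1).comp measurable_fst).prodMk measurable_snd)
  exact F.measurable_base.comp h

lemma measurable_orbit : Measurable F.orbit := by
  refine measurable_pi_iff.2 fun n => ?_
  have h := F.measurable_skew.iterate n
  exact ((measurable_pi_apply 0).comp (measurable_fst.comp h)).prodMk (measurable_snd.comp h)

lemma skew_iterate_fst (w : (ℕ → T) × X) (n i : ℕ) : ((F.skew)^[n] w).1 i = w.1 (i + n) := by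
  induction n generalizing w with
  | zero => rfl
  | succ n ih => rw [Function.iterate_succ_apply, ih]; rfl

lemma orbit_eq {z : ℕ → T × X} (h : ∀ n, (z (n + 1)).2 = F.base (z n).1 (z (n + 1)).1 (z n).2) :
    F.orbit (fun n => (z n).1, (z 0).2) = z := by
  funext n
  refine Prod.ext ?_ ?_
  · rw [orbit, skew_iterate_fst, zero_add]
  · induction n with
    | zero => rfl
    | succ n ih =>
      have ih' : ((F.skew)^[n] (fun n => (z n).1, (z 0).2)).2 = (z n).2 := ih
      change ((F.skew)^[n + 1] (fun n => (z n).1, (z 0).2)).2 = _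
      rw [Function.iterate_succ_apply', skew, ih', skew_iterate_fst, skew_iterate_fst, h n]
      simp only [zero_add, add_comm 1 n]

/-- The kernel chooses only s; the next point of X is then f_{t,s}(x). Almost surely this holds
along all edges, so the chain is recovered from (t_n) and x_0. This identifies integrals over the
driving measure with integrals over the path law. -/
lemma ae_orbit_eq [StandardBorelSpace X] {ν : Measure (T × X)} [IsProbabilityMeasure ν]
    (hν : F.stepKernel Q ∘ₘ ν = ν) :
    ∀ᵐ z ∂(F.chainMeasure Q ν), F.orbit (fun n => (z n).1, (z 0).2) = z := by
  have hS : MeasurableSet {p : (T × X) × (T × X) | p.2.2 = F.base p.1.1 p.2.1 p.1.2} :=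
    measurableSet_eq_fun measurable_snd.snd (F.measurable_base.comp
      (measurable_fst.fst.prodMk (measurable_snd.fst.prodMk measurable_fst.snd)))
  have h1 : ∀ᵐ p ∂(ν ⊗ₘ F.stepKernel Q), p.2.2 = F.base p.1.1 p.2.1 p.1.2 := by
    refine (Measure.ae_compProd_iff hS).2 (ae_of_all _ fun y => ?_)
    rw [stepKernel_apply]
    refine (ae_map_iff (F.measurable_step_right y).aemeasurable ?_).2 (ae_of_all _ fun s => rfl)
    exact measurable_prodMk_left hS
  have h2 : ∀ n, ∀ᵐ z ∂(F.chainMeasure Q ν),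
      (z (n + 1)).2 = F.base (z n).1 (z (n + 1)).1 (z n).2 := fun n => by
    have h3 := markovChain_map_edge hν n
    rw [← h3] at h1
    exact ae_of_ae_map (((measurable_pi_apply n).prodMk (measurable_pi_apply (n + 1))).aemeasurable) h1
  filter_upwards [ae_all_iff.2 h2] with z hz using F.orbit_eq hz

lemma measurable_history : Measurable fun z : ℕ → T × X => ((fun n => (z n).1, (z 0).2) :
    (ℕ → T) × X) :=
  Measurable.prodMk (measurable_pi_iff.2 fun n => measurable_fst.comp (measurable_pi_apply n))
    (measurable_snd.comp (measurable_pi_apply 0))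

lemma drivingMeasure_map_orbit [StandardBorelSpace X] {ν : Measure (T × X)} [IsProbabilityMeasure ν]
    (hν : F.stepKernel Q ∘ₘ ν = ν) :
    (F.drivingMeasure Q ν).map F.orbit = markovChain (F.stepKernel Q) ν := by
  rw [drivingMeasure, Measure.map_map F.measurable_orbit measurable_history]
  have h := F.ae_orbit_eq Q hν
  have h' : F.orbit ∘ (fun z : ℕ → T × X => ((fun n => (z n).1, (z 0).2) : (ℕ → T) × X))
      =ᵐ[F.chainMeasure Q ν] id := h
  rw [Measure.map_congr h', Measure.map_id]
  rfl

variable [∀ x, FiniteDimensional ℝ (E x)] (k : ℕ)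

lemma pathProd_orbit (n : ℕ) (w : (ℕ → T) × X) (v : ⋀[ℝ]^k (E w.2)) :
    pathProd (F.wedgeFrameMap k) n (F.orbit w) (wedgeIso k (B.frame w.2) v)
      = wedgeIso k (B.frame ((F.skew)^[n] w).2) (exteriorPower.map k (F.iter n w) v) := by
  induction n generalizing w with
  | zero =>
    change wedgeIso k (B.frame w.2) v = wedgeIso k (B.frame w.2) (exteriorPower.map k LinearMap.id v)
    rw [exteriorPower.map_id]
    rfl
  | succ n ih =>
    -- `iter` peels off the first step while `pathProd` peels off the last one, so the product is
    -- split at time 1.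
    have h1 : pathProd (F.wedgeFrameMap k) (n + 1) (F.orbit w)
        = pathProd (F.wedgeFrameMap k) n (F.orbit (F.skew w)) ∘L
          F.wedgeFrameMap k (F.orbit w 0) (F.orbit w 1) := by
      rw [add_comm, pathProd_add]
      rfl
    have h2 : F.wedgeFrameMap k (F.orbit w 0) (F.orbit w 1) (wedgeIso k (B.frame w.2) v)
        = wedgeIso k (B.frame (F.skew w).2) (exteriorPower.map k (F.cocycle w) v) :=
      F.wedgeFrameMap_wedgeIso k (F.orbit w 0) (F.orbit w 1) v
    rw [h1, ContinuousLinearMap.comp_apply, h2, ih (F.skew w)]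
    change _ = wedgeIso k (B.frame ((F.skew)^[n] (F.skew w)).2)
      (exteriorPower.map k (F.iter n (F.skew w) ∘ₗ F.cocycle w) v)
    rw [exteriorPower.map_comp]
    rfl

lemma logWedgeNorm_iter (n : ℕ) (w : (ℕ → T) × X) :
    logWedgeNorm k (F.iter n w) = elog ‖pathProd (F.wedgeFrameMap k) n (F.orbit w)‖ := by
  rw [← linOpNorm_eq_of_intertwine (wedgeIso k (B.frame w.2))
    (wedgeIso k (B.frame ((F.skew)^[n] w).2)) (exteriorPower.map k (F.iter n w))
    (pathProd (F.wedgeFrameMap k) n (F.orbit w)) (F.pathProd_orbit k n w)]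
  rfl

lemma linOpNorm_cocycle (w : (ℕ → T) × X) :
    linOpNorm (F.cocycle w) = ‖F.frameMap (F.orbit w 0) (F.orbit w 1)‖ := by
  refine linOpNorm_eq_of_intertwine (B.frame w.2) (B.frame (F.skew w).2) _ _ fun v => ?_
  change B.frame (F.skew w).2 (F.cocycle w ((B.frame w.2).symm (B.frame w.2 v))) = _
  rw [LinearIsometryEquiv.symm_apply_apply]

variable {ν : Measure (T × X)} [IsProbabilityMeasure ν]

lemma meanGrowth_eq [StandardBorelSpace X] (hν : F.stepKernel Q ∘ₘ ν = ν) (n : ℕ) :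
    F.meanGrowth Q ν k n
      = (((n : ℝ)⁻¹ : ℝ) : EReal) * pathGrowth (F.stepKernel Q) ν (F.wedgeFrameMap k) n := by
  rw [meanGrowth, pathGrowth, ← F.drivingMeasure_map_orbit Q hν]
  have hm : Measurable fun z => elog ‖pathProd (F.wedgeFrameMap k) n z‖ :=
    measurable_elog.comp (measurable_pathProd (F.measurable_wedgeFrameMap k) n).norm
  rw [extIntegral_map F.measurable_orbit hm]
  simp only [logWedgeNorm_iter]

omit [∀ x, FiniteDimensional ℝ (E x)] in
lemma lintegral_edge_orbit [StandardBorelSpace X] (hν : F.stepKernel Q ∘ₘ ν = ν)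
    {g : (T × X) × (T × X) → ℝ≥0∞} (hg : Measurable g) :
    ∫⁻ p, g p ∂(ν ⊗ₘ F.stepKernel Q)
      = ∫⁻ w, g (F.orbit w 0, F.orbit w 1) ∂(F.drivingMeasure Q ν) := by
  have he : Measurable fun z : ℕ → T × X => (z 0, z (0 + 1)) :=
    (measurable_pi_apply 0).prodMk (measurable_pi_apply (0 + 1))
  rw [← markovChain_map_edge hν 0, lintegral_map hg he, ← F.drivingMeasure_map_orbit Q hν]
  exact lintegral_map (hg.comp he) F.measurable_orbit

lemma lintegral_posLog_frameMap_ne_top [StandardBorelSpace X] (hν : F.stepKernel Q ∘ₘ ν = ν)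
    (hint : Integrable (fun z : (ℕ → T) × X => Real.posLog (linOpNorm (F.cocycle z)))
      (F.drivingMeasure Q ν)) :
    ∫⁻ p, ENNReal.ofReal (Real.posLog ‖F.frameMap p.1 p.2‖) ∂(ν ⊗ₘ F.stepKernel Q) ≠ ⊤ := by
  have hm : Measurable fun p : (T × X) × (T × X) =>
      ENNReal.ofReal (Real.posLog ‖F.frameMap p.1 p.2‖) :=
    (Real.continuous_posLog.measurable.comp F.measurable_frameMap.norm).ennreal_ofReal
  rw [F.lintegral_edge_orbit Q hν hm]
  simp only [← linOpNorm_cocycle]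
  exact hint.lintegral_lt_top.ne

lemma lintegral_posLog_wedgeFrameMap_ne_top
    (hint : ∫⁻ p, ENNReal.ofReal (Real.posLog ‖F.frameMap p.1 p.2‖) ∂(ν ⊗ₘ F.stepKernel Q) ≠ ⊤) :
    ∫⁻ p, ENNReal.ofReal (Real.posLog ‖F.wedgeFrameMap k p.1 p.2‖) ∂(ν ⊗ₘ F.stepKernel Q) ≠ ⊤ := by
  obtain ⟨C, hC0, hC⟩ := exists_norm_wedgeMap_le (W := EuclideanSpace ℝ (Fin d))
    (W' := EuclideanSpace ℝ (Fin d)) k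
  have h : ∀ p : (T × X) × (T × X), ENNReal.ofReal (Real.posLog ‖F.wedgeFrameMap k p.1 p.2‖)
      ≤ ENNReal.ofReal (Real.posLog C) + k * ENNReal.ofReal (Real.posLog ‖F.frameMap p.1 p.2‖) :=
      fun p => by
    rw [wedgeFrameMap_eq, ← ENNReal.ofReal_natCast, ← ENNReal.ofReal_mul (Nat.cast_nonneg k),
      ← ENNReal.ofReal_add Real.posLog_nonneg (mul_nonneg (Nat.cast_nonneg k) Real.posLog_nonneg)]
    refine ENNReal.ofReal_le_ofReal ?_
    refine (Real.posLog_le_posLog (ContinuousLinearMap.opNorm_nonneg _) (hC _)).trans ?_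
    refine Real.posLog_mul.trans ?_
    rw [Real.posLog_pow]
  refine ne_top_of_le_ne_top ?_ (lintegral_mono h)
  rw [lintegral_add_left measurable_const, lintegral_const, lintegral_const_mul' _ _ (ENNReal.natCast_ne_top k)]
  exact ENNReal.add_ne_top.2 ⟨ENNReal.mul_ne_top ENNReal.ofReal_ne_top (measure_ne_top _ _),
    ENNReal.mul_ne_top (ENNReal.natCast_ne_top k) hint⟩

lemma pathProd_wedgeFrameMap (n : ℕ) (z : ℕ → T × X) :
    pathProd (F.wedgeFrameMap k) n z = wedgeMap k (pathProd F.frameMap n z) := by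
  induction n with
  | zero => exact (wedgeMap_id k).symm
  | succ n ih =>
    change F.wedgeFrameMap k (z n) (z (n + 1)) ∘L pathProd (F.wedgeFrameMap k) n z
      = wedgeMap k (F.frameMap (z n) (z (n + 1)) ∘L pathProd F.frameMap n z)
    rw [ih, wedgeFrameMap_eq, wedgeMap_comp]

/-- Integrating the logarithm of ‖⋀^{k+1} L‖ ≤ C ‖L‖ ‖⋀^k L‖ for the n-step product: log⁺ C is paid
once, and log‖L‖ costs at most I per step by stationarity. -/
lemma exists_pathGrowth_succ_le (hν : F.stepKernel Q ∘ₘ ν = ν)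
    (hint : ∫⁻ p, ENNReal.ofReal (Real.posLog ‖F.frameMap p.1 p.2‖) ∂(ν ⊗ₘ F.stepKernel Q) ≠ ⊤) :
    ∃ C I : ℝ, 0 ≤ C ∧ ∀ n, pathGrowth (F.stepKernel Q) ν (F.wedgeFrameMap (k + 1)) n
      ≤ (C + n * I : ℝ) + pathGrowth (F.stepKernel Q) ν (F.wedgeFrameMap k) n := by
  obtain ⟨C, hC0, hC⟩ := exists_norm_wedgeMap_succ_le (W := EuclideanSpace ℝ (Fin d))
    (W' := EuclideanSpace ℝ (Fin d)) k
  set I := ∫⁻ p, ENNReal.ofReal (Real.posLog ‖F.frameMap p.1 p.2‖) ∂(ν ⊗ₘ F.stepKernel Q) with hI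
  refine ⟨Real.posLog C, I.toReal, Real.posLog_nonneg, fun n => ?_⟩
  have hm0 : Measurable fun z => elog ‖pathProd F.frameMap n z‖ :=
    measurable_elog.comp (measurable_pathProd F.measurable_frameMap n).norm
  have hmk : Measurable fun z => elog ‖pathProd (F.wedgeFrameMap k) n z‖ :=
    measurable_elog.comp (measurable_pathProd (F.measurable_wedgeFrameMap k) n).norm
  have h0 := lintegral_posLog_pathProd_le hν F.measurable_frameMap n
  have h0' : ∫⁻ z, (elog ‖pathProd F.frameMap n z‖).toENNReal ∂(markovChain (F.stepKernel Q) ν) ≠ ⊤ :=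
    ne_top_of_le_ne_top (ENNReal.mul_ne_top (ENNReal.natCast_ne_top n) hint) h0
  have hk' : ∫⁻ z, (elog ‖pathProd (F.wedgeFrameMap k) n z‖).toENNReal
      ∂(markovChain (F.stepKernel Q) ν) ≠ ⊤ :=
    ne_top_of_le_ne_top (ENNReal.mul_ne_top (ENNReal.natCast_ne_top n)
      (F.lintegral_posLog_wedgeFrameMap_ne_top Q k hint))
      (lintegral_posLog_pathProd_le hν (F.measurable_wedgeFrameMap k) n)
  have hc' : ∫⁻ _, (elog C).toENNReal ∂(markovChain (F.stepKernel Q) ν) ≠ ⊤ := by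
    rw [lintegral_const, measure_univ, mul_one, toENNReal_elog C hC0.le]
    exact ENNReal.ofReal_ne_top
  have hle : ∀ z, elog ‖pathProd (F.wedgeFrameMap (k + 1)) n z‖
      ≤ (elog C + elog ‖pathProd F.frameMap n z‖) + elog ‖pathProd (F.wedgeFrameMap k) n z‖ :=
      fun z => by
    rw [← elog_mul hC0.le, ← elog_mul (mul_nonneg hC0.le (norm_nonneg _)), mul_assoc,
      pathProd_wedgeFrameMap, pathProd_wedgeFrameMap]
    exact elog_mono (hC _)
  have hm1 : Measurable fun z => elog C + elog ‖pathProd F.frameMap n z‖ := measurable_const.add hm0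
  have h1' : ∫⁻ z, (elog C + elog ‖pathProd F.frameMap n z‖).toENNReal
      ∂(markovChain (F.stepKernel Q) ν) ≠ ⊤ := by
    refine ne_top_of_le_ne_top ?_ (lintegral_mono fun z => EReal.toENNReal_add_le)
    rw [lintegral_add_left measurable_const]
    exact ENNReal.add_ne_top.2 ⟨hc', h0'⟩
  have h2 : extIntegral (markovChain (F.stepKernel Q) ν) (fun z => elog ‖pathProd F.frameMap n z‖)
      ≤ ((n * I.toReal : ℝ) : EReal) := by
    refine (extIntegral_le_lintegral _).trans ((EReal.coe_ennreal_le_coe_ennreal_iff.2 h0).trans ?_)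
    rw [← hI, ← ENNReal.ofReal_toReal hint, ← ENNReal.ofReal_natCast,
      ← ENNReal.ofReal_mul (Nat.cast_nonneg n), EReal.coe_ennreal_ofReal, max_eq_left (by positivity),
      ENNReal.toReal_ofReal ENNReal.toReal_nonneg]
  refine (extIntegral_mono_ae (ae_of_all _ hle)).trans ?_
  rw [extIntegral_add hm1 hmk h1' hk', extIntegral_add measurable_const hm0 hc' h0', extIntegral_const]
  refine add_le_add_left ?_ _
  rw [EReal.coe_add]
  exact add_le_add (elog_le_posLog C hC0.le) h2

/-- After division by n ≥ 1 the excess of the growth at k + 1 over the growth at k is at most C + I,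
uniformly in n. -/
lemma pathRate_succ_eq_bot (hν : F.stepKernel Q ∘ₘ ν = ν)
    (hint : ∫⁻ p, ENNReal.ofReal (Real.posLog ‖F.frameMap p.1 p.2‖) ∂(ν ⊗ₘ F.stepKernel Q) ≠ ⊤)
    (h : pathRate (F.stepKernel Q) ν (F.wedgeFrameMap k) = ⊥) :
    pathRate (F.stepKernel Q) ν (F.wedgeFrameMap (k + 1)) = ⊥ := by
  obtain ⟨C, I, hC, hle⟩ := F.exists_pathGrowth_succ_le Q k hν hint
  have key : ∀ n : ℕ, 1 ≤ n →
      (((n : ℝ)⁻¹ : ℝ) : EReal) * pathGrowth (F.stepKernel Q) ν (F.wedgeFrameMap (k + 1)) n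
        ≤ ((C + I : ℝ) : EReal)
          + (((n : ℝ)⁻¹ : ℝ) : EReal) * pathGrowth (F.stepKernel Q) ν (F.wedgeFrameMap k) n :=
      fun n hn => by
    have hn' : (0 : ℝ) < n := by exact_mod_cast hn
    have hn0 : (0 : EReal) ≤ (((n : ℝ)⁻¹ : ℝ) : EReal) := by exact_mod_cast (inv_pos.2 hn').le
    refine (mul_le_mul_of_nonneg_left (hle n) hn0).trans ?_
    rw [EReal.left_distrib_of_nonneg_of_ne_top hn0 (EReal.coe_ne_top _), ← EReal.coe_mul]
    refine add_le_add_left (EReal.coe_le_coe_iff.2 ?_) _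
    rw [mul_add, ← mul_assoc, inv_mul_cancel₀ hn'.ne', one_mul]
    have h1 : (n : ℝ)⁻¹ * C ≤ C :=
      mul_le_of_le_one_left hC (inv_le_one_of_one_le₀ (by exact_mod_cast hn))
    linarith
  refine (EReal.eq_bot_iff_forall_lt _).2 fun r => ?_
  have h1 : pathRate (F.stepKernel Q) ν (F.wedgeFrameMap k) < ((r - (C + I) : ℝ) : EReal) := by
    rw [h]; exact EReal.bot_lt_coe _
  obtain ⟨⟨n, hn⟩, hlt⟩ := iInf_lt_iff.1 h1
  calc pathRate (F.stepKernel Q) ν (F.wedgeFrameMap (k + 1))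
      ≤ (((n : ℝ)⁻¹ : ℝ) : EReal) * pathGrowth (F.stepKernel Q) ν (F.wedgeFrameMap (k + 1)) n :=
        iInf_le (fun n : {n : ℕ // 1 ≤ n} => (((n : ℝ)⁻¹ : ℝ) : EReal)
          * pathGrowth (F.stepKernel Q) ν (F.wedgeFrameMap (k + 1)) n) ⟨n, hn⟩
    _ ≤ _ := key n hn
    _ < ((C + I : ℝ) : EReal) + ((r - (C + I) : ℝ) : EReal) := EReal.add_lt_add_left_coe hlt _
    _ = r := by rw [← EReal.coe_add]; congr 1; ring

lemma tendsto_meanGrowth [StandardBorelSpace X] (hν : F.stepKernel Q ∘ₘ ν = ν)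
    (hint : ∫⁻ p, ENNReal.ofReal (Real.posLog ‖F.frameMap p.1 p.2‖) ∂(ν ⊗ₘ F.stepKernel Q) ≠ ⊤) :
    Tendsto (fun n => F.meanGrowth Q ν k n) atTop
      (𝓝 (pathRate (F.stepKernel Q) ν (F.wedgeFrameMap k))) := by
  simp only [F.meanGrowth_eq Q k hν]
  exact tendsto_pathGrowth hν (F.measurable_wedgeFrameMap k)
    (F.lintegral_posLog_wedgeFrameMap_ne_top Q k hint)

lemma growthRate_eq [StandardBorelSpace X] (hν : F.stepKernel Q ∘ₘ ν = ν)
    (hint : ∫⁻ p, ENNReal.ofReal (Real.posLog ‖F.frameMap p.1 p.2‖) ∂(ν ⊗ₘ F.stepKernel Q) ≠ ⊤)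
    (hk : 1 ≤ k) :
    F.growthRate Q ν k = pathRate (F.stepKernel Q) ν (F.wedgeFrameMap k) := by
  rw [growthRate, if_neg (by omega)]
  exact (F.tendsto_meanGrowth Q k hν hint).limsup_eq

/-- The sum telescopes as long as Σ_k is finite. Once it is -∞ the next exponent is -∞ by
convention, which agrees with Σ_{k+1} = -∞ by `pathRate_succ_eq_bot`. -/
lemma sum_lyapunov [StandardBorelSpace X] (hν : F.stepKernel Q ∘ₘ ν = ν)
    (hint : ∫⁻ p, ENNReal.ofReal (Real.posLog ‖F.frameMap p.1 p.2‖) ∂(ν ⊗ₘ F.stepKernel Q) ≠ ⊤) :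
    ∑ i ∈ Finset.Icc 1 k, F.lyapunov Q ν i = F.growthRate Q ν k := by
  induction k with
  | zero => simp [growthRate]
  | succ k ih =>
    rw [Finset.sum_Icc_succ_top (by omega), ih, lyapunov, Nat.add_sub_cancel]
    have htop : F.growthRate Q ν k ≠ ⊤ := by
      rcases Nat.eq_zero_or_pos k with rfl | hk
      · simp [growthRate]
      · rw [F.growthRate_eq Q k hν hint hk]
        exact pathRate_ne_top hν (F.measurable_wedgeFrameMap k)
          (F.lintegral_posLog_wedgeFrameMap_ne_top Q k hint)
    split_ifs with hb
    · rcases Nat.eq_zero_or_pos k with rfl | hk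
      · simp [growthRate] at hb
      · rw [EReal.add_bot, F.growthRate_eq Q (k + 1) hν hint (by omega)]
        rw [F.growthRate_eq Q k hν hint hk] at hb
        exact (F.pathRate_succ_eq_bot Q k hν hint hb).symm
    · rw [add_comm]
      rw [← EReal.coe_toReal htop hb]
      exact EReal.sub_add_cancel

end EdgeBundleMorphism

/-! ### Invariance and ergodicity over the base. -/

namespace EdgeBundleMorphism

variable {T : Type*} [MeasurableSpace T] {X : Type*} [MeasurableSpace X] {d : ℕ} {E : X → Type*}
  [∀ x, NormedAddCommGroup (E x)] [∀ x, InnerProductSpace ℝ (E x)]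
  {B : MeasurableEuclideanBundle d E} (F : EdgeBundleMorphism T B) (Q : Kernel T T)
  [IsMarkovKernel Q]

lemma measurable_baseOperator {φ : T × X → ℝ} (hφ : Measurable φ) :
    Measurable (F.baseOperator Q φ) := by
  rw [funext (F.baseOperator_eq_integral Q hφ)]
  exact hφ.stronglyMeasurable.integral_kernel.measurable

lemma mem_ergodicMeasures_of_mem_extremePoints {ν : Measure (T × X)}
    (hν : ν ∈ ergodicMeasures (F.baseOperator Q)) {k : ℕ} {μ : Measure (T × B.Proj k)}
    (hμ : μ ∈ (F.invariantLifts Q ν k).extremePoints ℝ≥0∞) :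
    μ ∈ ergodicMeasures (F.annealedOperator Q k) :=
  mem_ergodicMeasures_of_extreme (π := fun z : T × B.Proj k => (z.1, z.2.pt))
    (measurable_fst.prodMk ((B.measurable_proj_pt k).comp measurable_snd)) (fun _ _ => rfl)
    (fun _ hψ _ => F.measurable_baseOperator Q hψ) hν hμ

lemma stepKernel_comp_of_mem_invariantMeasures {ν : Measure (T × X)}
    (hν : ν ∈ invariantMeasures (F.baseOperator Q)) : F.stepKernel Q ∘ₘ ν = ν :=
  ((mem_invariantMeasures_iff fun _ hψ z => F.baseOperator_eq_integral Q hψ z).1 hν).2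

end EdgeBundleMorphism

end

/-! ### The variational formula. -/

theorem mainTheorem7 {T X : Type*} [MeasurableSpace T] [StandardBorelSpace T]
    [MeasurableSpace X] [StandardBorelSpace X] {d : ℕ} {E : X → Type*}
    [∀ x, NormedAddCommGroup (E x)] [∀ x, InnerProductSpace ℝ (E x)]
    [∀ x, FiniteDimensional ℝ (E x)]
    (B : MeasurableEuclideanBundle d E) (F : EdgeBundleMorphism T B)
    (Q : Kernel T T) [IsMarkovKernel Q] (ν : Measure (T × X))
    (hν : ν ∈ invariantMeasures (F.baseOperator Q))
    (hint : Integrable (fun z : (ℕ → T) × X => Real.posLog (linOpNorm (F.cocycle z)))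
      (F.drivingMeasure Q ν))
    (k : ℕ) (hk : 1 ≤ k) (hkd : k ≤ d) :
    Tendsto (fun n => F.meanGrowth Q ν k n) atTop
        (𝓝 (∑ i ∈ Finset.Icc 1 k, F.lyapunov Q ν i)) ∧
    ∑ i ∈ Finset.Icc 1 k, F.lyapunov Q ν i =
        sSup ((fun μ => extIntegral μ (F.annealedPotential Q k)) '' F.invariantLifts Q ν k) ∧
    (∃ μ ∈ (F.invariantLifts Q ν k).extremePoints ℝ≥0∞,
        extIntegral μ (F.annealedPotential Q k) = ∑ i ∈ Finset.Icc 1 k, F.lyapunov Q ν i ∧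
        (ν ∈ ergodicMeasures (F.baseOperator Q) →
          μ ∈ ergodicMeasures (F.annealedOperator Q k)) ∧
        ((∀ t s x, Function.Injective (F.lin t s x)) → μ (F.cemetery k) = 0)) ∧
    ∀ μ ∈ F.invariantLifts Q ν k,
        extIntegral μ (F.annealedPotential Q k) = ∑ i ∈ Finset.Icc 1 k, F.lyapunov Q ν i →
        F.lyapunov Q ν k ≠ ⊥ →
        μ (F.degeneracyLocus Q k) = 0 ∧ μ {z | F.annealedPotential Q k z = ⊥} = 0 := by
  have := hν.1
  -- The bound k ≤ d makes the exterior power nonzero, so that its unit sphere is not empty.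
  have : Nontrivial (WedgeSpace d k) := nontrivial_exteriorPower hkd
  have hν' := F.stepKernel_comp_of_mem_invariantMeasures Q hν
  have hintF := F.lintegral_posLog_frameMap_ne_top Q hν' hint
  have hintk := F.lintegral_posLog_wedgeFrameMap_ne_top Q k hintF
  have hA := F.measurable_wedgeFrameMap k
  have hsum := (F.sum_lyapunov Q k hν' hintF).trans (F.growthRate_eq Q k hν' hintF hk)
  have hle : ∀ μ ∈ F.invariantLifts Q ν k, extIntegral μ (F.annealedPotential Q k)
      ≤ pathRate (F.stepKernel Q) ν (F.wedgeFrameMap k) := fun μ hμ => by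
    rw [F.invariantLifts_eq] at hμ
    rw [F.annealedPotential_eq]
    exact ProjModel.extIntegral_potential_le _ hA hintk hν' hμ
  obtain ⟨μ, hμ, hμe, hμd⟩ := (B.projModel k T).exists_extremePoint_eq_pathRate hA hintk hν'
  rw [← F.invariantLifts_eq] at hμ
  rw [← F.annealedPotential_eq] at hμe
  rw [hsum]
  refine ⟨F.tendsto_meanGrowth Q k hν' hintF, ?_, ⟨μ, hμ, hμe, fun h =>
    F.mem_ergodicMeasures_of_mem_extremePoints Q h hμ, fun h => ?_⟩, fun μ' hμ' he hb => ?_⟩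
  · refine le_antisymm ?_ (sSup_le ?_)
    · exact hμe ▸ le_sSup (Set.mem_image_of_mem _ hμ.1)
    · rintro _ ⟨μ', hμ', rfl⟩
      exact hle μ' hμ'
  · rw [F.cemetery_eq]
    exact hμd fun y y' => F.wedgeFrameMap_injective k h y y'
  -- A maximizer has integral Σ_k. If this were -∞, the exponent λ_k would be -∞ in both branches of
  -- its definition.
  · have hbot : extIntegral μ' (F.annealedPotential Q k) ≠ ⊥ := fun h0 => by
      rw [he, ← F.growthRate_eq Q k hν' hintF hk] at h0
      refine hb ?_
      rw [EdgeBundleMorphism.lyapunov, h0]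
      split_ifs with h1
      · rfl
      · exact EReal.bot_sub _
    have hm : Measurable (F.annealedPotential Q k) := by
      rw [F.annealedPotential_eq]
      exact ProjModel.measurable_potential _ hA
    have hnull := measure_eq_bot_of_extIntegral hm hbot
    exact ⟨measure_mono_null (F.degeneracyLocus_subset Q k) hnull, hnull⟩
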